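/- \textbf{Setting.} Let $X$ be a measurable space, let $H$ be a class of hypotheses $h:X\to\{-1,1\}$ of VC dimension at most $d$ ($d\ge1$), and let $D_1,\dots,D_k$ be probability distributions on $X\times\{-1,1\}$ with average $D=\frac1k\sum_{i=1}^kD_i$. Assume the usual measurability condition: all $h\in H$ are measurable and there is a countable $H_0\subseteq H$ such that each $h\in H$ is the pointwise limit of a sequence in $H_0$. For a probability distribution $P$ on $X\times\{-1,1\}$ put $err_P(h)=P(h(x)\ne y)$ and $err_P(H)=\inf_{h\in H}err_P(h)$. A $\beta$-weak agnostic learner for $H$ returns, for every probability distribution $P$ on $X\times\{-1,1\}$, a hypothesis $h\in H$ with $err_P(h)\le err_P(H)+\beta$. There are $k$ entities and a center; entity $i$ can sample from $D_i$. Communication is counted in words (a number is one word, a hypothesis is $d$ words); transmitted examples are counted separately. \textbf{Distributed boosting algorithm} (parameters: sample size $N$, rounds $T$, examples per round $m$, smoothness $\kappa\in(0,1]$). Let $\gamma=\frac12(\frac12-\beta)$. Each entity $i$ draws $s=\lfloor N/k\rfloor+1$ independent examples $S_i$ from $D_i$ (so $n=ks$ in total) and gives each of them weight $1/s$. In each round: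 every entity sends its sum of weights; the center assigns $m$ requests independently to the entities with probabilities proportional to these sums and tells each entity its number of requests; each entity draws that many of its examples independently, proportionally to their weights, and sends them; the center runs the weak learner on the (uniform distribution on the) received examples and broadcasts the returned $h^{(t)}$; every entity multiplies the weight of each example with $h^{(t)}(x)=y$ by $1-\gamma$; the weights are normalized to sum to $1$ and then projected, in relative entropy, onto the distributions with all weights at most $\frac1{\kappa n}$. The projection clips the weights above a threshold to $\frac{1}{\kappa n}$ and rescales the others; the threshold is found by a distributed binary search that repeatedly takes the median $\theta$ of the still active weights. Each median is found by distributed selection: the entities send the medians and the numbers of their remaining candidates, the center broadcasts the weighted median of these medians as a pivot, the entities send the numbers of their candidates below and equal to the pivot, and the candidates on the wrong side of the pivot are discarded. The output is $\mathrm{sign}\big(\frac1T\sum_{t=1}^Th^{(t)}\big)$. \textbf{Theorem.} For every $\delta>0$ there are constants $C_1,C_2,C_3>0$ depending only on $\delta$, and for every $b<\frac12$ a constant $C_4>0$ depending only on $\delta$ and $b$, such that the following holds for all $X,H,d,k,D_1,\dots,D_k$ as above, all $0<\beta\le b$, all $0<\varepsilon\le\frac12$ and every $\beta$-weak agnostic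 learner for $H$. Let $\Lambda=\frac{d\log(1/\varepsilon)}{(1/2-\beta)^2\varepsilon^2}$ and run the algorithm with $$T=\Big\lfloor \tfrac{C_1\log(1/\varepsilon)}{(1/2-\beta)^2}\Big\rfloor,\quad m=\Big\lfloor C_4\tfrac{d}{\beta^2}\log\tfrac1\beta\Big\rfloor,\quad N=\lfloor C_2\Lambda\log\Lambda\rfloor,$$ and smoothness $\min\{1,\kappa\}$, where $\kappa$ is any number with $\frac{2err_D(H)}{1/2-\beta}+\frac\varepsilon2\le\kappa\le\frac{2err_D(H)}{1/2-\beta}+\frac{3\varepsilon}4$. Then: (i) with (outer) probability at least $1-\delta$ over the samples $S_1,\dots,S_k$, the output $f$ satisfies $err_D(f)\le\frac{2err_D(H)}{1/2-\beta}+\varepsilon$ with probability at least $1-\delta$ over the random choices of the algorithm; (ii) in every run the number of rounds is at most $C_1\frac{\log(1/\varepsilon)}{(1/2-\beta)^2}$, in each round at most $C_4\frac d{\beta^2}\log\frac1\beta$ examples are communicated, and, if $k\le N$, at most $C_3\,k\,d\,\log^2\!\Big(\frac{d\log(1/\varepsilon)}{(1/2-\beta)\varepsilon}\Big)$ further words are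 communicated in each round. -/

import Mathlib

open MeasureTheory Filter
open scoped ENNReal

noncomputable section

namespace DistBoost

/-! ## Agnostic learning. Labels in `{-1, 1}` are coded as `false`, `true`. -/

section Learning

universe u
variable {X : Type u}

/-- `H` realizes every labelling of the finite set `F`. -/
def Shatters (H : Set (X → Bool)) (F : Finset X) : Prop :=
  ∀ g : X → Bool, ∃ h ∈ H, ∀ x ∈ F, h x = g x

/-- The Vapnik-Chervonenkis dimension. -/
def vcDim (H : Set (X → Bool)) : ℕ∞ :=
  ⨆ (F : Finset X) (_ : Shatters H F), (F.card : ℕ∞)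

variable [MeasurableSpace X]

/-- The error rate of `h` under `D`. -/
def err (D : Measure (X × Bool)) (h : X → Bool) : ℝ :=
  D.real {z | h z.1 ≠ z.2}

/-- The least error rate in the class `H` under `D`. -/
def optErr (D : Measure (X × Bool)) (H : Set (X → Bool)) : ℝ :=
  ⨅ h : H, err D h

/-- Given any probability distribution `D`, the learner returns a hypothesis of the class whose
error rate is within `β` of the optimal one. -/
def IsWeakAgnosticLearner (H : Set (X → Bool)) (β : ℝ)
    (A : Measure (X × Bool) → X → Bool) : Prop :=
  ∀ D : Measure (X × Bool), IsProbabilityMeasure D → A D ∈ H ∧ err D (A D) ≤ optErr D H + β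

/-- The usual measurability condition of VC theory: the hypotheses are measurable, and they are
pointwise limits of sequences from one countable subclass. -/
def UniversallySeparable (H : Set (X → Bool)) : Prop :=
  (∀ h ∈ H, Measurable h) ∧
    ∃ H₀ ⊆ H, H₀.Countable ∧
      ∀ h ∈ H, ∃ g : ℕ → X → Bool, (∀ n, g n ∈ H₀) ∧ ∀ x, ∀ᶠ n in atTop, g n x = h x

/-- The overall distribution `(1/k) ∑ Dᵢ`. -/
def mixture {k : ℕ} (D : Fin k → Measure (X × Bool)) : Measure (X × Bool) :=
  (k : ℝ≥0∞)⁻¹ • ∑ i, D i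

/-- The empirical distribution of `m` examples. -/
def empirical {m : ℕ} (z : Fin m → X × Bool) : Measure (X × Bool) :=
  (m : ℝ≥0∞)⁻¹ • ∑ l, Measure.dirac (z l)

/-- The law of the local samples: entity `i` holds `s` independent examples drawn from `Dᵢ`. -/
def sampleLaw {k : ℕ} (D : Fin k → Measure (X × Bool)) (s : ℕ) :
    Measure (Fin k → Fin s → X × Bool) :=
  Measure.pi fun i => Measure.pi fun _ : Fin s => D i

/-- The sign of the average of the `±1`-valued hypotheses in the list (with `sign 0 = 1`). -/
def majority (hs : List (X → Bool)) (x : X) : Bool :=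
  decide (0 ≤ (hs.map fun h => if h x then (1 : ℤ) else -1).sum)

end Learning

/-! ## The network: `k` entities and a center that exchange words (numbers) -/

/-- The numerical part of the memory of an entity with `s` examples. -/
structure Node (s : ℕ) where
  /-- the weights of its examples -/
  weight : Fin s → ℝ
  /-- the examples whose weights are still active in the projection -/
  active : Finset (Fin s)
  /-- the examples whose weights are still candidates in the search of the median -/
  cand : Finset (Fin s)

/-- The memories of the `k` entities, and the number of words communicated so far. -/
structure Network (k s : ℕ) where
  node : Fin k → Node s
  words : ℕ

/-- Programs run by the center. All access to the entities is through `localStep`, `gather`,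
`scatter`, `broadcast`, `query`, which count every word sent. -/
abbrev Comm (k s : ℕ) := StateM (Network k s)

section Primitives

variable {k s w w' : ℕ}

/-- Every entity performs a computation on its own memory; nothing is sent. -/
def localStep (f : Fin k → Node s → Node s) : Comm k s Unit := fun N =>
  ((), { N with node := fun i => f i (N.node i) })

/-- Every entity sends `w` words to the center. -/
def gather (f : Node s → Fin w → ℝ) : Comm k s (Fin k → Fin w → ℝ) := fun N =>
  (fun i => f (N.node i), { N with words := N.words + k * w })

/-- The center sends `w` words to every entity, possibly different ones. -/
def scatter (msg : Fin k → Fin w → ℝ) (f : (Fin w → ℝ) → Node s → Node s) :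
    Comm k s Unit := fun N =>
  ((), { node := fun i => f (msg i) (N.node i), words := N.words + k * w })

/-- The center sends the same `w` words to every entity. -/
def broadcast (msg : Fin w → ℝ) (f : (Fin w → ℝ) → Node s → Node s) : Comm k s Unit :=
  scatter (fun _ => msg) f

/-- The center sends the same `w` words to every entity, and every entity answers with `w'`
words. -/
def query (msg : Fin w → ℝ) (f : (Fin w → ℝ) → Node s → Fin w' → ℝ) :
    Comm k s (Fin k → Fin w' → ℝ) := fun N =>
  (fun i => f msg (N.node i), { N with words := N.words + k * w + k * w' })

/-- The center sends a hypothesis to every entity; a hypothesis counts as `d` words. The entities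
only record, in `f`, what it does on their own examples. -/
def broadcastHypothesis (d : ℕ) (f : Fin k → Node s → Node s) : Comm k s Unit := fun N =>
  ((), { node := fun i => f i (N.node i), words := N.words + k * d })

end Primitives

section Median

variable {k s : ℕ}

/-- The median of the candidate weights of an entity (and `0` if there are none). -/
def Node.median (e : Node s) : ℝ :=
  ((e.cand.val.map e.weight).sort (· ≤ ·)).getD (e.cand.card / 2) 0

/-- The weighted median of the local medians `r i 0`, with the numbers `r i 1` of candidates as
weights: the least local median such that at least half of the candidates belong to entities with
a local median that is not larger. -/
def pivot (r : Fin k → Fin 2 → ℝ) : ℝ :=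
  sInf {p | (∃ i, 0 < r i 1 ∧ p = r i 0) ∧
    ∑ i, r i 1 ≤ 2 * ∑ i with r i 0 ≤ p, r i 1}

/-- Distributedly find the weight of rank `j` (counted from `0`) among all candidates. The first
argument bounds the number of iterations. Every entity sends its local median and its number of
candidates, the center broadcasts a pivot, every entity counts the candidates below the pivot and
equal to it, and the candidates on the wrong side are removed. -/
def select : ℕ → ℝ → Comm k s ℝ
  | 0, _ => pure 0
  | fuel + 1, j => do
    let r ← gather fun e => ![e.median, (e.cand.card : ℝ)]
    let p := pivot r
    let c ← query ![p] fun q e =>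
      ![((e.cand.filter fun x => e.weight x < q 0).card : ℝ),
        ((e.cand.filter fun x => e.weight x = q 0).card : ℝ)]
    let lo := ∑ i, c i 0
    let eq := ∑ i, c i 1
    if lo ≤ j ∧ j < lo + eq then
      pure p
    else do
      broadcast ![p, if j < lo then -1 else 1] fun q e =>
        { e with cand := e.cand.filter fun x =>
            if (q 1 < 0) then e.weight x < q 0 else q 0 < e.weight x }
      select fuel (if j < lo then j else j - (lo + eq))

/-- Distributedly find the median of the `n₀` active weights of all entities. -/
def findMedian (n₀ : ℝ) : Comm k s ℝ := do
  localStep fun _ e => { e with cand := e.active }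
  select (k * s) (n₀ / 2)

end Median

section Projection

variable {k s : ℕ}

/-- The loop of the projection; the weights are to be made at most `cap`. Here `n₀` is the number
of active weights, `C` and `Cw` are the number and the sum of the weights that are known to be
clipped, `θ` is the current threshold. The first argument bounds the number of iterations (every
iteration removes an active weight). Returns the final `C`, `Cw`, `θ`. -/
def projectLoop (cap : ℝ) : ℕ → (n₀ C Cw θ : ℝ) → Comm k s (ℝ × ℝ × ℝ)
  | 0, _, C, Cw, θ => pure (C, Cw, θ)
  | fuel + 1, n₀, C, Cw, θ =>
    if n₀ = 0 then
      pure (C, Cw, θ)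
    else do
      let θ ← findMedian n₀
      let r ← query ![θ] fun q e =>
        ![((e.active.filter fun x => e.weight x < q 0).card : ℝ),
          ((e.active.filter fun x => e.weight x = q 0).card : ℝ),
          ((e.active.filter fun x => q 0 < e.weight x).card : ℝ),
          ∑ x ∈ e.active with e.weight x = q 0, e.weight x,
          ∑ x ∈ e.active with q 0 < e.weight x, e.weight x]
      let L := ∑ i, r i 0
      let M := ∑ i, r i 1
      let H := ∑ i, r i 2
      let Mw := ∑ i, r i 3
      let Hw := ∑ i, r i 4
      let m₀ := (1 - (C + H) * cap) / (1 - (Cw + Hw))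
      broadcast ![θ, m₀] fun q e =>
        { e with active := e.active.filter fun x =>
            if cap < q 0 * q 1 then e.weight x < q 0 else q 0 < e.weight x }
      if cap < θ * m₀ then
        if L = 0 then do
          -- the next smaller weight; an entity without a weight below `θ` answers `0`
          let b ← query ![θ] fun q e =>
            ![sSup {v | ∃ x, v = e.weight x ∧ v < q 0}]
          projectLoop cap fuel L (C + H + M) (Cw + Hw + Mw) (⨆ i, b i 0)
        else
          projectLoop cap fuel L (C + H + M) (Cw + Hw + Mw) θ
      else
        projectLoop cap fuel H C Cw θ

/-- Distributed Bregman projection of the (normalized) weights onto the distributions with all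
weights at most `cap`. -/
def project (cap : ℝ) : Comm k s Unit := do
  localStep fun _ e => { e with active := Finset.univ }
  let (C, Cw, θ) ← projectLoop cap (k * s) ((k * s : ℕ) : ℝ) 0 0 0
  let m₀ := (1 - C * cap) / (1 - Cw)
  broadcast ![θ, m₀] fun q e =>
    { e with weight := fun x => if q 0 < e.weight x then cap else e.weight x * q 1 }

/-- Distributed normalization of the weights. -/
def normalize : Comm k s Unit := do
  let r ← gather fun e => ![∑ x, e.weight x]
  broadcast ![∑ i, r i 0] fun q e => { e with weight := fun x => e.weight x / q 0 }

end Projection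

/-! ## Random choices -/

open Classical in
/-- A random index, with probabilities proportional to the nonnegative weights `w` (uniform if the
weights are all zero). -/
def weightedPMF {α : Type} [Fintype α] [Nonempty α] (w : α → ℝ) : PMF α :=
  if h : ∑ a, ENNReal.ofReal (w a) ≠ 0 then
    PMF.normalize (fun a => ENNReal.ofReal (w a))
      (by rwa [tsum_fintype]) (by rw [tsum_fintype]; exact (ENNReal.sum_lt_top.2 fun _ _ => ENNReal.ofReal_lt_top).ne)
  else PMF.uniformOfFintype α

/-- Independent choices, the `l`-th one with law `p l`. -/
def piPMF {m : ℕ} {α : Type} [Fintype α] (p : Fin m → PMF α) : PMF (Fin m → α) :=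
  PMF.ofFintype (fun a => ∏ l, p l (a l)) (by
    classical
    rw [← Fintype.prod_sum fun l a => p l a]
    exact Finset.prod_eq_one fun l _ => by rw [← tsum_fintype (L := .unconditional _), (p l).tsum_coe])

/-! ## The boosting algorithm -/

universe u

/-- What a round leaves behind: the hypothesis, the new weights, and the numbers of examples and
of words that were communicated in the round. -/
structure Round (X : Type u) (k s : ℕ) where
  hyp : X → Bool
  weight : Fin k → Fin s → ℝ
  examples : ℕ
  words : ℕ

variable {X : Type u} [MeasurableSpace X] {k s : ℕ} [NeZero k] [NeZero s]

/-- One round, with local samples `S`, weak learner `A`, hypotheses of `d` words, `m` examples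
for the weak learner, update parameter `γ`, largest admissible weight `cap`, and current
weights `v`. -/
def boostRound (S : Fin k → Fin s → X × Bool) (A : Measure (X × Bool) → X → Bool) (d m : ℕ)
    (γ cap : ℝ) (v : Fin k → Fin s → ℝ) : PMF (Round X k s) :=
  -- every entity sends its sum of weights
  let sums := (gather fun e => ![∑ x, e.weight x]).run ⟨fun i => ⟨v i, ∅, ∅⟩, 0⟩
  -- the center chooses the entities that supply the `m` examples
  (piPMF fun _ : Fin m => weightedPMF fun i => sums.1 i 0).bind fun I =>
    let n : Fin k → ℕ := fun i => (Finset.univ.filter fun l => I l = i).card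
    -- and tells every entity its number of examples
    let asked := (scatter (fun i => ![(n i : ℝ)]) fun _ e => e).run sums.2
    -- the entities draw these examples proportionally to their weights and send them
    (piPMF fun l => weightedPMF (v (I l))).bind fun J =>
      let h := A (empirical fun l => S (I l) (J l))
      let final := (do
        broadcastHypothesis d fun i e =>
          { e with weight := fun x =>
              if (h (S i x).1 = (S i x).2) then e.weight x * (1 - γ) else e.weight x }
        normalize
        project cap : Comm k s Unit).run asked.2
      PMF.pure ⟨h, fun i => (final.2.node i).weight, ∑ i, n i, final.2.words⟩

/-- `T` rounds from the weights `v`. -/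
def boostFrom (S : Fin k → Fin s → X × Bool) (A : Measure (X × Bool) → X → Bool) (d m : ℕ)
    (γ cap : ℝ) : ℕ → (Fin k → Fin s → ℝ) → PMF (List (Round X k s))
  | 0, _ => PMF.pure []
  | T + 1, v => (boostRound S A d m γ cap v).bind fun r =>
      (boostFrom S A d m γ cap T r.weight).map fun ρ => r :: ρ

/-- The distributed agnostic boosting algorithm with `T` rounds, run on the local samples `S`,
where the weights are kept `κ`-smooth, i.e. at most `1 / (κ n)` with `n = k s`. The value is the
law of the list of the rounds. -/
def distBoost (S : Fin k → Fin s → X × Bool) (A : Measure (X × Bool) → X → Bool) (d m : ℕ)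
    (β κ : ℝ) (T : ℕ) : PMF (List (Round X k s)) :=
  boostFrom S A d m ((1 / 2 - β) / 2) (1 / (κ * ((k * s : ℕ) : ℝ))) T fun _ _ => 1 / (s : ℝ)

/-- The hypothesis that the algorithm outputs. -/
def output (ρ : List (Round X k s)) : X → Bool :=
  majority (ρ.map Round.hyp)

/-- `d log(1/ε) / ((1/2 - β)² ε²)`, the order of the sample size up to a logarithmic factor. -/
def sampleOrder (d : ℕ) (β ε : ℝ) : ℝ :=
  d * Real.log (1 / ε) / ((1 / 2 - β) ^ 2 * ε ^ 2)

end DistBoost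

end

open DistBoost

namespace DistBoost

/-! ### The growth function of a VC class -/

section Growth

universe u
variable {X : Type u}

/-! The algorithm is multiplicative weights with projection onto smooth distributions. Write `u =
1/2 - β`, `γ = u/2`, `n = k s`, `cap = 1/(κ n)`. Four estimates carry the theorem.

Regret. For a distribution `Q ≤ cap` on the examples, follow the potential `∑ Q log (v / ∑ v)`. It
starts at `-log n` and never exceeds `log cap = log (1/κ) - log n`. The projection cannot lower it,
by the Pythagorean inequality of relative entropy (`clip_spec`), so a round with hypothesis `h`
changes it by at least `log (1 - γ) * Q(h right) + γ * (1 - wErr h)` (`roundOf_spec`). If the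
majority vote erred on `κ n` examples or more, take `Q` uniform on them. There at most half of the
votes are right, while a fixed nearly optimal `h'` has error at most `γ` under all the smooth
weights, so that an ideal weak learner has `1 - wErr h ≥ 1/2 + γ`. The potential then gains at least
`γ² / 4` per round, even after a small loss for sampling errors, and breaks its ceiling
(`errCount_output_lt`).

Sampling in the rounds. The learner sees only `m` random examples, so its weighted error may exceed
that of `h'` by more than `β`. Symmetrization, Massart's lemma and the Sauer-Shelah bound make the
expectation of this `excess` at most `2 η` for every positive weighting (`expect_excess_le`). The
expectations add up over the rounds and Markov's inequality is applied once, to the sum; hence `m`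
does not depend on `T`.

Generalization. Majorities of `T` hypotheses show at most the `T`-th power of the number of patterns
of `H`. The same symmetrization works for independent examples with different laws, whose average is
the mixture, so sample errors of all majorities are uniformly close to true ones
(`integral_maxDev_le`, `sampleLaw_deviation_le`).

Communication. A weighted median of medians leaves at most three quarters of the candidates, so a
selection takes `O(log n)` iterations of `O(k)` words (`select_spec`). Each median halves the active
set, so a projection takes `O(log n)` selections (`projectLoop_spec`). The binary search is sound
because the need to clip is monotone in the weight (`mustClip_mono`). Finally `log n` is of the
order of the logarithm in the claim (`log_card_le`). -/

theorem card_le_of_shatters {H : Set (X → Bool)} {d : ℕ} (hH : vcDim H ≤ d) {F : Finset X}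
    (hF : Shatters H F) : F.card ≤ d := by
  have h : (F.card : ℕ∞) ≤ vcDim H :=
    le_iSup₂ (f := fun (F : Finset X) (_ : Shatters H F) => (F.card : ℕ∞)) F hF
  exact_mod_cast h.trans hH

/-- The Sauer-Shelah bound, in the form `∑_{i ≤ d} (n choose i) ≤ x⁻ᵈ eⁿˣ`. -/
theorem exists_patterns {H : Set (X → Bool)} {d : ℕ} (hH : vcDim H ≤ d) {ι : Type*} [Fintype ι]
    (p : ι → X) {x : ℝ} (hx : 0 < x) (hx1 : x ≤ 1) :
    ∃ V : Finset (ι → Bool), (∀ h ∈ H, (fun i => h (p i)) ∈ V) ∧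
      (V.card : ℝ) ≤ (x⁻¹) ^ d * Real.exp (x * Fintype.card ι) := by
  classical
  set P : Finset X := Finset.univ.image p with hP
  set 𝒜 : Finset (Finset X) := P.powerset.filter fun u => ∃ h ∈ H, u = P.filter fun y => h y = true
    with h𝒜
  refine ⟨𝒜.image fun u i => decide (p i ∈ u), ?_, ?_⟩
  · intro h hh
    refine Finset.mem_image.2 ⟨P.filter fun y => h y = true, ?_, ?_⟩
    · exact Finset.mem_filter.2 ⟨Finset.mem_powerset.2 (Finset.filter_subset _ _), h, hh, rfl⟩
    · funext i
      have : p i ∈ P := Finset.mem_image_of_mem _ (Finset.mem_univ _)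
      simp [this]
  -- A set shattered by the family of traces on `P` is shattered by `H`, so all of the shatterer
  -- lies in dimension at most `d`; Pajor's inequality then bounds the family by its shatterer.
  have hsh : ∀ F ∈ 𝒜.shatterer, F ∈ P.powerset ∧ F.card ≤ d := by
    intro F hF
    rw [Finset.mem_shatterer] at hF
    have hFP : F ⊆ P := by
      obtain ⟨u, hu, hFu⟩ := hF (Finset.Subset.refl F)
      exact (Finset.inter_eq_left.1 hFu).trans
        (Finset.mem_powerset.1 (Finset.mem_filter.1 hu).1)
    refine ⟨Finset.mem_powerset.2 hFP, card_le_of_shatters hH fun g => ?_⟩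
    obtain ⟨u, hu, hFu⟩ := hF (Finset.filter_subset (fun y => g y = true) F)
    obtain ⟨h, hh, rfl⟩ := (Finset.mem_filter.1 hu).2
    refine ⟨h, hh, fun y hy => ?_⟩
    have := Finset.ext_iff.1 hFu y
    simp only [Finset.mem_inter, Finset.mem_filter, hy, hFP hy, true_and] at this
    exact Bool.eq_iff_iff.2 this
  have h1 : (((𝒜.image fun u i => decide (p i ∈ u)) : Finset (ι → Bool)).card : ℝ)
      ≤ 𝒜.shatterer.card := by
    exact_mod_cast Finset.card_image_le.trans (Finset.card_le_card_shatterer 𝒜)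
  -- Each shattered set is charged `x ^ d ≤ x ^ |F|`, and the generating function of all subsets of
  -- `P` is `(1 + x) ^ |P|`. The parameter `x` stays free and is tuned later.
  have h2 : (𝒜.shatterer.card : ℝ) * x ^ d ≤ (1 + x) ^ P.card := by
    calc (𝒜.shatterer.card : ℝ) * x ^ d = ∑ F ∈ 𝒜.shatterer, x ^ d := by simp
      _ ≤ ∑ F ∈ 𝒜.shatterer, x ^ F.card :=
        Finset.sum_le_sum fun F hF => pow_le_pow_of_le_one hx.le hx1 (hsh F hF).2
      _ ≤ ∑ F ∈ P.powerset, x ^ F.card :=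
        Finset.sum_le_sum_of_subset_of_nonneg (fun F hF => (hsh F hF).1)
          fun _ _ _ => by positivity
      _ = (1 + x) ^ P.card := by
        have := Finset.sum_pow_mul_eq_add_pow x 1 P
        simp only [one_pow, mul_one] at this
        rw [this, add_comm]
  have h3 : (1 + x) ^ P.card ≤ Real.exp (x * Fintype.card ι) := by
    have hc : P.card ≤ Fintype.card ι := Finset.card_image_le
    calc (1 + x) ^ P.card ≤ (1 + x) ^ Fintype.card ι :=
          pow_le_pow_right₀ (by linarith) hc
      _ ≤ (Real.exp x) ^ Fintype.card ι :=
          pow_le_pow_left₀ (by linarith) (by linarith [Real.add_one_le_exp x]) _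
      _ = _ := by rw [← Real.exp_nat_mul, mul_comm]
  have hxd : 0 < x ^ d := by positivity
  rw [inv_pow, inv_mul_eq_div, le_div_iff₀ hxd]
  calc _ ≤ (𝒜.shatterer.card : ℝ) * x ^ d := by gcongr
    _ ≤ _ := h2.trans h3

end Growth

/-! ### Random signs and finite maxima -/

section Symmetrization

variable {ι Z Θ : Type*} [Fintype ι]

/-- The sum of `exp (∑ ± vⱼ)` over the signs. -/
theorem sum_signs_exp [DecidableEq ι] (v : ι → ℝ) :
    ∑ σ : ι → Bool, Real.exp (∑ j, (if σ j then v j else - v j)) =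
      2 ^ Fintype.card ι * ∏ j, Real.cosh (v j) := by
  simp_rw [Real.exp_sum]
  rw [← Fintype.prod_sum (fun j (s : Bool) => Real.exp (if s then v j else - v j))]
  simp_rw [Fintype.sum_bool, Real.cosh_eq]
  rw [← Finset.card_univ, ← Finset.prod_const, ← Finset.prod_mul_distrib]
  refine Finset.prod_congr rfl fun j _ => ?_
  simp; ring

/-- Massart's lemma: the mean over the signs of the maximum of `|∑ ± vⱼ|`. -/
theorem sum_signs_le [DecidableEq ι] (V : Finset (ι → ℝ)) (hV : ∀ v ∈ V, ∀ j, |v j| ≤ 1)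
    {G η : ℝ} (hη : 0 < η) (hVG : (V.card : ℝ) ≤ G) (hG1 : 1 ≤ G)
    (hG : Real.log (2 * G) ≤ Fintype.card ι * η ^ 2 / 2) (M : (ι → Bool) → ℝ)
    (hM : ∀ σ, ∃ v ∈ V, M σ ≤ |∑ j, (if σ j then v j else - v j)|) :
    ∑ σ, M σ ≤ 2 ^ Fintype.card ι * (Fintype.card ι * η) := by
  set n : ℝ := (Fintype.card ι : ℝ) with hn
  set a : ℝ := n * η ^ 2 with ha
  -- The tangent line of `exp` at `a = n η²` replaces Jensen's inequality and a logarithm. The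
  -- maximum is bounded by a sum over `V`, with two terms per vector for the two signs of the
  -- absolute value.
  have key : ∀ σ, η * M σ ≤ a - 1 + Real.exp (-a) * ∑ v ∈ V,
      (Real.exp (∑ j, (if σ j then η * v j else - (η * v j))) +
        Real.exp (∑ j, (if σ j then (- η * v j) else - (- η * v j)))) := by
    intro σ
    obtain ⟨v, hv, hMv⟩ := hM σ
    have h1 : η * M σ ≤ a - 1 + Real.exp (-a) * Real.exp (η * M σ) := by
      rw [← Real.exp_add]
      linarith [Real.add_one_le_exp (-a + η * M σ)]
    refine h1.trans ?_
    gcongr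
    have e1 : ∑ j, (if σ j then η * v j else - (η * v j)) =
        η * ∑ j, (if σ j then v j else - v j) := by
      rw [Finset.mul_sum]; refine Finset.sum_congr rfl fun j _ => ?_; split_ifs <;> ring
    have e2 : ∑ j, (if σ j then (- η * v j) else - (- η * v j)) =
        - (η * ∑ j, (if σ j then v j else - v j)) := by
      rw [Finset.mul_sum, ← Finset.sum_neg_distrib]
      refine Finset.sum_congr rfl fun j _ => ?_; split_ifs <;> ring
    refine le_trans ?_ (Finset.single_le_sum (f := fun v : ι → ℝ =>
      (Real.exp (∑ j, (if σ j then η * v j else - (η * v j))) +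
        Real.exp (∑ j, (if σ j then (- η * v j) else - (- η * v j)))))
      (fun _ _ => by positivity) hv)
    simp only [e1, e2]
    set S := ∑ j, (if σ j then v j else - v j)
    have h2 : η * M σ ≤ |η * S| := by
      rw [abs_mul, abs_of_pos hη]; gcongr
    refine (Real.exp_le_exp.2 h2).trans ?_
    rcases abs_cases (η * S) with ⟨h, _⟩ | ⟨h, _⟩ <;> rw [h]
    · linarith [Real.exp_pos (-(η * S))]
    · linarith [Real.exp_pos (η * S)]
  have hcosh : ∀ c : ℝ, c ^ 2 = η ^ 2 → ∀ v ∈ V,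
      ∑ σ : ι → Bool, Real.exp (∑ j, (if σ j then c * v j else - (c * v j))) ≤
        2 ^ Fintype.card ι * Real.exp (a / 2) := by
    intro c hc v hv
    rw [sum_signs_exp fun j => c * v j]
    gcongr
    calc ∏ j, Real.cosh (c * v j) ≤ ∏ j : ι, Real.exp (η ^ 2 / 2) := by
          refine Finset.prod_le_prod (fun j _ => (Real.cosh_pos _).le) fun j _ => ?_
          refine (Real.cosh_le_exp_half_sq _).trans (Real.exp_le_exp.2 ?_)
          have : (v j) ^ 2 ≤ 1 := by
            have := hV v hv j
            rw [← sq_abs]; nlinarith [abs_nonneg (v j)]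
          rw [mul_pow, hc]
          nlinarith [sq_nonneg η]
      _ = _ := by
          rw [Finset.prod_const, ← Real.exp_nat_mul, Finset.card_univ, ha]; congr 1; ring
  have hsum : η * ∑ σ, M σ ≤ 2 ^ Fintype.card ι * a := by
    rw [Finset.mul_sum]
    refine (Finset.sum_le_sum fun σ _ => key σ).trans ?_
    rw [Finset.sum_add_distrib, ← Finset.mul_sum, Finset.sum_comm]
    have h3 : ∑ v ∈ V, ∑ σ : ι → Bool,
        (Real.exp (∑ j, (if σ j then η * v j else - (η * v j))) +
        Real.exp (∑ j, (if σ j then (- η * v j) else - (- η * v j)))) ≤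
        ∑ v ∈ V, 2 * (2 ^ Fintype.card ι * Real.exp (a / 2)) := by
      refine Finset.sum_le_sum fun v hv => ?_
      rw [Finset.sum_add_distrib]
      linarith [hcosh η rfl v hv, hcosh (-η) (by ring) v hv]
    -- The hypothesis on `G` says exactly `2 G ≤ exp (a / 2)`; with the factor `exp (a / 2)` from
    -- the hyperbolic cosines this cancels `exp (-a)`.
    have h4 : Real.exp (-a) * ∑ v ∈ V, 2 * (2 ^ Fintype.card ι * Real.exp (a / 2)) ≤
        2 ^ Fintype.card ι := by
      rw [Finset.sum_const, nsmul_eq_mul]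
      have h5 : 2 * (V.card : ℝ) ≤ Real.exp (a / 2) := by
        have : 2 * G ≤ Real.exp (a / 2) := by
          rw [← Real.log_le_iff_le_exp (by linarith)]; linarith
        linarith
      have h6 : Real.exp (-a) = (Real.exp (a / 2) * Real.exp (a / 2))⁻¹ := by
        rw [← Real.exp_add, ← Real.exp_neg]; congr 1; ring
      rw [h6, inv_mul_le_iff₀ (by positivity)]
      have : 0 < Real.exp (a / 2) := Real.exp_pos _
      have h7 : (0:ℝ) < 2 ^ Fintype.card ι := by positivity
      calc (V.card : ℝ) * (2 * (2 ^ Fintype.card ι * Real.exp (a / 2)))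
          = (2 * V.card) * (2 ^ Fintype.card ι * Real.exp (a / 2)) := by ring
        _ ≤ Real.exp (a / 2) * (2 ^ Fintype.card ι * Real.exp (a / 2)) := by gcongr
        _ = _ := by ring
    have h8 := (mul_le_mul_of_nonneg_left h3 (Real.exp_pos (-a)).le).trans h4
    have h9 : ∑ _σ : ι → Bool, (a - 1) = 2 ^ Fintype.card ι * (a - 1) := by
      simp; ring
    rw [h9]; linarith
  have : η * ∑ σ, M σ ≤ η * (2 ^ Fintype.card ι * (n * η)) := by
    refine hsum.trans (le_of_eq ?_); rw [ha]; ring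
  exact le_of_mul_le_mul_left this hη

end Symmetrization

/-! ### Largest deviations and their boundedness -/

section Symmetrization

variable {ι Z Θ : Type*} [Fintype ι]

/-- The symmetrized deviation. -/
noncomputable def signedDev (f : Θ → Z → ℝ) (σ : ι → Bool) (y : ι → Z × Z) : ℝ :=
  ⨆ θ, |∑ j, (if σ j then f θ (y j).2 - f θ (y j).1 else -(f θ (y j).2 - f θ (y j).1))|

/-- The largest deviation of the sum over a sample from its expectation. -/
noncomputable def maxDev (f : Θ → Z → ℝ) (m : Θ → ι → ℝ) (z : ι → Z) : ℝ :=
  ⨆ θ, |∑ j, (m θ j - f θ (z j))|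

theorem abs_sum_le_card {g : ι → ℝ} (hg : ∀ j, |g j| ≤ 1) : |∑ j, g j| ≤ Fintype.card ι := by
  refine (Finset.abs_sum_le_sum_abs _ _).trans ((Finset.sum_le_sum fun j _ => hg j).trans ?_)
  simp

variable {f : Θ → Z → ℝ} (hf0 : ∀ θ z, 0 ≤ f θ z) (hf1 : ∀ θ z, f θ z ≤ 1)
include hf0 hf1

theorem abs_signedDev_term_le (σ : ι → Bool) (y : ι → Z × Z) (θ : Θ) :
    |∑ j, (if σ j then f θ (y j).2 - f θ (y j).1 else -(f θ (y j).2 - f θ (y j).1))| ≤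
      Fintype.card ι := by
  refine abs_sum_le_card fun j => ?_
  have := hf0 θ (y j).1; have := hf0 θ (y j).2
  have := hf1 θ (y j).1; have := hf1 θ (y j).2
  split_ifs <;> rw [abs_le] <;> constructor <;> linarith

theorem bddAbove_signedDev (σ : ι → Bool) (y : ι → Z × Z) : BddAbove (Set.range fun θ : Θ =>
    |∑ j, (if σ j then f θ (y j).2 - f θ (y j).1 else -(f θ (y j).2 - f θ (y j).1))|) :=
  ⟨Fintype.card ι, by rintro _ ⟨θ, rfl⟩; exact abs_signedDev_term_le hf0 hf1 σ y θ⟩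

variable [Nonempty Θ]

theorem abs_signedDev_le (σ : ι → Bool) (y : ι → Z × Z) :
    |signedDev f σ y| ≤ Fintype.card ι := by
  rw [signedDev, abs_of_nonneg (Real.iSup_nonneg fun _ => abs_nonneg _)]
  exact ciSup_le fun θ => abs_signedDev_term_le hf0 hf1 σ y θ

variable {m : Θ → ι → ℝ} (hm0 : ∀ θ j, 0 ≤ m θ j) (hm1 : ∀ θ j, m θ j ≤ 1)
include hm0 hm1

omit [Nonempty Θ] in
theorem abs_maxDev_term_le (z : ι → Z) (θ : Θ) :
    |∑ j, (m θ j - f θ (z j))| ≤ Fintype.card ι := by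
  refine abs_sum_le_card fun j => ?_
  have := hf0 θ (z j); have := hf1 θ (z j)
  have := hm0 θ j; have := hm1 θ j
  rw [abs_le]; constructor <;> linarith

omit [Nonempty Θ] in
theorem bddAbove_maxDev (z : ι → Z) : BddAbove (Set.range fun θ : Θ =>
    |∑ j, (m θ j - f θ (z j))|) :=
  ⟨Fintype.card ι, by rintro _ ⟨θ, rfl⟩; exact abs_maxDev_term_le hf0 hf1 hm0 hm1 z θ⟩

theorem abs_maxDev_le (z : ι → Z) : |maxDev f m z| ≤ Fintype.card ι := by
  rw [maxDev, abs_of_nonneg (Real.iSup_nonneg fun _ => abs_nonneg _)]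
  exact ciSup_le fun θ => abs_maxDev_term_le hf0 hf1 hm0 hm1 z θ

end Symmetrization

/-! ### Symmetrization for independent, not identically distributed variables -/

section Symmetrization

variable {ι Z Θ : Type*} [Fintype ι] [MeasurableSpace Z] [Countable Θ]

theorem measurable_signedDev {f : Θ → Z → ℝ} (hf : ∀ θ, Measurable (f θ)) (σ : ι → Bool) :
    Measurable (signedDev f σ) := by
  refine Measurable.iSup fun θ => ?_
  have h : Measurable fun y : ι → Z × Z =>
      ∑ j, (if σ j then f θ (y j).2 - f θ (y j).1 else -(f θ (y j).2 - f θ (y j).1)) := by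
    refine Finset.measurable_sum _ fun j _ => ?_
    have := hf θ
    cases σ j <;> simp <;> fun_prop
  exact h.abs

theorem measurable_maxDev {f : Θ → Z → ℝ} (hf : ∀ θ, Measurable (f θ)) (m : Θ → ι → ℝ) :
    Measurable (maxDev f m) := by
  refine Measurable.iSup fun θ => ?_
  have h : Measurable fun z : ι → Z => ∑ j, (m θ j - f θ (z j)) := by
    refine Finset.measurable_sum _ fun j _ => ?_
    have := hf θ
    fun_prop
  exact h.abs

theorem integrable_of_abs_le {Ω : Type*} [MeasurableSpace Ω] {P : Measure Ω} [IsFiniteMeasure P]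
    {g : Ω → ℝ} (hg : Measurable g) {c : ℝ} (hc : ∀ x, |g x| ≤ c) : Integrable g P :=
  Integrable.of_bound hg.aestronglyMeasurable c (Eventually.of_forall hc)

/-- The expected largest deviation of the empirical means over a class with few patterns. -/
theorem integral_maxDev_le [Nonempty Θ] {f : Θ → Z → ℝ} (hf : ∀ θ, Measurable (f θ))
    (hf0 : ∀ θ z, 0 ≤ f θ z) (hf1 : ∀ θ z, f θ z ≤ 1)
    (μ : ι → Measure Z) [∀ j, IsProbabilityMeasure (μ j)] {G η : ℝ} (hη : 0 < η)
    (hV : ∀ y : ι → Z × Z, ∃ V : Finset (ι → ℝ),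
      (∀ θ, (fun j => f θ (y j).2 - f θ (y j).1) ∈ V) ∧ (V.card : ℝ) ≤ G)
    (hG : Real.log (2 * G) ≤ Fintype.card ι * η ^ 2 / 2) :
    ∫ z, maxDev f (fun θ j => ∫ a, f θ a ∂μ j) z ∂Measure.pi μ ≤ Fintype.card ι * η := by
  classical
  set π := Measure.pi μ with hπ
  set m : Θ → ι → ℝ := fun θ j => ∫ a, f θ a ∂μ j with hm
  have hm0 : ∀ θ j, 0 ≤ m θ j := fun θ j => integral_nonneg fun a => hf0 θ a
  have hint : ∀ θ j, Integrable (f θ) (μ j) := fun θ j =>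
    integrable_of_abs_le (hf θ) (c := 1) fun z => by
      rw [abs_of_nonneg (hf0 θ z)]; exact hf1 θ z
  have hm1 : ∀ θ j, m θ j ≤ 1 := fun θ j =>
    (integral_mono (hint θ j) (integrable_const 1) fun a => hf1 θ a).trans (by simp)
  have hintπ : ∀ θ j, Integrable (fun z : ι → Z => f θ (z j)) π := fun θ j =>
    integrable_of_abs_le ((hf θ).comp (measurable_pi_apply j)) (c := 1) fun z => by
      rw [abs_of_nonneg (hf0 θ _)]; exact hf1 θ _
  have heval : ∀ θ j, ∫ z, f θ (z j) ∂π = m θ j := by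
    intro θ j
    have := (measurePreserving_eval μ j).map_eq
    rw [hm]; simp only
    conv_rhs => rw [← this]
    rw [integral_map (measurable_pi_apply j).aemeasurable (hf θ).aestronglyMeasurable]
  set σ₁ : ι → Bool := fun _ => true with hσ₁
  have hms := measurable_signedDev (ι := ι) hf
  have hpair : Measurable fun p : (ι → Z) × (ι → Z) => fun j => (p.1 j, p.2 j) := by fun_prop
  have hpair' : ∀ z : ι → Z, Measurable fun z' : ι → Z => fun j => (z j, z' j) := by
    intro z; fun_prop
  have hsint : ∀ z : ι → Z, Integrable (fun z' => signedDev f σ₁ fun j : ι => (z j, z' j)) π := fun z =>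
    integrable_of_abs_le ((hms σ₁).comp (hpair' z)) fun z' => abs_signedDev_le hf0 hf1 _ _
  -- Ghost sample: the means are written as integrals over a second sample `z'`, and the absolute
  -- value and the supremum move inside the integral.
  have step1 : ∀ z, maxDev f m z ≤ ∫ z', signedDev f σ₁ (fun j => (z j, z' j)) ∂π := by
    intro z
    refine ciSup_le fun θ => ?_
    have hs : ∀ j, Integrable (fun z' : ι → Z => f θ (z' j) - f θ (z j)) π := fun j =>
      (hintπ θ j).sub (integrable_const _)
    have h1 : ∑ j, (m θ j - f θ (z j)) = ∫ z', ∑ j, (f θ (z' j) - f θ (z j)) ∂π := by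
      rw [integral_finsetSum _ fun j _ => hs j]
      refine Finset.sum_congr rfl fun j _ => ?_
      rw [integral_sub (hintπ θ j) (integrable_const _), heval]
      simp
    rw [h1]
    refine (abs_integral_le_integral_abs).trans ?_
    refine integral_mono (integrable_finsetSum _ fun j _ => hs j).abs (hsint z) fun z' => ?_
    have := le_ciSup (bddAbove_signedDev hf0 hf1 σ₁ fun j => (z j, z' j)) θ
    simpa [hσ₁, signedDev] using this
  set ρ : Measure (ι → Z × Z) := Measure.pi fun j => (μ j).prod (μ j) with hρ
  have hsρ : ∀ σ, Integrable (signedDev f σ) ρ := fun σ =>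
    integrable_of_abs_le (hms σ) fun y => abs_signedDev_le hf0 hf1 _ _
  have step2 : ∫ z, maxDev f m z ∂π ≤ ∫ y, signedDev f σ₁ y ∂ρ := by
    have hI : Integrable (fun p : (ι → Z) × (ι → Z) => signedDev f σ₁ fun j => (p.1 j, p.2 j))
        (π.prod π) :=
      integrable_of_abs_le ((hms σ₁).comp hpair) fun y => abs_signedDev_le hf0 hf1 _ _
    have h2 : ∫ y, signedDev f σ₁ y ∂ρ =
        ∫ p : (ι → Z) × (ι → Z), signedDev f σ₁ (fun j => (p.1 j, p.2 j)) ∂(π.prod π) := by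
      have hmp := measurePreserving_arrowProdEquivProdArrow Z Z ι μ μ
      rw [← hmp.map_eq, integral_map_equiv]
      rfl
    rw [h2, integral_prod _ hI]
    refine integral_mono (integrable_of_abs_le (measurable_maxDev hf m)
      fun z => abs_maxDev_le hf0 hf1 hm0 hm1 z) hI.integral_prod_left fun z => step1 z
  -- Swapping the two members of the `j`-th pair preserves `μ j × μ j`. So the laws may differ
  -- between coordinates, and every sign pattern has the same expected deviation.
  have step3 : ∀ σ, ∫ y, signedDev f σ y ∂ρ = ∫ y, signedDev f σ₁ y ∂ρ := by
    intro σ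
    have hmp : MeasurePreserving (fun (y : ι → Z × Z) j => if σ j then y j else (y j).swap) ρ ρ := by
      refine measurePreserving_pi (fun j => (μ j).prod (μ j)) (fun j => (μ j).prod (μ j))
        (f := fun j y => if σ j then y else y.swap) fun j => ?_
      cases σ j
      · simpa using Measure.measurePreserving_swap
      · simpa using! MeasurePreserving.id _
    conv_lhs => rw [← hmp.map_eq]
    rw [integral_map hmp.measurable.aemeasurable (hms σ).aestronglyMeasurable]
    refine integral_congr_ae (Eventually.of_forall fun y => ?_)
    simp only [signedDev, hσ₁, if_true]
    refine iSup_congr fun θ => ?_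
    congr 1
    refine Finset.sum_congr rfl fun j _ => ?_
    cases σ j <;> simp
  have hpt : ∀ y, ∑ σ : ι → Bool, signedDev f σ y ≤
      2 ^ Fintype.card ι * (Fintype.card ι * η) := by
    intro y
    obtain ⟨V, hV, hVG⟩ := hV y
    -- `V` may contain arbitrary vectors; Massart's lemma needs entries in `[-1, 1]`, which only the
    -- realized differences are known to have.
    set V' := V.filter fun v => ∃ θ, v = fun j => f θ (y j).2 - f θ (y j).1 with hV'
    have hmem : ∀ θ, (fun j => f θ (y j).2 - f θ (y j).1) ∈ V' := fun θ =>
      Finset.mem_filter.2 ⟨hV θ, θ, rfl⟩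
    have hne : V'.Nonempty := ⟨_, hmem (Classical.arbitrary Θ)⟩
    have hcard : (V'.card : ℝ) ≤ G :=
      le_trans (by exact_mod_cast Finset.card_filter_le _ _) hVG
    refine sum_signs_le V' ?_ hη hcard ?_ hG _ fun σ => ?_
    · intro v hv j
      obtain ⟨θ, rfl⟩ := (Finset.mem_filter.1 hv).2
      have := hf0 θ (y j).1; have := hf0 θ (y j).2
      have := hf1 θ (y j).1; have := hf1 θ (y j).2
      rw [abs_le]; constructor <;> simp only <;> linarith
    · exact le_trans (by exact_mod_cast hne.card_pos) hcard
    · obtain ⟨v, hv, hmax⟩ := Finset.exists_max_image V'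
        (fun v => |∑ j, (if σ j then v j else - v j)|) hne
      exact ⟨v, hv, ciSup_le fun θ => hmax _ (hmem θ)⟩
  have h4 : 2 ^ Fintype.card ι * ∫ y, signedDev f σ₁ y ∂ρ ≤
      2 ^ Fintype.card ι * (Fintype.card ι * η) := by
    have h5 : ∑ σ : ι → Bool, ∫ y, signedDev f σ y ∂ρ =
        2 ^ Fintype.card ι * ∫ y, signedDev f σ₁ y ∂ρ := by
      rw [Finset.sum_congr rfl fun σ _ => step3 σ]; simp
    rw [← h5, ← integral_finsetSum _ fun σ _ => hsρ σ]
    refine (integral_mono (integrable_finsetSum _ fun σ _ => hsρ σ)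
      (integrable_const _) hpt).trans ?_
    simp
  exact step2.trans (le_of_mul_le_mul_left h4 (by positivity))

end Symmetrization

/-! ### Distributed selection -/

section Programs

variable {k s : ℕ}

theorem Comm.bind_apply {α β : Type} (x : Comm k s α) (f : α → Comm k s β) (N : Network k s) :
    (x >>= f) N = f (x N).1 (x N).2 := rfl

theorem Comm.ite_apply {α : Type} (c : Prop) [Decidable c] (x y : Comm k s α) (N : Network k s) :
    (if c then x else y) N = if c then x N else y N := by split_ifs <;> rfl

/-- The weight of an example. -/
def Network.wt (N : Network k s) (a : Fin k × Fin s) : ℝ := (N.node a.1).weight a.2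

/-- All candidates. -/
def Network.cands (N : Network k s) : Finset (Fin k × Fin s) :=
  Finset.univ.filter fun a => a.2 ∈ (N.node a.1).cand

/-- All active examples. -/
def Network.actives (N : Network k s) : Finset (Fin k × Fin s) :=
  Finset.univ.filter fun a => a.2 ∈ (N.node a.1).active

/-- The center adds up local answers, while the analysis treats all examples as one population
indexed by pairs; this passes from one view to the other. -/
theorem sum_sum_filter {M : Type*} [AddCommMonoid M] (f : Fin k → Finset (Fin s))
    (P : Fin k → Fin s → Prop) [∀ i, DecidablePred (P i)]
    [DecidablePred fun a : Fin k × Fin s => P a.1 a.2] (g : Fin k → Fin s → M) :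
    ∑ i, ∑ x ∈ (f i).filter (P i), g i x =
      ∑ a ∈ (Finset.univ.filter fun a : Fin k × Fin s => a.2 ∈ f a.1).filter
        (fun a => P a.1 a.2), g a.1 a.2 := by
  rw [Finset.filter_filter, Finset.sum_filter, Fintype.sum_prod_type]
  refine Finset.sum_congr rfl fun i _ => ?_
  rw [← Finset.sum_filter]
  congr 1; ext x; simp

theorem sum_card_filter (f : Fin k → Finset (Fin s))
    (P : Fin k → Fin s → Prop) [∀ i, DecidablePred (P i)]
    [DecidablePred fun a : Fin k × Fin s => P a.1 a.2] :
    ∑ i, (((f i).filter (P i)).card : ℝ) =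
      (((Finset.univ.filter fun a : Fin k × Fin s => a.2 ∈ f a.1).filter
        (fun a => P a.1 a.2)).card : ℝ) := by
  have := sum_sum_filter f P (fun _ _ => (1 : ℝ))
  simpa using this

theorem sum_card_cand (N : Network k s) :
    ∑ i, (N.node i).cand.card = N.cands.card := by
  have := sum_card_filter (fun i => (N.node i).cand) (fun _ _ => True)
  simp only [Finset.filter_true] at this
  exact_mod_cast this

/-- The pivot of an iteration of the selection. -/
noncomputable def Network.pivot (N : Network k s) : ℝ :=
  DistBoost.pivot fun i => ![(N.node i).median, ((N.node i).cand.card : ℝ)]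

/-- The network after the candidates on one side of `p` are kept: those below `p` if `c < 0`. -/
noncomputable def Network.discard (N : Network k s) (p c : ℝ) : Network k s where
  node := fun i => { N.node i with cand := (N.node i).cand.filter fun x =>
    if c < 0 then (N.node i).weight x < p else p < (N.node i).weight x }
  words := N.words + k * 2 + k * 1 + k * 2 + k * 2

/-- Unfolds the monadic program once, in terms of the pooled candidates, so that the later arguments
deal with pure functions of the network. -/
theorem select_succ (fuel : ℕ) (j : ℝ) (N : Network k s) :
    select (fuel + 1) j N =
      if (((N.cands.filter fun a => N.wt a < N.pivot).card : ℝ) ≤ j ∧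
        j < ((N.cands.filter fun a => N.wt a < N.pivot).card : ℝ) +
          ((N.cands.filter fun a => N.wt a = N.pivot).card : ℝ)) then
        (N.pivot, { N with words := N.words + k * 2 + k * 1 + k * 2 })
      else
        select fuel (if j < ((N.cands.filter fun a => N.wt a < N.pivot).card : ℝ) then j else
          j - (((N.cands.filter fun a => N.wt a < N.pivot).card : ℝ) +
          ((N.cands.filter fun a => N.wt a = N.pivot).card : ℝ)))
          (N.discard N.pivot (if j < ((N.cands.filter fun a => N.wt a < N.pivot).card : ℝ)
            then -1 else 1)) := by
  have e1 : ∑ i, ((((N.node i).cand.filter fun x => (N.node i).weight x < N.pivot).card : ℝ)) =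
      ((N.cands.filter fun a => N.wt a < N.pivot).card : ℝ) :=
    sum_card_filter (fun i => (N.node i).cand) (fun i x => (N.node i).weight x < N.pivot)
  have e2 : ∑ i, ((((N.node i).cand.filter fun x => (N.node i).weight x = N.pivot).card : ℝ)) =
      ((N.cands.filter fun a => N.wt a = N.pivot).card : ℝ) :=
    sum_card_filter (fun i => (N.node i).cand) (fun i x => (N.node i).weight x = N.pivot)
  rw [select, ← e1, ← e2]
  simp only [Comm.bind_apply, Comm.ite_apply]
  rfl

/-- In the sorted list the entries of index at most `card / 2` (counted from `0`) are `≤` the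
median, and those of index at least `card / 2` are `≥` it. These are `card / 2 + 1` and `card - card
/ 2` entries, both at least half. -/
theorem half_le_card_le_getD (M : Multiset ℝ) :
    M.card ≤ 2 * M.countP (· ≤ (M.sort (· ≤ ·)).getD (M.card / 2) 0) ∧
    M.card ≤ 2 * M.countP ((M.sort (· ≤ ·)).getD (M.card / 2) 0 ≤ ·) := by
  set l := M.sort (· ≤ ·) with hl
  have hM : (l : Multiset ℝ) = M := Multiset.sort_eq _ _
  have hs : l.Pairwise (· ≤ ·) := Multiset.pairwise_sort _ _
  have hlen : M.card = l.length := by rw [← hM]; rfl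
  rcases Nat.eq_zero_or_pos M.card with h0 | hpos
  · simp [h0]
  have hlt : M.card / 2 < l.length := by omega
  set v := l.getD (M.card / 2) 0 with hv
  have hv' : v = l[M.card / 2] := by rw [hv, List.getD_eq_getElem _ _ hlt]
  have hmono : ∀ i j (hi : i < l.length) (hj : j < l.length), i ≤ j → l[i] ≤ l[j] := by
    intro i j hi hj hij
    rcases hij.eq_or_lt with rfl | h
    · exact le_rfl
    · exact List.pairwise_iff_getElem.1 hs i j hi hj h
  rw [← hM, Multiset.coe_countP, Multiset.coe_countP, Multiset.coe_card]
  constructor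
  · have h1 : (l.take (M.card / 2 + 1)).countP (fun a => decide (a ≤ v)) = M.card / 2 + 1 := by
      have : (l.take (M.card / 2 + 1)).length = M.card / 2 + 1 := by simp; omega
      refine Eq.trans (List.countP_eq_length.2 fun a ha => ?_) this
      obtain ⟨i, hi, rfl⟩ := List.getElem_of_mem ha
      rw [List.getElem_take, hv']
      simp only [decide_eq_true_eq]
      exact hmono _ _ _ _ (by simp at hi; omega)
    have h2 := (List.take_sublist (M.card / 2 + 1) l).countP_le (p := fun a => decide (a ≤ v))
    omega
  · have h1 : (l.drop (M.card / 2)).countP (fun a => decide (v ≤ a)) = M.card - M.card / 2 := by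
      have : (l.drop (M.card / 2)).length = M.card - M.card / 2 := by simp; omega
      refine Eq.trans (List.countP_eq_length.2 fun a ha => ?_) this
      obtain ⟨i, hi, rfl⟩ := List.getElem_of_mem ha
      rw [List.getElem_drop, hv']
      simp only [decide_eq_true_eq]
      exact hmono _ _ _ _ (by omega)
    have h2 := (List.drop_sublist (M.card / 2) l).countP_le (p := fun a => decide (v ≤ a))
    omega

theorem Node.card_cand_le_median (e : Node s) :
    e.cand.card ≤ 2 * (e.cand.filter fun x => e.weight x ≤ e.median).card ∧
    e.cand.card ≤ 2 * (e.cand.filter fun x => e.median ≤ e.weight x).card := by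
  have h := half_le_card_le_getD (e.cand.val.map e.weight)
  simp only [Multiset.countP_map, Multiset.card_map] at h
  exact h

/-- The set in the definition of `pivot` is finite and contains the largest local median of an
entity with candidates, so the infimum is attained. Its minimality gives the strict second half. -/
theorem pivot_spec {ι : ℕ} (m : Fin ι → ℝ) (c : Fin ι → ℕ) (hc : 0 < ∑ i, c i) :
    (∑ i, c i ≤ 2 * ∑ i with m i ≤ DistBoost.pivot (fun i => ![m i, (c i : ℝ)]), c i) ∧
    (2 * ∑ i with m i < DistBoost.pivot (fun i => ![m i, (c i : ℝ)]), c i < ∑ i, c i) := by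
  classical
  set p := DistBoost.pivot (fun i => ![m i, (c i : ℝ)]) with hp
  set S : Set ℝ := {p | (∃ i, 0 < c i ∧ p = m i) ∧
    ∑ i, c i ≤ 2 * ∑ i with m i ≤ p, c i} with hS
  have hpS : p = sInf S := by
    rw [hp, DistBoost.pivot, hS]
    congr 1
    ext q
    simp only [Matrix.cons_val_zero, Matrix.cons_val_one, Set.mem_ofPred_eq, Nat.cast_pos]
    refine and_congr Iff.rfl ?_
    exact_mod_cast Iff.rfl
  have hfin : S.Finite := (Set.finite_range m).subset fun q hq => by
    obtain ⟨⟨i, _, rfl⟩, _⟩ := hq; exact ⟨i, rfl⟩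
  have hpos : (Finset.univ.filter fun i => 0 < c i).Nonempty := by
    by_contra h
    rw [Finset.not_nonempty_iff_eq_empty, Finset.filter_eq_empty_iff] at h
    exact hc.ne' (Finset.sum_eq_zero fun i _ => by have := h (Finset.mem_univ i); omega)
  have hsub : ∀ A B : Finset (Fin ι), (∀ i ∈ A, 0 < c i → i ∈ B) → ∑ i ∈ A, c i ≤ ∑ i ∈ B, c i := by
    intro A B h
    rw [← Finset.sum_filter_ne_zero]
    refine Finset.sum_le_sum_of_subset fun i hi => ?_
    obtain ⟨h1, h2⟩ := Finset.mem_filter.1 hi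
    exact h i h1 (Nat.pos_of_ne_zero h2)
  have hne : S.Nonempty := by
    obtain ⟨i, hi, hmax⟩ := Finset.exists_max_image _ m hpos
    refine ⟨m i, ⟨i, (Finset.mem_filter.1 hi).2, rfl⟩, ?_⟩
    have := hsub Finset.univ (Finset.univ.filter fun l => m l ≤ m i) fun l _ hl =>
      Finset.mem_filter.2 ⟨Finset.mem_univ _, hmax l (Finset.mem_filter.2 ⟨Finset.mem_univ _, hl⟩)⟩
    omega
  have hmem : p ∈ S := hpS ▸ hne.csInf_mem hfin
  refine ⟨hmem.2, ?_⟩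
  -- Otherwise the largest local median below `p`, among entities that still have candidates, would
  -- already lie in `S`, below its infimum.
  by_contra! hcon
  have hB : (Finset.univ.filter fun i => 0 < c i ∧ m i < p).Nonempty := by
    by_contra h
    rw [Finset.not_nonempty_iff_eq_empty, Finset.filter_eq_empty_iff] at h
    have := hsub (Finset.univ.filter fun i => m i < p) ∅ fun i hi hci =>
      absurd ⟨hci, (Finset.mem_filter.1 hi).2⟩ (h (Finset.mem_univ i))
    simp only [Finset.sum_empty] at this
    omega
  obtain ⟨i, hi, hmax⟩ := Finset.exists_max_image _ m hB
  obtain ⟨hci, hmi⟩ := (Finset.mem_filter.1 hi).2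
  have hiS : m i ∈ S := by
    refine ⟨⟨i, hci, rfl⟩, hcon.trans (Nat.mul_le_mul_left _ (hsub _ _ fun l hl hcl => ?_))⟩
    exact Finset.mem_filter.2 ⟨Finset.mem_univ _, hmax l
      (Finset.mem_filter.2 ⟨Finset.mem_univ _, hcl, (Finset.mem_filter.1 hl).2⟩)⟩
  have := csInf_le hfin.bddBelow hiS
  rw [← hpS] at this
  linarith

theorem sum_card_filter_nat (f : Fin k → Finset (Fin s))
    (P : Fin k → Fin s → Prop) [∀ i, DecidablePred (P i)]
    [DecidablePred fun a : Fin k × Fin s => P a.1 a.2] :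
    ∑ i, ((f i).filter (P i)).card =
      ((Finset.univ.filter fun a : Fin k × Fin s => a.2 ∈ f a.1).filter
        (fun a => P a.1 a.2)).card := by
  exact_mod_cast sum_card_filter f P

/-- Half of the candidates belong to entities whose median is on the given side of the pivot, and
half of the candidates of such an entity are on that side of its median: a quarter in all. -/
theorem Network.card_cands_le_pivot (N : Network k s) (h : 0 < N.cands.card) :
    N.cands.card ≤ 4 * (N.cands.filter fun a => N.wt a ≤ N.pivot).card ∧
    N.cands.card ≤ 4 * (N.cands.filter fun a => N.pivot ≤ N.wt a).card := by
  have hp := pivot_spec (fun i => (N.node i).median) (fun i => (N.node i).cand.card)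
    (by rw [sum_card_cand]; exact h)
  rw [sum_card_cand] at hp
  change (_ ≤ 2 * ∑ i with (N.node i).median ≤ N.pivot, _) ∧
    (2 * ∑ i with (N.node i).median < N.pivot, _ < _) at hp
  have e1 : ∑ i, (((N.node i).cand.filter fun x => (N.node i).weight x ≤ N.pivot).card) =
      ((N.cands.filter fun a => N.wt a ≤ N.pivot).card) :=
    sum_card_filter_nat (fun i => (N.node i).cand) (fun i x => (N.node i).weight x ≤ N.pivot)
  have e2 : ∑ i, (((N.node i).cand.filter fun x => N.pivot ≤ (N.node i).weight x).card) =
      ((N.cands.filter fun a => N.pivot ≤ N.wt a).card) :=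
    sum_card_filter_nat (fun i => (N.node i).cand) (fun i x => N.pivot ≤ (N.node i).weight x)
  constructor
  · have h1 : ∑ i with (N.node i).median ≤ N.pivot, (N.node i).cand.card ≤
        2 * ∑ i, (((N.node i).cand.filter fun x => (N.node i).weight x ≤ N.pivot).card) := by
      rw [Finset.mul_sum]
      refine le_trans (Finset.sum_le_sum fun i hi => ?_)
        (Finset.sum_le_sum_of_subset (Finset.filter_subset _ _))
      refine (N.node i).card_cand_le_median.1.trans (Nat.mul_le_mul_left _ ?_)
      refine Finset.card_le_card (Finset.monotone_filter_right _ fun x _ hx => ?_)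
      exact hx.trans (Finset.mem_filter.1 hi).2
    omega
  · have h1 : ∑ i with ¬ (N.node i).median < N.pivot, (N.node i).cand.card ≤
        2 * ∑ i, (((N.node i).cand.filter fun x => N.pivot ≤ (N.node i).weight x).card) := by
      rw [Finset.mul_sum]
      refine le_trans (Finset.sum_le_sum fun i hi => ?_)
        (Finset.sum_le_sum_of_subset (Finset.filter_subset _ _))
      refine (N.node i).card_cand_le_median.2.trans (Nat.mul_le_mul_left _ ?_)
      refine Finset.card_le_card (Finset.monotone_filter_right _ fun x _ hx => ?_)
      exact (not_lt.1 (Finset.mem_filter.1 hi).2).trans hx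
    have h2 := Finset.sum_filter_add_sum_filter_not Finset.univ
      (fun i => (N.node i).median < N.pivot) fun i => (N.node i).cand.card
    rw [sum_card_cand] at h2
    omega

theorem Network.cands_discard (N : Network k s) (p c : ℝ) :
    (N.discard p c).cands = N.cands.filter fun a => if c < 0 then N.wt a < p else p < N.wt a := by
  ext a
  rw [Finset.mem_filter, Network.cands, Network.cands, Finset.mem_filter, Finset.mem_filter]
  simp only [Network.discard, Network.wt]
  rw [Finset.mem_filter, and_assoc]

/-- Pays for one iteration: the logarithm to base `4/3` drops by at least one when a quarter of the
candidates disappears. -/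
theorem one_add_log_div_le {c c' : ℕ} (h : 4 * c' ≤ 3 * c) (hc' : 0 < c') :
    1 + Real.log c' / Real.log (4 / 3) ≤ Real.log c / Real.log (4 / 3) := by
  have hl43 : 0 < Real.log (4 / 3) := Real.log_pos (by norm_num)
  have hpos' : (0 : ℝ) < c' := by exact_mod_cast hc'
  have h1 : ((4 : ℝ) / 3) * c' ≤ c := by
    have : (4 : ℝ) * c' ≤ 3 * c := by exact_mod_cast h
    linarith
  have h2 := Real.log_le_log (by positivity) h1
  rw [Real.log_mul (by norm_num) hpos'.ne'] at h2
  rw [le_div_iff₀ hl43, add_mul, div_mul_cancel₀ _ hl43.ne']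
  linarith

/-- The rank is kept as a real number, so that half of an odd number needs no rounding: the result
is characterized by the counts below it and up to it. Fuel suffices because each unfinished
iteration removes a candidate; it costs `7 k` words. -/
theorem select_spec (fuel : ℕ) : ∀ (j : ℝ) (N : Network k s), 0 ≤ j → j < N.cands.card →
    N.cands.card ≤ fuel →
    (∀ i, (((select fuel j N).2.node i).weight = (N.node i).weight ∧
      ((select fuel j N).2.node i).active = (N.node i).active)) ∧
    (((N.cands.filter fun a => N.wt a < (select fuel j N).1).card : ℝ) ≤ j ∧
      j < (N.cands.filter fun a => N.wt a ≤ (select fuel j N).1).card) ∧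
    (((select fuel j N).2.words : ℝ) ≤
      N.words + 7 * k * (1 + Real.log N.cands.card / Real.log (4 / 3))) := by
  induction fuel with
  | zero => intro j N h0 h1 h2; exfalso; simp at h2; simp [h2] at h1; linarith
  | succ fuel ih =>
    intro j N h0 h1 h2
    have hcpos : 0 < N.cands.card := by
      have : (0 : ℝ) < N.cands.card := h0.trans_lt h1
      exact_mod_cast this
    have hlog : 0 ≤ Real.log N.cands.card := Real.log_natCast_nonneg _
    have hq := N.card_cands_le_pivot hcpos
    rw [select_succ]
    set p := N.pivot with hp
    have hle : (N.cands.filter fun a => N.wt a ≤ p).card =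
        (N.cands.filter fun a => N.wt a < p).card + (N.cands.filter fun a => N.wt a = p).card := by
      rw [← Finset.card_union_of_disjoint]
      · congr 1; ext a; simp only [Finset.mem_filter, Finset.mem_union, le_iff_lt_or_eq]; tauto
      · rw [Finset.disjoint_filter]; intro a _ h h'; linarith
    have hge : (N.cands.filter fun a => N.wt a < p).card +
        (N.cands.filter fun a => p ≤ N.wt a).card = N.cands.card := by
      rw [← Finset.card_filter_add_card_filter_not (s := N.cands) (fun a => N.wt a < p)]
      simp only [not_lt]
    have hgt : (N.cands.filter fun a => N.wt a ≤ p).card +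
        (N.cands.filter fun a => p < N.wt a).card = N.cands.card := by
      rw [← Finset.card_filter_add_card_filter_not (s := N.cands) (fun a => N.wt a ≤ p)]
      simp only [not_le]
    by_cases hfound : (((N.cands.filter fun a => N.wt a < p).card : ℝ) ≤ j ∧
        j < ((N.cands.filter fun a => N.wt a < p).card : ℝ) +
          ((N.cands.filter fun a => N.wt a = p).card : ℝ))
    · rw [if_pos hfound]
      refine ⟨fun i => ⟨rfl, rfl⟩, ⟨hfound.1, ?_⟩, ?_⟩
      · rw [hle]; push_cast; exact hfound.2
      · push_cast
        have : (0 : ℝ) ≤ 7 * k * (Real.log N.cands.card / Real.log (4 / 3)) := by positivity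
        have : (0 : ℝ) ≤ k := by positivity
        linarith
    rw [if_neg hfound]
    set lo : ℝ := ((N.cands.filter fun a => N.wt a < p).card : ℝ) with hlo
    set N' := N.discard p (if j < lo then -1 else 1) with hN'
    have hwt : N'.wt = N.wt := rfl
    have words' : (N'.words : ℝ) = N.words + 7 * k := by
      simp only [hN', Network.discard]; push_cast; ring
    -- the words of the remaining iterations
    have fin : ∀ (W : ℝ), 4 * N'.cands.card ≤ 3 * N.cands.card → 0 < N'.cands.card →
        W ≤ N'.words + 7 * k * (1 + Real.log N'.cands.card / Real.log (4 / 3)) →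
        W ≤ N.words + 7 * k * (1 + Real.log N.cands.card / Real.log (4 / 3)) := by
      intro W h34 hpos hW
      have := mul_le_mul_of_nonneg_left (one_add_log_div_le h34 hpos)
        (by positivity : (0 : ℝ) ≤ 7 * k)
      rw [words'] at hW
      linarith
    by_cases hjlo : j < lo
    · have hc' : N'.cands = N.cands.filter fun a => N.wt a < p := by
        rw [hN', if_pos hjlo, N.cands_discard]; simp
      rw [if_pos hjlo]
      have hcard : (N'.cands.card : ℝ) = lo := by rw [hc']
      have hcn : N'.cands.card = (N.cands.filter fun a => N.wt a < p).card := by rw [hc']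
      obtain ⟨i1, ⟨i2, i3⟩, i4⟩ := ih j N' h0 (by rw [hcard]; exact hjlo) (by
        have : 4 * (N.cands.filter fun a => N.wt a < p).card ≤ 3 * N.cands.card := by omega
        omega)
      set q := (select fuel j N').1 with hqq
      -- If the result exceeded `p`, all the kept candidates would be below it. Their number `lo` is
      -- larger than `j`, against the specification of the recursive call.
      have hqp : q ≤ p := by
        by_contra! hlt
        rw [hc', hwt, Finset.filter_filter] at i2
        have : (N.cands.filter fun a => N.wt a < p ∧ N.wt a < q) =
            N.cands.filter fun a => N.wt a < p := by
          refine Finset.filter_congr fun a _ => ?_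
          exact ⟨fun h => h.1, fun h => ⟨h, h.trans hlt⟩⟩
        rw [this] at i2
        linarith
      refine ⟨i1, ⟨?_, ?_⟩, fin _ (by omega) ?_ i4⟩
      · refine le_trans ?_ i2
        rw [hc', hwt, Finset.filter_filter]
        exact Nat.cast_le.2 (Finset.card_le_card (Finset.monotone_filter_right _
          fun a _ h => ⟨lt_of_lt_of_le h hqp, h⟩))
      · refine i3.trans_le ?_
        rw [hc', hwt, Finset.filter_filter]
        exact Nat.cast_le.2 (Finset.card_le_card (Finset.monotone_filter_right _
          fun a _ h => h.2))
      · have : (0 : ℝ) < N'.cands.card := by rw [hcard]; linarith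
        exact_mod_cast this
    · have hc' : N'.cands = N.cands.filter fun a => p < N.wt a := by
        rw [hN', if_neg hjlo, N.cands_discard]
        refine Finset.filter_congr fun a _ => ?_
        rw [if_neg (by norm_num)]
      rw [if_neg hjlo]
      have hcn : N'.cands.card = (N.cands.filter fun a => p < N.wt a).card := by rw [hc']
      have hlee : ((N.cands.filter fun a => N.wt a ≤ p).card : ℝ) = lo +
          (N.cands.filter fun a => N.wt a = p).card := by
        rw [hle]; push_cast; rfl
      rw [← hlee] at hfound ⊢
      have hj' : ((N.cands.filter fun a => N.wt a ≤ p).card : ℝ) ≤ j := by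
        by_contra! h; exact hfound ⟨not_lt.1 hjlo, h⟩
      set le := (N.cands.filter fun a => N.wt a ≤ p).card with hledef
      have hsum : (le : ℝ) + N'.cands.card = N.cands.card := by rw [hcn]; exact_mod_cast hgt
      obtain ⟨i1, ⟨i2, i3⟩, i4⟩ := ih (j - le) N' (by linarith) (by linarith) (by omega)
      set q := (select fuel (j - le) N').1 with hqq
      -- If the result were below `p`, no kept candidate would be at most it, while the recursive
      -- call promises more than `j - le ≥ 0` of them.
      have hpq : p ≤ q := by
        by_contra! hlt
        rw [hc', hwt, Finset.filter_filter] at i3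
        have : (N.cands.filter fun a => p < N.wt a ∧ N.wt a ≤ q) = ∅ := by
          refine Finset.filter_eq_empty_iff.2 fun a _ h => ?_
          linarith [h.1, h.2]
        rw [this] at i3
        simp at i3; linarith
      refine ⟨i1, ⟨?_, ?_⟩, fin _ (by omega) ?_ i4⟩
      · have : (N.cands.filter fun a => N.wt a < q).card ≤ le +
            (N'.cands.filter fun a => N'.wt a < q).card := by
          rw [hc', hwt, Finset.filter_filter, hledef]
          refine le_trans (Finset.card_le_card ?_) (Finset.card_union_le _ _)
          intro a ha
          simp only [Finset.mem_union, Finset.mem_filter] at ha ⊢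
          rcases le_or_gt (N.wt a) p with h | h
          · exact Or.inl ⟨ha.1, h⟩
          · exact Or.inr ⟨ha.1, h, ha.2⟩
        have : ((N.cands.filter fun a => N.wt a < q).card : ℝ) ≤ le +
            (N'.cands.filter fun a => N'.wt a < q).card := by exact_mod_cast this
        linarith
      · have : le + (N'.cands.filter fun a => N'.wt a ≤ q).card ≤
            (N.cands.filter fun a => N.wt a ≤ q).card := by
          rw [hc', hwt, Finset.filter_filter, hledef, ← Finset.card_union_of_disjoint]
          · refine Finset.card_le_card fun a ha => ?_
            simp only [Finset.mem_union, Finset.mem_filter] at ha ⊢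
            rcases ha with h | h
            · exact ⟨h.1, h.2.trans hpq⟩
            · exact ⟨h.1, h.2.2⟩
          · rw [Finset.disjoint_filter]; intro a _ h h'; linarith [h'.1]
        have : (le : ℝ) + (N'.cands.filter fun a => N'.wt a ≤ q).card ≤
            (N.cands.filter fun a => N.wt a ≤ q).card := by exact_mod_cast this
        linarith
      · have : (0 : ℝ) < N'.cands.card := by linarith
        exact_mod_cast this

end Programs

/-! ### The distributed median and one pass of the threshold search -/

section Projection

variable {k s : ℕ}

/-- At most half of the active weights lie strictly on either side of `θ`, whichever side is kept;
and `θ` is itself an active weight, which is what the invariant of the search needs. -/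
theorem findMedian_spec (N : Network k s) (h : 0 < N.actives.card) :
    (∀ i, (((findMedian (N.actives.card : ℝ) N).2.node i).weight = (N.node i).weight ∧
      ((findMedian (N.actives.card : ℝ) N).2.node i).active = (N.node i).active)) ∧
    2 * (N.actives.filter fun a => N.wt a < (findMedian (N.actives.card : ℝ) N).1).card ≤
      N.actives.card ∧
    2 * (N.actives.filter fun a => (findMedian (N.actives.card : ℝ) N).1 < N.wt a).card ≤
      N.actives.card ∧
    (∃ a ∈ N.actives, N.wt a = (findMedian (N.actives.card : ℝ) N).1) ∧
    ((findMedian (N.actives.card : ℝ) N).2.words : ℝ) ≤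
      N.words + 7 * k * (1 + Real.log (k * s : ℕ) / Real.log (4 / 3)) := by
  set N' : Network k s := { N with node := fun i => { N.node i with cand := (N.node i).active } }
    with hN'
  have hrun : findMedian (N.actives.card : ℝ) N = select (k * s) ((N.actives.card : ℝ) / 2) N' := rfl
  have hc : N'.cands = N.actives := rfl
  have hwt : N'.wt = N.wt := rfl
  have hle : N.actives.card ≤ k * s := by
    refine (Finset.card_le_univ _).trans ?_
    simp
  have hpos : (0 : ℝ) < N.actives.card := by exact_mod_cast h
  obtain ⟨h1, ⟨h2, h3⟩, h4⟩ := select_spec (k * s) ((N.actives.card : ℝ) / 2) N' (by positivity)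
    (by rw [hc]; linarith) (by rw [hc]; exact hle)
  rw [hrun]
  set θ := (select (k * s) ((N.actives.card : ℝ) / 2) N').1
  rw [hc, hwt] at h2 h3
  have hgt : (N.actives.filter fun a => N.wt a ≤ θ).card +
      (N.actives.filter fun a => θ < N.wt a).card = N.actives.card := by
    rw [← Finset.card_filter_add_card_filter_not (s := N.actives) (fun a => N.wt a ≤ θ)]
    simp only [not_le]
  refine ⟨h1, ?_, ?_, ?_, ?_⟩
  · have : (2 : ℝ) * (N.actives.filter fun a => N.wt a < θ).card ≤ N.actives.card := by linarith
    exact_mod_cast this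
  · have h5 : (N.actives.card : ℝ) < 2 * (N.actives.filter fun a => N.wt a ≤ θ).card := by linarith
    have h6 : N.actives.card < 2 * (N.actives.filter fun a => N.wt a ≤ θ).card := by
      exact_mod_cast h5
    omega
  -- Without an active weight equal to `θ` the counts of weights `< θ` and `≤ θ` agree, yet half of
  -- the active number separates them.
  · by_contra! hcon
    have : (N.actives.filter fun a => N.wt a ≤ θ) = N.actives.filter fun a => N.wt a < θ :=
      Finset.filter_congr fun a ha => ⟨fun h => lt_of_le_of_ne h (hcon a ha), fun h => h.le⟩
    rw [this] at h3
    linarith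
  · refine h4.trans ?_
    rw [hc]
    have : Real.log N.actives.card ≤ Real.log (k * s : ℕ) :=
      Real.log_le_log hpos (by exact_mod_cast hle)
    have h43 : 0 < Real.log (4 / 3) := Real.log_pos (by norm_num)
    have hw : N'.words = N.words := rfl
    rw [hw]
    gcongr

/-- The network after an iteration of the loop of the projection. -/
noncomputable def Network.clip (N : Network k s) (cap θ m : ℝ) : Network k s where
  node := fun i => { N.node i with active := (N.node i).active.filter fun x =>
    if cap < θ * m then (N.node i).weight x < θ else θ < (N.node i).weight x }
  words := N.words + k * 1 + k * 5 + k * 2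

theorem Network.actives_clip (N : Network k s) (cap θ m : ℝ) :
    (N.clip cap θ m).actives =
      N.actives.filter fun a => if cap < θ * m then N.wt a < θ else θ < N.wt a := by
  ext a
  rw [Finset.mem_filter, Network.actives, Network.actives, Finset.mem_filter, Finset.mem_filter]
  simp only [Network.clip, Network.wt]
  rw [Finset.mem_filter, and_assoc]

/-- The factor for the weights that are not clipped, if those above `θ` are. -/
noncomputable def Network.factor (N : Network k s) (cap C Cw θ : ℝ) : ℝ :=
  (1 - (C + ((N.actives.filter fun a => θ < N.wt a).card : ℝ)) * cap) /
    (1 - (Cw + ∑ a ∈ N.actives with θ < N.wt a, N.wt a))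

theorem projectLoop_of_ne (cap : ℝ) (fuel : ℕ) {n₀ : ℝ} (C Cw θ₀ : ℝ) (N N₁ : Network k s) (θ : ℝ)
    (hn : n₀ ≠ 0) (h : findMedian n₀ N = (θ, N₁)) :
    projectLoop cap (fuel + 1) n₀ C Cw θ₀ N =
      if cap < θ * N₁.factor cap C Cw θ then
        if ((N₁.actives.filter fun a => N₁.wt a < θ).card : ℝ) = 0 then
          projectLoop cap fuel ((N₁.actives.filter fun a => N₁.wt a < θ).card : ℝ)
            (C + ((N₁.actives.filter fun a => θ < N₁.wt a).card : ℝ) +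
              ((N₁.actives.filter fun a => N₁.wt a = θ).card : ℝ))
            (Cw + (∑ a ∈ N₁.actives with θ < N₁.wt a, N₁.wt a) +
              ∑ a ∈ N₁.actives with N₁.wt a = θ, N₁.wt a)
            (⨆ i, sSup {v | ∃ x, v = (N₁.node i).weight x ∧ v < θ})
            { N₁.clip cap θ (N₁.factor cap C Cw θ) with
              words := (N₁.clip cap θ (N₁.factor cap C Cw θ)).words + k * 1 + k * 1 }
        else
          projectLoop cap fuel ((N₁.actives.filter fun a => N₁.wt a < θ).card : ℝ)
            (C + ((N₁.actives.filter fun a => θ < N₁.wt a).card : ℝ) +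
              ((N₁.actives.filter fun a => N₁.wt a = θ).card : ℝ))
            (Cw + (∑ a ∈ N₁.actives with θ < N₁.wt a, N₁.wt a) +
              ∑ a ∈ N₁.actives with N₁.wt a = θ, N₁.wt a)
            θ (N₁.clip cap θ (N₁.factor cap C Cw θ))
      else
        projectLoop cap fuel ((N₁.actives.filter fun a => θ < N₁.wt a).card : ℝ) C Cw θ
          (N₁.clip cap θ (N₁.factor cap C Cw θ)) := by
  have e1 : ∑ i, ((((N₁.node i).active.filter fun x => (N₁.node i).weight x < θ).card : ℝ)) =
      ((N₁.actives.filter fun a => N₁.wt a < θ).card : ℝ) :=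
    sum_card_filter (fun i => (N₁.node i).active) (fun i x => (N₁.node i).weight x < θ)
  have e2 : ∑ i, ((((N₁.node i).active.filter fun x => (N₁.node i).weight x = θ).card : ℝ)) =
      ((N₁.actives.filter fun a => N₁.wt a = θ).card : ℝ) :=
    sum_card_filter (fun i => (N₁.node i).active) (fun i x => (N₁.node i).weight x = θ)
  have e3 : ∑ i, ((((N₁.node i).active.filter fun x => θ < (N₁.node i).weight x).card : ℝ)) =
      ((N₁.actives.filter fun a => θ < N₁.wt a).card : ℝ) :=
    sum_card_filter (fun i => (N₁.node i).active) (fun i x => θ < (N₁.node i).weight x)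
  have e4 : ∑ i, ∑ x ∈ (N₁.node i).active with (N₁.node i).weight x = θ, (N₁.node i).weight x =
      ∑ a ∈ N₁.actives with N₁.wt a = θ, N₁.wt a :=
    sum_sum_filter (fun i => (N₁.node i).active) (fun i x => (N₁.node i).weight x = θ)
      (fun i x => (N₁.node i).weight x)
  have e5 : ∑ i, ∑ x ∈ (N₁.node i).active with θ < (N₁.node i).weight x, (N₁.node i).weight x =
      ∑ a ∈ N₁.actives with θ < N₁.wt a, N₁.wt a :=
    sum_sum_filter (fun i => (N₁.node i).active) (fun i x => θ < (N₁.node i).weight x)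
      (fun i x => (N₁.node i).weight x)
  rw [projectLoop, if_neg hn, Comm.bind_apply, h, Network.factor, ← e1, ← e2, ← e3, ← e4, ← e5]
  simp only [Comm.bind_apply, Comm.ite_apply]
  rfl

theorem projectLoop_zero_fuel (cap n₀ C Cw θ : ℝ) (N : Network k s) :
    projectLoop cap 0 n₀ C Cw θ N = ((C, Cw, θ), N) := rfl

theorem projectLoop_zero (cap : ℝ) (fuel : ℕ) (C Cw θ : ℝ) (N : Network k s) :
    projectLoop cap fuel 0 C Cw θ N = ((C, Cw, θ), N) := by
  cases fuel with
  | zero => rfl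
  | succ fuel => rw [projectLoop, if_pos rfl]; rfl

end Projection

/-! ### The invariant and the cost of the threshold search -/

section Projection

variable {k s : ℕ}

/-- The invariant of the loop of the projection of the weights `w`, where `bad v` means that the
weights that are at least `v` must be clipped. -/
structure ProjInv (w : Fin k × Fin s → ℝ) (bad : ℝ → Prop) (C Cw θ : ℝ) (N : Network k s) :
    Prop where
  wt : N.wt = w
  card : C = ∑ a : Fin k × Fin s, open Classical in if a ∉ N.actives ∧ bad (w a) then 1 else 0
  sum : Cw = ∑ a : Fin k × Fin s, open Classical in if a ∉ N.actives ∧ bad (w a) then w a else 0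
  above : ∀ a ∈ N.actives, ∀ c ∉ N.actives, bad (w c) → w a < w c
  below : ∀ a ∈ N.actives, ∀ c ∉ N.actives, ¬ bad (w c) → w c < w a
  final : N.actives = ∅ → ∀ a, θ < w a ↔ bad (w a)

/-- The words sent in one iteration of the loop. -/
noncomputable def iterationWords (k s : ℕ) : ℝ :=
  7 * k * (1 + Real.log (k * s : ℕ) / Real.log (4 / 3)) + 10 * k

theorem sum_indicator_filter {α : Type*} [Fintype α] [DecidableEq α] (A : Finset α)
    (P : α → Prop) [DecidablePred P] (g : α → ℝ) :
    ∑ a ∈ A.filter P, g a = ∑ a, if a ∈ A ∧ P a then g a else 0 := by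
  rw [← Finset.sum_filter]
  congr 1; ext a; simp

theorem card_indicator_filter {α : Type*} [Fintype α] [DecidableEq α] (A : Finset α)
    (P : α → Prop) [DecidablePred P] :
    ((A.filter P).card : ℝ) = ∑ a, if a ∈ A ∧ P a then (1 : ℝ) else 0 := by
  rw [← sum_indicator_filter A P fun _ => (1 : ℝ)]; simp

/-- The final clipping test is strict. If `θ` itself must be clipped, the threshold has to move to
the next smaller weight. Entities without one answer `sSup ∅ = 0`, which is harmless because `θ >
0`. -/
theorem lt_max_below_iff [NeZero k] (w : Fin k → Fin s → ℝ) {θ : ℝ}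
    (hθ : 0 < θ) (i : Fin k) (x : Fin s) :
    (⨆ i, sSup {v | ∃ x, v = w i x ∧ v < θ}) < w i x ↔ θ ≤ w i x := by
  have hfin : ∀ i, ({v | ∃ x, v = w i x ∧ v < θ}).Finite := fun i =>
    (Set.finite_range (w i)).subset fun v hv => by obtain ⟨x, rfl, _⟩ := hv; exact ⟨x, rfl⟩
  have hlt : ∀ i, sSup {v | ∃ x, v = w i x ∧ v < θ} < θ := by
    intro i
    rcases Set.eq_empty_or_nonempty {v | ∃ x, v = w i x ∧ v < θ} with h | h
    · rw [h, Real.sSup_empty]; exact hθ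
    · obtain ⟨_, _, h2⟩ := h.csSup_mem (hfin i); exact h2
  constructor
  · intro h
    by_contra! hcon
    have h1 : w i x ≤ sSup {v | ∃ x, v = w i x ∧ v < θ} :=
      le_csSup (hfin i).bddAbove ⟨x, rfl, hcon⟩
    have h2 := le_ciSup (f := fun i => sSup {v | ∃ x, v = w i x ∧ v < θ})
      (Set.finite_range _).bddAbove i
    exact absurd (h1.trans h2) (not_le.2 h)
  · intro h
    refine lt_of_lt_of_le ?_ h
    obtain ⟨i₀, hi₀⟩ := exists_eq_ciSup_of_finite
      (f := fun i => sSup {v | ∃ x, v = w i x ∧ v < θ})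
    rw [← hi₀]; exact hlt i₀

open Classical in
-- If `θ` need not be clipped, neither does anything below it, so the discarded examples leave `C`
-- and `Cw` unchanged, and `θ` separates correctly should nothing remain active.
theorem ProjInv.step_above {w : Fin k × Fin s → ℝ} {bad : ℝ → Prop} {C Cw θ₀ θ : ℝ}
    {N N' : Network k s} (h : ProjInv w bad C Cw θ₀ N)
    (hmono : ∀ a b, w a ≤ w b → bad (w a) → bad (w b)) {a₀ : Fin k × Fin s}
    (ha₀ : a₀ ∈ N.actives) (hθ : w a₀ = θ) (hnot : ¬ bad θ) (hwt : N'.wt = w) (hact : N'.actives = N.actives.filter fun a => θ < w a) :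
    ProjInv w bad C Cw θ N' := by
  have hiff : ∀ a, (a ∉ N'.actives ∧ bad (w a)) ↔ (a ∉ N.actives ∧ bad (w a)) := by
    intro a
    rw [hact, Finset.mem_filter]
    refine ⟨fun ⟨h1, h2⟩ => ⟨fun h3 => h1 ⟨h3, ?_⟩, h2⟩, fun ⟨h1, h2⟩ => ⟨fun h3 => h1 h3.1, h2⟩⟩
    by_contra! h4
    exact hnot (hθ ▸ hmono a a₀ (hθ ▸ h4) h2)
  have hsub : ∀ a ∈ N'.actives, a ∈ N.actives ∧ θ < w a := fun a ha => by
    rwa [hact, Finset.mem_filter] at ha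
  refine ⟨hwt, ?_, ?_, ?_, ?_, ?_⟩
  · rw [h.card]; exact Finset.sum_congr rfl fun a _ => if_congr (hiff a).symm rfl rfl
  · rw [h.sum]; exact Finset.sum_congr rfl fun a _ => if_congr (hiff a).symm rfl rfl
  · intro a ha c hc hbad
    exact h.above a (hsub a ha).1 c ((hiff c).1 ⟨hc, hbad⟩).1 hbad
  · intro a ha c hc hbad
    by_cases hc' : c ∈ N.actives
    · have : ¬ θ < w c := fun h' => hc (by rw [hact]; exact Finset.mem_filter.2 ⟨hc', h'⟩)
      linarith [(hsub a ha).2]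
    · exact h.below a (hsub a ha).1 c hc' hbad
  · intro hemp a
    constructor
    · intro hlt
      by_contra hbad
      by_cases ha : a ∈ N.actives
      · have : a ∈ N'.actives := by rw [hact]; exact Finset.mem_filter.2 ⟨ha, hlt⟩
        simp [hemp] at this
      · linarith [h.below a₀ ha₀ a ha hbad]
    · intro hbad
      by_contra! hle
      exact hnot (hθ ▸ hmono a a₀ (hθ ▸ hle) hbad)

open Classical in
-- If `θ` must be clipped, so must everything above it, and these active examples enter `C` and
-- `Cw`. The new threshold matters only when the search ends here, hence the conditional `hfin`.
theorem ProjInv.step_below {w : Fin k × Fin s → ℝ} {bad : ℝ → Prop} {C Cw θ₀ θ θ' : ℝ}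
    {N N' : Network k s} (h : ProjInv w bad C Cw θ₀ N)
    (hmono : ∀ a b, w a ≤ w b → bad (w a) → bad (w b)) {a₀ : Fin k × Fin s}
    (ha₀ : a₀ ∈ N.actives) (hθ : w a₀ = θ) (hbadθ : bad θ)
    (hwt : N'.wt = w) (hact : N'.actives = N.actives.filter fun a => w a < θ)
    (hfin : N'.actives = ∅ → ∀ a, θ' < w a ↔ θ ≤ w a) :
    ProjInv w bad (C + ((N.actives.filter fun a => θ < w a).card : ℝ) +
        ((N.actives.filter fun a => w a = θ).card : ℝ))
      (Cw + (∑ a ∈ N.actives with θ < w a, w a) + ∑ a ∈ N.actives with w a = θ, w a) θ' N' := by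
  have hge : ∀ a, θ ≤ w a → bad (w a) := fun a ha => hmono a₀ a (hθ ▸ ha) (hθ.symm ▸ hbadθ)
  have hmem : ∀ a, a ∈ N'.actives ↔ a ∈ N.actives ∧ w a < θ := fun a => by
    rw [hact, Finset.mem_filter]
  refine ⟨hwt, ?_, ?_, ?_, ?_, ?_⟩
  · rw [h.card, card_indicator_filter, card_indicator_filter, ← Finset.sum_add_distrib,
      ← Finset.sum_add_distrib]
    refine Finset.sum_congr rfl fun a _ => ?_
    have h1 := hmem a
    have h2 := hge a
    by_cases ha : a ∈ N.actives
    · rcases lt_trichotomy (w a) θ with h3 | h3 | h3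
      · simp [h1, ha, h3, h3.not_gt, h3.ne]
      · simp [h1, ha, h3, hbadθ]
      · simp [h1, ha, h3, h3.not_gt, h3.ne', h2 h3.le]
    · simp [h1, ha]
  · rw [h.sum, sum_indicator_filter, sum_indicator_filter, ← Finset.sum_add_distrib,
      ← Finset.sum_add_distrib]
    refine Finset.sum_congr rfl fun a _ => ?_
    have h1 := hmem a
    have h2 := hge a
    by_cases ha : a ∈ N.actives
    · rcases lt_trichotomy (w a) θ with h3 | h3 | h3
      · simp [h1, ha, h3, h3.not_gt, h3.ne]
      · simp [h1, ha, h3, hbadθ]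
      · simp [h1, ha, h3, h3.not_gt, h3.ne', h2 h3.le]
    · simp [h1, ha]
  · intro a ha c hc hbad
    rw [hmem] at ha hc
    by_cases hc' : c ∈ N.actives
    · have : ¬ w c < θ := fun h' => hc ⟨hc', h'⟩
      linarith [ha.2]
    · exact h.above a ha.1 c hc' hbad
  · intro a ha c hc hbad
    rw [hmem] at ha hc
    by_cases hc' : c ∈ N.actives
    · exact absurd (hge c (not_lt.1 fun h' => hc ⟨hc', h'⟩)) hbad
    · exact h.below a ha.1 c hc' hbad
  · intro hemp a
    rw [hfin hemp]
    refine ⟨hge a, fun hbad => ?_⟩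
    by_contra! hlt
    by_cases ha : a ∈ N.actives
    · have : a ∈ N'.actives := (hmem a).2 ⟨ha, hlt⟩
      simp [hemp] at this
    · linarith [h.above a₀ ha₀ a ha hbad]

open Classical in
-- Since `θ` is an active weight, the inactive examples above it are exactly those already counted
-- as clipped. So the running totals agree with the global sums in `mustClip`.
theorem ProjInv.sum_gt {w : Fin k × Fin s → ℝ} {bad : ℝ → Prop} {C Cw θ₀ θ : ℝ}
    {N : Network k s} (h : ProjInv w bad C Cw θ₀ N) {a₀ : Fin k × Fin s}
    (ha₀ : a₀ ∈ N.actives) (hθ : w a₀ = θ) :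
    C + ((N.actives.filter fun a => θ < w a).card : ℝ) =
      ((Finset.univ.filter fun a => θ < w a).card : ℝ) ∧
    Cw + (∑ a ∈ N.actives with θ < w a, w a) = ∑ a with θ < w a, w a := by
  have key : ∀ a ∉ N.actives, bad (w a) ↔ θ < w a := fun a ha =>
    ⟨fun hb => hθ ▸ h.above a₀ ha₀ a ha hb, fun hlt => by
      by_contra hb
      linarith [h.below a₀ ha₀ a ha hb]⟩
  constructor
  · rw [h.card, card_indicator_filter, card_indicator_filter, ← Finset.sum_add_distrib]
    refine Finset.sum_congr rfl fun a _ => ?_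
    by_cases ha : a ∈ N.actives
    · simp [ha]
    · simp [ha, key a ha]
  · rw [h.sum, sum_indicator_filter, sum_indicator_filter, ← Finset.sum_add_distrib]
    refine Finset.sum_congr rfl fun a _ => ?_
    by_cases ha : a ∈ N.actives
    · simp [ha]
    · simp [ha, key a ha]

/-- Whether the weights that are at least `v` must be clipped. -/
def mustClip (w : Fin k × Fin s → ℝ) (cap v : ℝ) : Prop :=
  cap < v * ((1 - ((Finset.univ.filter fun a => v < w a).card : ℝ) * cap) /
    (1 - ∑ a with v < w a, w a))

/-- One iteration of the loop. -/
theorem projectLoop_step [NeZero k] (cap : ℝ) (fuel : ℕ) (C Cw θ₀ : ℝ) (N : Network k s)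
    (hN : 0 < N.actives.card) : ∃ (C' Cw' θ' : ℝ) (N' : Network k s),
      projectLoop cap (fuel + 1) N.actives.card C Cw θ₀ N =
        projectLoop cap fuel N'.actives.card C' Cw' θ' N' ∧
      2 * N'.actives.card ≤ N.actives.card ∧
      (N'.words : ℝ) ≤ N.words + iterationWords k s ∧
      ∀ w : Fin k × Fin s → ℝ, (∀ a, 0 < w a) →
        (∀ a b, w a ≤ w b → mustClip w cap (w a) → mustClip w cap (w b)) →
        ProjInv w (mustClip w cap) C Cw θ₀ N → ProjInv w (mustClip w cap) C' Cw' θ' N' := by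
  obtain ⟨h1, h2, h3, ⟨a₀, ha₀, hθ⟩, h5⟩ := findMedian_spec N hN
  set θ := (findMedian (N.actives.card : ℝ) N).1 with hθdef
  set N₁ := (findMedian (N.actives.card : ℝ) N).2 with hN₁
  have hwt : N₁.wt = N.wt := by
    funext a; simp only [Network.wt]; rw [(h1 a.1).1]
  have hact : N₁.actives = N.actives := by
    simp only [Network.actives]
    refine Finset.filter_congr fun a _ => ?_
    rw [(h1 a.1).2]
  have hne : (N.actives.card : ℝ) ≠ 0 := by exact_mod_cast hN.ne'
  have hstep := projectLoop_of_ne cap fuel C Cw θ₀ N N₁ θ hne rfl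
  rw [hact, hwt] at hstep
  set m := N₁.factor cap C Cw θ with hm
  -- The test that the center makes from the messages is therefore `mustClip` at the median.
  have hfac : ∀ w : Fin k × Fin s → ℝ, ProjInv w (mustClip w cap) C Cw θ₀ N →
      (cap < θ * m ↔ mustClip w cap θ) := by
    intro w h
    have hs := h.sum_gt (θ := θ) ha₀ (by rw [← h.wt]; exact hθ)
    rw [mustClip, hm, Network.factor, hact, hwt, h.wt, hs.1, hs.2]
  have hclipact : (N₁.clip cap θ m).actives =
      N.actives.filter fun a => if cap < θ * m then N.wt a < θ else θ < N.wt a := by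
    rw [Network.actives_clip, hact, hwt]
  have hclipwt : (N₁.clip cap θ m).wt = N.wt := hwt
  -- The threshold, the five answers and the new cut cost `8 k` words; `2 k` are reserved for the
  -- possible query of the next smaller weight.
  have hwords : ((N₁.clip cap θ m).words : ℝ) + 2 * k ≤ N.words + iterationWords k s := by
    have : ((N₁.clip cap θ m).words : ℝ) = N₁.words + 8 * k := by
      simp only [Network.clip]; push_cast; ring
    rw [this, iterationWords]
    linarith
  by_cases hc : cap < θ * m
  · rw [if_pos hc] at hstep
    have hclipact' : (N₁.clip cap θ m).actives = N.actives.filter fun a => N.wt a < θ := by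
      rw [hclipact]; exact Finset.filter_congr fun a _ => by rw [if_pos hc]
    by_cases hL : ((N.actives.filter fun a => N.wt a < θ).card : ℝ) = 0
    · rw [if_pos hL, ← hclipact'] at hstep
      refine ⟨_, _, _,
        { N₁.clip cap θ m with words := (N₁.clip cap θ m).words + k * 1 + k * 1 },
        hstep, ?_, ?_, ?_⟩
      · change 2 * (N₁.clip cap θ m).actives.card ≤ _
        rw [hclipact']; exact h2
      · push_cast; linarith
      · intro w hw hmono h
        have hwN := h.wt
        subst hwN
        refine h.step_below hmono ha₀ hθ ((hfac _ h).1 hc) hclipwt hclipact' fun _ a => ?_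
        have := lt_max_below_iff (fun i x => N₁.wt (i, x))
          (hθ ▸ hw a₀ : 0 < θ) a.1 a.2
        rw [← hwt]
        exact this
    · rw [if_neg hL, ← hclipact'] at hstep
      refine ⟨_, _, _, N₁.clip cap θ m, hstep, ?_, ?_, ?_⟩
      · rw [hclipact']; exact h2
      · have : (0 : ℝ) ≤ k := by positivity
        linarith
      · intro w hw hmono h
        have hwN := h.wt
        subst hwN
        refine h.step_below hmono ha₀ hθ ((hfac _ h).1 hc) hclipwt hclipact' fun hemp a => ?_
        rw [hclipact'] at hemp
        simp [hemp] at hL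
  · rw [if_neg hc] at hstep
    have hclipact' : (N₁.clip cap θ m).actives = N.actives.filter fun a => θ < N.wt a := by
      rw [hclipact]; exact Finset.filter_congr fun a _ => by rw [if_neg hc]
    rw [← hclipact'] at hstep
    refine ⟨_, _, _, N₁.clip cap θ m, hstep, ?_, ?_, ?_⟩
    · rw [hclipact']; exact h3
    · have : (0 : ℝ) ≤ k := by positivity
      linarith
    · intro w hw hmono h
      have hwN := h.wt
      subst hwN
      exact h.step_above hmono ha₀ hθ (fun hb => hc ((hfac _ h).2 hb)) hclipwt hclipact'

theorem iterationWords_nonneg (k s : ℕ) : 0 ≤ iterationWords k s := by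
  have h1 : 0 < Real.log (4 / 3) := Real.log_pos (by norm_num)
  have h2 : 0 ≤ Real.log (k * s : ℕ) := Real.log_natCast_nonneg _
  unfold iterationWords
  positivity

/-- The bound on words needs no assumption on the weights, since halving always happens; correctness
needs positive weights and a monotone clipping test. `Nat.size`, the number of binary digits, counts
the halvings down to zero. -/
theorem projectLoop_spec [NeZero k] (cap : ℝ) (fuel : ℕ) : ∀ (C Cw θ : ℝ) (N : Network k s),
    N.actives.card ≤ fuel →
    (((projectLoop cap fuel N.actives.card C Cw θ N).2.words : ℝ) ≤
      N.words + iterationWords k s * Nat.size N.actives.card) ∧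
    ∀ w : Fin k × Fin s → ℝ, (∀ a, 0 < w a) →
      (∀ a b, w a ≤ w b → mustClip w cap (w a) → mustClip w cap (w b)) →
      ProjInv w (mustClip w cap) C Cw θ N →
      ∃ C' Cw' θ', (projectLoop cap fuel N.actives.card C Cw θ N).1 = (C', Cw', θ') ∧
        (projectLoop cap fuel N.actives.card C Cw θ N).2.actives = ∅ ∧
        ProjInv w (mustClip w cap) C' Cw' θ'
          (projectLoop cap fuel N.actives.card C Cw θ N).2 := by
  induction fuel with
  | zero =>
    intro C Cw θ N hN
    have h0 : N.actives.card = 0 := by omega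
    rw [projectLoop_zero_fuel]
    refine ⟨by simp [h0], fun w _ _ h => ⟨C, Cw, θ, rfl, Finset.card_eq_zero.1 h0, h⟩⟩
  | succ fuel ih =>
    intro C Cw θ N hN
    rcases Nat.eq_zero_or_pos N.actives.card with h0 | hpos
    · rw [h0, Nat.cast_zero, projectLoop_zero]
      refine ⟨by simp, fun w _ _ h => ⟨C, Cw, θ, rfl, Finset.card_eq_zero.1 h0, h⟩⟩
    · obtain ⟨C', Cw', θ', N', hrun, hhalf, hwords, hinv⟩ := projectLoop_step cap fuel C Cw θ N hpos
      obtain ⟨h1, h2⟩ := ih C' Cw' θ' N' (by omega)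
      rw [hrun]
      refine ⟨?_, fun w hw hmono h => h2 w hw hmono (hinv w hw hmono h)⟩
      refine h1.trans ?_
      have hsz : Nat.size N'.actives.card + 1 ≤ Nat.size N.actives.card := by
        by_contra! hcon
        have h3 : N.actives.card < 2 ^ Nat.size N.actives.card := Nat.lt_size_self _
        have hs1 : Nat.size N.actives.card ≠ 0 := by
          intro h; rw [h, pow_zero] at h3; omega
        obtain ⟨r, hr⟩ := Nat.exists_eq_succ_of_ne_zero hs1
        rw [hr, Nat.succ_eq_add_one, pow_succ] at h3
        have h4 : Nat.size N'.actives.card ≤ r := Nat.size_le.2 (show N'.actives.card < 2 ^ r by omega)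
        omega
      have hsz' : (Nat.size N'.actives.card : ℝ) + 1 ≤ Nat.size N.actives.card := by
        exact_mod_cast hsz
      nlinarith [iterationWords_nonneg k s]

end Projection

/-! ### Clipping is the projection in relative entropy -/

section Projection

variable {k s : ℕ}

/-- Clearing denominators, each weight above `w a` contributes `1` and each other one `w b / w a`.
The resulting sum of minima is nonincreasing in `w a`, which gives the monotonicity that binary
search needs. -/
theorem mustClip_iff {w : Fin k × Fin s → ℝ} (hw : ∀ a, 0 < w a) (hsum : ∑ a, w a = 1) (cap : ℝ)
    (a : Fin k × Fin s) :
    mustClip w cap (w a) ↔ cap * ∑ b, min 1 (w b / w a) < 1 := by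
  classical
  have ha := hw a
  have hsplit := Finset.sum_filter_add_sum_filter_not Finset.univ (fun b => w a < w b) w
  have hR : 0 < ∑ b with ¬ w a < w b, w b :=
    Finset.sum_pos (fun b _ => hw b) ⟨a, Finset.mem_filter.2 ⟨Finset.mem_univ _, lt_irrefl _⟩⟩
  have hR' : 1 - ∑ b with w a < w b, w b = ∑ b with ¬ w a < w b, w b := by linarith
  have hmin : ∑ b, min 1 (w b / w a) = ((Finset.univ.filter fun b => w a < w b).card : ℝ) +
      (∑ b with ¬ w a < w b, w b) / w a := by
    rw [← Finset.sum_filter_add_sum_filter_not Finset.univ (fun b => w a < w b), Finset.sum_div]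
    congr 1
    · rw [Finset.sum_congr rfl (g := fun _ => (1 : ℝ))]
      · simp
      · intro b hb
        exact min_eq_left ((one_le_div ha).2 (Finset.mem_filter.1 hb).2.le)
    · refine Finset.sum_congr rfl fun b hb => ?_
      exact min_eq_right ((div_le_one ha).2 (not_lt.1 (Finset.mem_filter.1 hb).2))
  rw [mustClip, hR', hmin]
  set R := ∑ b with ¬ w a < w b, w b
  set c := ((Finset.univ.filter fun b => w a < w b).card : ℝ)
  rw [mul_div_assoc', lt_div_iff₀ hR]
  have : cap * (c + R / w a) = (cap * c * w a + cap * R) / w a := by field_simp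
  rw [this, div_lt_one ha]
  constructor <;> intro h <;> nlinarith

theorem mustClip_mono {w : Fin k × Fin s → ℝ} (hw : ∀ a, 0 < w a) (hsum : ∑ a, w a = 1) {cap : ℝ}
    (hcap : 0 < cap) (a b : Fin k × Fin s) (hab : w a ≤ w b) (h : mustClip w cap (w a)) :
    mustClip w cap (w b) := by
  rw [mustClip_iff hw hsum] at h ⊢
  refine lt_of_le_of_lt (mul_le_mul_of_nonneg_left (Finset.sum_le_sum fun c _ => ?_) hcap.le) h
  have := hw a; have := hw c
  exact min_le_min_left _ (by gcongr)

/-- Clipping the weights that must be clipped is the projection in relative entropy. -/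
theorem clip_spec {w : Fin k × Fin s → ℝ} (hw : ∀ a, 0 < w a) (hsum : ∑ a, w a = 1) {cap : ℝ}
    (hcap : 0 < cap) (hn : 1 ≤ (k * s : ℕ) * cap) (U : Finset (Fin k × Fin s))
    (hU : ∀ a, a ∈ U ↔ mustClip w cap (w a)) {m : ℝ}
    (hm : m = (1 - U.card * cap) / (1 - ∑ a ∈ U, w a)) (w' : Fin k × Fin s → ℝ)
    (hw' : ∀ a, w' a = if a ∈ U then cap else w a * m) :
    (∀ a, 0 < w' a) ∧ ∑ a, w' a = 1 ∧ (∀ a, w' a ≤ cap) ∧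
      ∀ Q : Fin k × Fin s → ℝ, (∀ a, Q a ≤ cap) → ∑ a, Q a = 1 →
        ∑ a, Q a * Real.log (w a) ≤ ∑ a, Q a * Real.log (w' a) := by
  classical
  have hmono := mustClip_mono hw hsum hcap
  have hne : (Finset.univ : Finset (Fin k × Fin s)).Nonempty := by
    by_contra h
    rw [Finset.not_nonempty_iff_eq_empty] at h
    rw [h] at hsum; simp at hsum
  -- The smallest weight is never clipped: all its minima equal `1`, and `n * cap ≥ 1`. So the
  -- rescaling factor has a positive denominator.
  have hUc : Uᶜ.Nonempty := by
    obtain ⟨a, _, hmin⟩ := Finset.exists_min_image _ w hne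
    refine ⟨a, Finset.mem_compl.2 fun ha => ?_⟩
    rw [hU, mustClip_iff hw hsum] at ha
    have : ∑ b, min 1 (w b / w a) = (k * s : ℕ) := by
      rw [Finset.sum_congr rfl (g := fun _ => (1 : ℝ))]
      · simp
      · intro b hb
        exact min_eq_left ((one_le_div (hw a)).2 (hmin b hb))
    rw [this] at ha
    linarith
  have hsplit := Finset.sum_add_sum_compl U w
  have hR : 0 < ∑ b ∈ Uᶜ, w b := Finset.sum_pos (fun b _ => hw b) hUc
  have hR' : 1 - ∑ b ∈ U, w b = ∑ b ∈ Uᶜ, w b := by linarith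
  rw [hR'] at hm
  set R := ∑ b ∈ Uᶜ, w b with hRdef
  -- the clipped weights are too large
  have hbig : 0 < m ∧ ∀ a ∈ U, cap ≤ w a * m := by
    rcases U.eq_empty_or_nonempty with he | hUne
    · have : R = 1 := by rw [hRdef, he]; simpa using hsum
      rw [hm, this, he]; simp
    · obtain ⟨a, ha, hmin⟩ := Finset.exists_min_image _ w hUne
      have h1 := (hU a).1 ha
      rw [mustClip_iff hw hsum] at h1
      have hpa := hw a
      have h2 : ∑ b, min 1 (w b / w a) = U.card + R / w a := by
        rw [← Finset.sum_add_sum_compl U, hRdef, Finset.sum_div]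
        congr 1
        · rw [Finset.sum_congr rfl (g := fun _ => (1 : ℝ))]
          · simp
          · intro b hb
            exact min_eq_left ((one_le_div hpa).2 (hmin b hb))
        · refine Finset.sum_congr rfl fun b hb => ?_
          refine min_eq_right ((div_le_one hpa).2 ?_)
          by_contra! hlt
          exact Finset.mem_compl.1 hb ((hU b).2 (hmono a b hlt.le ((hU a).1 ha)))
      rw [h2] at h1
      have h3 : cap * R / w a < 1 - U.card * cap := by
        have : cap * (U.card + R / w a) = cap * U.card + cap * R / w a := by ring
        linarith
      have h4 : cap < w a * m := by
        rw [hm, mul_div_assoc', lt_div_iff₀ hR]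
        rw [div_lt_iff₀ hpa] at h3
        linarith
      have hmpos : 0 < m := by
        by_contra! hneg
        have := mul_nonpos_of_nonneg_of_nonpos hpa.le hneg
        linarith
      refine ⟨hmpos, fun b hb => h4.le.trans ?_⟩
      have := hmin b hb
      gcongr
  obtain ⟨hmpos, hbig⟩ := hbig
  -- the others are not
  have hsmall : ∀ a ∉ U, w a * m ≤ cap := by
    obtain ⟨a, ha, hmax⟩ := Finset.exists_max_image _ w hUc
    have ha' := Finset.mem_compl.1 ha
    -- For the largest unclipped weight the examples above it are exactly `U`, so its failed test
    -- says that `m` keeps it below `cap`.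
    have hfil : (Finset.univ.filter fun b => w a < w b) = U := by
      ext b
      simp only [Finset.mem_filter, Finset.mem_univ, true_and]
      constructor
      · intro hlt
        by_contra hb
        linarith [hmax b (Finset.mem_compl.2 hb)]
      · intro hb
        by_contra! hle
        exact ha' ((hU a).2 (hmono b a hle ((hU b).1 hb)))
    have h1 : ¬ mustClip w cap (w a) := fun h => ha' ((hU a).2 h)
    rw [mustClip, hfil, hR', ← hm, not_lt] at h1
    intro b hb
    refine le_trans ?_ h1
    have := hmax b (Finset.mem_compl.2 hb)
    gcongr
  have hpos : ∀ a, 0 < w' a := by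
    intro a
    rw [hw']
    split_ifs
    · exact hcap
    · exact mul_pos (hw a) hmpos
  have hsum' : ∑ a, w' a = 1 := by
    rw [← Finset.sum_add_sum_compl U w', Finset.sum_congr rfl (g := fun _ => cap)
      fun a ha => by rw [hw', if_pos ha], Finset.sum_congr (s₁ := Uᶜ) rfl
      (g := fun a => w a * m) fun a ha => by rw [hw', if_neg (Finset.mem_compl.1 ha)],
      ← Finset.sum_mul, ← hRdef, hm, mul_div_cancel₀ _ hR.ne']
    simp
  refine ⟨hpos, hsum', fun a => ?_, fun Q hQ hQsum => ?_⟩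
  · rw [hw']
    split_ifs with h
    · exact le_rfl
    · exact hsmall a h
  set l : Fin k × Fin s → ℝ := fun a => Real.log (w' a) - Real.log (w a) with hl
  -- This sum is the relative entropy of `w'` from `w`, hence nonnegative.
  have h1 : 0 ≤ ∑ a, w' a * l a := by
    have : ∑ a, (w' a - w a) ≤ ∑ a, w' a * l a := by
      refine Finset.sum_le_sum fun a _ => ?_
      have h2 := Real.log_le_sub_one_of_pos (div_pos (hw a) (hpos a))
      rw [Real.log_div (hw a).ne' (hpos a).ne'] at h2
      have h3 := mul_le_mul_of_nonneg_left h2 (hpos a).le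
      have h4 : w' a * (w a / w' a - 1) = w a - w' a := by
        have := (hpos a).ne'
        field_simp
      simp only [hl]
      nlinarith
    rw [Finset.sum_sub_distrib, hsum, hsum'] at this
    linarith
  -- The optimality condition: off `U` the log-ratio `l` is the constant `log m`; on `U` it is at
  -- most that, and there `w'` sits at the cap, so `Q ≤ w'`.
  have h2 : 0 ≤ ∑ a, (Q a - w' a) * (l a - Real.log m) := by
    refine Finset.sum_nonneg fun a _ => ?_
    by_cases ha : a ∈ U
    · have e : w' a = cap := by rw [hw', if_pos ha]
      refine mul_nonneg_of_nonpos_of_nonpos ?_ ?_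
      · rw [e]; linarith [hQ a]
      · have := Real.log_le_log hcap (hbig a ha)
        rw [Real.log_mul (hw a).ne' hmpos.ne'] at this
        simp only [hl, e]; linarith
    · have e : w' a = w a * m := by rw [hw', if_neg ha]
      have : l a - Real.log m = 0 := by
        simp only [hl, e]
        rw [Real.log_mul (hw a).ne' hmpos.ne']; ring
      rw [this, mul_zero]
  have h3 : ∑ a, (Q a - w' a) * (l a - Real.log m) =
      ∑ a, Q a * l a - ∑ a, w' a * l a := by
    have : ∀ a, (Q a - w' a) * (l a - Real.log m) =
        Q a * l a - w' a * l a - (Q a * Real.log m - w' a * Real.log m) := fun a => by ring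
    simp only [this, Finset.sum_sub_distrib, ← Finset.sum_mul, hQsum, hsum']
    ring
  have h4 : ∑ a, Q a * l a = ∑ a, Q a * Real.log (w' a) - ∑ a, Q a * Real.log (w a) := by
    rw [← Finset.sum_sub_distrib]
    exact Finset.sum_congr rfl fun a _ => by simp only [hl]; ring
  linarith

/-- The network after the weights above `θ` are clipped and the others are rescaled. -/
noncomputable def Network.rescale (N : Network k s) (cap θ m : ℝ) : Network k s where
  node := fun i => { N.node i with weight := fun x =>
    if (θ < (N.node i).weight x) then cap else (N.node i).weight x * m }
  words := N.words + k * 2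

theorem project_apply (cap C Cw θ : ℝ) (N N₁ : Network k s)
    (h : projectLoop cap (k * s) ((k * s : ℕ) : ℝ) 0 0 0
      { N with node := fun i => { N.node i with active := Finset.univ } } = ((C, Cw, θ), N₁)) :
    project cap N = ((), N₁.rescale cap θ ((1 - C * cap) / (1 - Cw))) := by
  rw [project]
  simp only [Comm.bind_apply, localStep]
  rw [h]
  rfl

theorem project_spec [NeZero k] (cap : ℝ) (N : Network k s) :
    (((project cap N).2.words : ℝ) ≤
      N.words + iterationWords k s * Nat.size (k * s) + 2 * k) ∧
    ((∀ a, 0 < N.wt a) → ∑ a, N.wt a = 1 → 0 < cap → 1 ≤ (k * s : ℕ) * cap →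
      (∀ a, 0 < (project cap N).2.wt a) ∧ ∑ a, (project cap N).2.wt a = 1 ∧
      (∀ a, (project cap N).2.wt a ≤ cap) ∧
      ∀ Q : Fin k × Fin s → ℝ, (∀ a, Q a ≤ cap) → ∑ a, Q a = 1 →
        ∑ a, Q a * Real.log (N.wt a) ≤ ∑ a, Q a * Real.log ((project cap N).2.wt a)) := by
  classical
  set N₀ : Network k s := { N with node := fun i => { N.node i with active := Finset.univ } }
    with hN₀
  have hact : N₀.actives = Finset.univ := by
    ext a; simp [Network.actives, hN₀]
  have hcard : N₀.actives.card = k * s := by rw [hact]; simp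
  obtain ⟨h1, h2⟩ := projectLoop_spec cap (k * s) 0 0 0 N₀ hcard.le
  rw [hcard] at h1 h2
  set R := projectLoop cap (k * s) ((k * s : ℕ) : ℝ) 0 0 0 N₀ with hR
  have hrun := project_apply cap R.1.1 R.1.2.1 R.1.2.2 N R.2 rfl
  rw [hrun]
  constructor
  · have e₀ : (N₀.words : ℝ) = N.words := rfl
    simp only [Network.rescale]
    push_cast
    linarith
  · intro hw hsum hcap hn
    -- Initially all examples are active, so the statements about inactive ones are vacuous, as is
    -- the condition on an empty active set.
    obtain ⟨C, Cw, θ, e1, e2, inv⟩ := h2 N.wt hw (mustClip_mono hw hsum hcap)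
      ⟨rfl, by simp [hact], by simp [hact], fun a _ c hc => absurd (by simp [hact]) hc,
        fun a _ c hc => absurd (by simp [hact]) hc, fun hemp a => by
          rw [hact] at hemp
          have := Finset.mem_univ a
          rw [hemp] at this
          simp at this⟩
    rw [e1]
    set U := Finset.univ.filter fun a => θ < N.wt a with hUdef
    have hU : ∀ a, a ∈ U ↔ mustClip N.wt cap (N.wt a) := fun a => by
      rw [hUdef, Finset.mem_filter, inv.final e2 a]; simp
    have hC : C = U.card := by
      rw [inv.card, ← Finset.sum_filter, e2, Finset.sum_const, nsmul_eq_mul, mul_one]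
      congr 2; ext a; simp [hU]
    have hCw : Cw = ∑ a ∈ U, N.wt a := by
      rw [inv.sum, ← Finset.sum_filter, e2]
      refine Finset.sum_congr ?_ fun _ _ => rfl
      ext a; simp [hU]
    refine clip_spec hw hsum hcap hn U hU rfl _ fun a => ?_
    have hwa : (R.2.node a.1).weight a.2 = N.wt a := congrFun inv.wt a
    change (if θ < (R.2.node a.1).weight a.2 then cap else
      (R.2.node a.1).weight a.2 * ((1 - C * cap) / (1 - Cw))) = _
    rw [hwa, ← hC, ← hCw]
    refine if_congr ?_ rfl rfl
    simp [hUdef]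

end Projection

/-! ### A round of boosting and its potential gain -/

section Round

universe u
variable {X : Type u} {k s : ℕ}

/-- The network after the weights are updated with the hypothesis `h`. -/
noncomputable def updated (S : Fin k → Fin s → X × Bool) (d : ℕ) (γ : ℝ)
    (v : Fin k → Fin s → ℝ) (h : X → Bool) : Network k s where
  node := fun i => ⟨fun x => (if (h (S i x).1 = (S i x).2) then v i x * (1 - γ) else v i x) /
    ∑ i, ∑ x, (if (h (S i x).1 = (S i x).2) then v i x * (1 - γ) else v i x), ∅, ∅⟩
  words := 0 + k * 1 + k * 1 + k * d + k * 1 + k * 1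

/-- The outcome of a round in which the hypothesis `h` is chosen. -/
noncomputable def roundOf (S : Fin k → Fin s → X × Bool) (d m : ℕ) (γ cap : ℝ)
    (v : Fin k → Fin s → ℝ) (h : X → Bool) : Round X k s where
  hyp := h
  weight := fun i => ((project cap (updated S d γ v h)).2.node i).weight
  examples := m
  words := (project cap (updated S d γ v h)).2.words

variable [NeZero k]

/-- The draws influence the outcome only through the returned hypothesis, because the requests
always add up to `m`. All later analysis uses the deterministic `roundOf`. -/
theorem boostRound_eq [MeasurableSpace X] [NeZero s] (S : Fin k → Fin s → X × Bool) (A : Measure (X × Bool) → X → Bool)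
    (d m : ℕ) (γ cap : ℝ) (v : Fin k → Fin s → ℝ) :
    boostRound S A d m γ cap v =
      (piPMF fun _ : Fin m => weightedPMF fun i => ∑ x, v i x).bind fun I =>
        (piPMF fun l => weightedPMF (v (I l))).bind fun J =>
          PMF.pure (roundOf S d m γ cap v (A (empirical fun l => S (I l) (J l)))) := by
  have hm : ∀ I : Fin m → Fin k,
      ∑ i, (Finset.univ.filter fun l => I l = i).card = m := by
    intro I
    have := (Finset.card_eq_sum_card_fiberwise (f := I) (s := Finset.univ) (t := Finset.univ)
      fun _ _ => Finset.mem_univ _).symm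
    simpa using this
  have : ∀ (I : Fin m → Fin k) (h : X → Bool), roundOf S d m γ cap v h =
      { roundOf S d m γ cap v h with
        examples := ∑ i, (Finset.univ.filter fun l => I l = i).card } := by
    intro I h; rw [hm]; rfl
  rw [boostRound]
  refine congrArg (PMF.bind _) (funext fun I => ?_)
  refine congrArg (PMF.bind (piPMF fun l => weightedPMF (v (I l)))) (funext fun J => ?_)
  rw [this I]
  rfl

theorem roundOf_words_le (S : Fin k → Fin s → X × Bool) (d m : ℕ) (γ cap : ℝ)
    (v : Fin k → Fin s → ℝ) (h : X → Bool) :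
    ((roundOf S d m γ cap v h).words : ℝ) ≤
      k * d + 6 * k + iterationWords k s * Nat.size (k * s) := by
  have := (project_spec cap (updated S d γ v h)).1
  have e : ((updated S d γ v h).words : ℝ) = k * d + 4 * k := by
    simp only [updated]; push_cast; ring
  simp only [roundOf]
  linarith

/-- The error rate of `h` on the examples under the distribution proportional to `w`. -/
noncomputable def wErr (S : Fin k → Fin s → X × Bool) (w : Fin k → Fin s → ℝ) (h : X → Bool) : ℝ :=
  (∑ a : Fin k × Fin s, if h (S a.1 a.2).1 ≠ (S a.1 a.2).2 then w a.1 a.2 else 0) /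
    ∑ a : Fin k × Fin s, w a.1 a.2

/-- The number of examples where `h` errs. -/
noncomputable def errCount (S : Fin k → Fin s → X × Bool) (h : X → Bool) : ℕ :=
  (Finset.univ.filter fun a : Fin k × Fin s => h (S a.1 a.2).1 ≠ (S a.1 a.2).2).card

/-- The guarantee of a round: smooth distributions `Q` gain on the current weights. -/
theorem roundOf_spec [NeZero s] (S : Fin k → Fin s → X × Bool) (d m : ℕ) {γ cap : ℝ}
    (hγ1 : γ < 1) (hcap : 0 < cap) (hn : 1 ≤ (k * s : ℕ) * cap)
    {v : Fin k → Fin s → ℝ} (hv : ∀ i x, 0 < v i x) (h : X → Bool) :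
    (∀ i x, 0 < (roundOf S d m γ cap v h).weight i x) ∧
    ∑ a : Fin k × Fin s, (roundOf S d m γ cap v h).weight a.1 a.2 = 1 ∧
    (∀ i x, (roundOf S d m γ cap v h).weight i x ≤ cap) ∧
    ∀ Q : Fin k × Fin s → ℝ, (∀ a, Q a ≤ cap) → ∑ a, Q a = 1 →
      ∑ a, Q a * Real.log (v a.1 a.2) - Real.log (∑ a : Fin k × Fin s, v a.1 a.2) +
        Real.log (1 - γ) * (∑ a, if h (S a.1 a.2).1 = (S a.1 a.2).2 then Q a else 0) +
        γ * (1 - wErr S v h) ≤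
      ∑ a, Q a * Real.log ((roundOf S d m γ cap v h).weight a.1 a.2) := by
  set u : Fin k × Fin s → ℝ := fun a =>
    if (h (S a.1 a.2).1 = (S a.1 a.2).2) then v a.1 a.2 * (1 - γ) else v a.1 a.2 with hu
  have h1γ : 0 < 1 - γ := by linarith
  have hupos : ∀ a, 0 < u a := by
    intro a; simp only [hu]; split_ifs
    · exact mul_pos (hv _ _) h1γ
    · exact hv _ _
  set Z := ∑ a, u a with hZ
  have hZpos : 0 < Z := Finset.sum_pos (fun a _ => hupos a) ⟨(0, 0), Finset.mem_univ _⟩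
  have hwt : ∀ a, (updated S d γ v h).wt a = u a / Z := by
    intro a
    simp only [Network.wt, updated, hZ, hu]
    rw [Fintype.sum_prod_type]
  obtain ⟨h1, h2, h3, h4⟩ := (project_spec cap (updated S d γ v h)).2
    (fun a => by rw [hwt]; exact div_pos (hupos a) hZpos)
    (by simp only [hwt]; rw [← Finset.sum_div]; exact div_self hZpos.ne') hcap hn
  refine ⟨fun i x => h1 (i, x), h2, fun i x => h3 (i, x), fun Q hQ hQs => ?_⟩
  refine le_trans ?_ (h4 Q hQ hQs)
  set V := ∑ a : Fin k × Fin s, v a.1 a.2 with hV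
  have hVpos : 0 < V := Finset.sum_pos (fun a _ => hv _ _) ⟨(0, 0), Finset.mem_univ _⟩
  -- the normalizing factor
  have hZV : Z = V * (1 - γ * (1 - wErr S v h)) := by
    have e : ∀ a : Fin k × Fin s, u a = v a.1 a.2 - γ * (v a.1 a.2 -
        (if h (S a.1 a.2).1 ≠ (S a.1 a.2).2 then v a.1 a.2 else 0)) := by
      intro a
      by_cases hc : h (S a.1 a.2).1 = (S a.1 a.2).2
      · simp [hu, hc]; ring
      · simp [hu, hc]
    rw [hZ, Finset.sum_congr rfl fun a _ => e a, Finset.sum_sub_distrib, ← Finset.mul_sum,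
      Finset.sum_sub_distrib, wErr, ← hV]
    field_simp
  -- From `log (1 - t) ≤ -t`: normalization raises the potential by at least `γ` times the weighted
  -- accuracy.
  have hlogZ : Real.log Z ≤ Real.log V - γ * (1 - wErr S v h) := by
    have hfac : 0 < 1 - γ * (1 - wErr S v h) := by
      have := hZpos; rw [hZV] at this
      exact pos_of_mul_pos_right this hVpos.le
    rw [hZV, Real.log_mul hVpos.ne' hfac.ne']
    linarith [Real.log_le_sub_one_of_pos hfac]
  have e : ∑ a, Q a * Real.log ((updated S d γ v h).wt a) =
      ∑ a, Q a * Real.log (v a.1 a.2) +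
        Real.log (1 - γ) * (∑ a, if h (S a.1 a.2).1 = (S a.1 a.2).2 then Q a else 0) -
        Real.log Z := by
    have e1 : ∀ a, Q a * Real.log ((updated S d γ v h).wt a) = Q a * Real.log (v a.1 a.2) +
        Real.log (1 - γ) * (if h (S a.1 a.2).1 = (S a.1 a.2).2 then Q a else 0) -
        Q a * Real.log Z := by
      intro a
      rw [hwt, Real.log_div (hupos a).ne' hZpos.ne']
      by_cases hc : h (S a.1 a.2).1 = (S a.1 a.2).2
      · simp only [hu, hc, if_true]
        rw [Real.log_mul (hv _ _).ne' h1γ.ne']; ring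
      · simp only [hu, hc, if_false]; ring
    rw [Finset.sum_congr rfl fun a _ => e1 a, Finset.sum_sub_distrib, Finset.sum_add_distrib,
      ← Finset.mul_sum, ← Finset.sum_mul, hQs, one_mul]
  rw [e]
  linarith

end Round

/-! ### Regret and the majority vote -/

section Regret

universe u
variable {X : Type u} {k s : ℕ}

/-- A wrong majority has at least as many wrong votes as right ones. The inequality is not strict
because ties go to `true`. -/
theorem two_mul_countP_le_of_majority_ne (hs : List (X → Bool)) {x : X} {y : Bool}
    (h : majority hs x ≠ y) : 2 * hs.countP (fun h => decide (h x = y)) ≤ hs.length := by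
  have key : (hs.map fun h => if h x then (1 : ℤ) else -1).sum =
      2 * hs.countP (fun h => decide (h x = true)) - hs.length := by
    clear h
    induction hs with
    | nil => simp
    | cons h t ih =>
      rw [List.map_cons, List.sum_cons, ih, List.countP_cons, List.length_cons]
      by_cases hx : h x = true
      · simp [hx]; ring
      · simp [hx]; ring
  have hsum : hs.countP (fun h => decide (h x = true)) +
      hs.countP (fun h => decide (h x = false)) = hs.length := by
    clear h key
    induction hs with
    | nil => simp
    | cons h t ih =>
      rw [List.countP_cons, List.countP_cons, List.length_cons]
      by_cases hx : h x = true
      · simp [hx] at ih ⊢; omega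
      · simp [hx] at ih ⊢; omega
  rw [majority, key] at h
  cases y
  · simp only [ne_eq, Bool.not_eq_false, decide_eq_true_eq] at h
    omega
  · simp only [ne_eq, Bool.not_eq_true, decide_eq_false_iff_not, not_le] at h
    omega

variable [NeZero k]

/-- The lists of rounds that the algorithm can go through from the weights `v`, with hypotheses
from `H`. -/
def IsRun (S : Fin k → Fin s → X × Bool) (d m : ℕ) (γ cap : ℝ) (H : Set (X → Bool)) :
    (Fin k → Fin s → ℝ) → List (Round X k s) → Prop
  | _, [] => True
  | v, r :: ρ => (∃ h ∈ H, r = roundOf S d m γ cap v h) ∧ IsRun S d m γ cap H r.weight ρ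

/-- By how much the error rate of `h` exceeds that of `h'` by more than `β`. -/
noncomputable def excess (S : Fin k → Fin s → X × Bool) (h' : X → Bool) (β : ℝ)
    (v : Fin k → Fin s → ℝ) (h : X → Bool) : ℝ :=
  max 0 (wErr S v h - wErr S v h' - β)

/-- The sum of the excesses of the rounds. -/
noncomputable def excessSum (S : Fin k → Fin s → X × Bool) (h' : X → Bool) (β : ℝ) :
    (Fin k → Fin s → ℝ) → List (Round X k s) → ℝ
  | _, [] => 0
  | v, r :: ρ => excess S h' β v r.hyp + excessSum S h' β r.weight ρ

omit [NeZero k] in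
theorem excess_nonneg (S : Fin k → Fin s → X × Bool) (h' : X → Bool) (β : ℝ)
    (v : Fin k → Fin s → ℝ) (h : X → Bool) : 0 ≤ excess S h' β v h := le_max_left _ _

omit [NeZero k] in
theorem excessSum_nonneg (S : Fin k → Fin s → X × Bool) (h' : X → Bool) (β : ℝ)
    (ρ : List (Round X k s)) : ∀ v, 0 ≤ excessSum S h' β v ρ := by
  induction ρ with
  | nil => intro v; exact le_rfl
  | cons r ρ ih => intro v; exact add_nonneg (excess_nonneg _ _ _ _ _) (ih _)

/-- Smoothness turns a small error count into a small weighted error. This controls the reference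
hypothesis under every weighting that occurs, without knowledge of the weights. -/
theorem wErr_le [NeZero s] (S : Fin k → Fin s → X × Bool) {v : Fin k → Fin s → ℝ} {cap : ℝ}
    (hv : ∀ i x, 0 < v i x) (hvcap : ∀ i x, v i x ≤ cap * ∑ a : Fin k × Fin s, v a.1 a.2)
    (h : X → Bool) : wErr S v h ≤ cap * errCount S h := by
  have hVpos : 0 < ∑ a : Fin k × Fin s, v a.1 a.2 :=
    Finset.sum_pos (fun a _ => hv _ _) ⟨(0, 0), Finset.mem_univ _⟩
  rw [wErr, div_le_iff₀ hVpos, ← Finset.sum_filter, errCount]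
  refine (Finset.sum_le_sum fun a _ => hvcap a.1 a.2).trans (le_of_eq ?_)
  rw [Finset.sum_const, nsmul_eq_mul]
  ring

/-- The regret bound of multiplicative weights on smooth distributions. -/
theorem regret_le [NeZero s] (S : Fin k → Fin s → X × Bool) (d m : ℕ) {γ cap : ℝ} (hγ0 : 0 < γ)
    (hγ1 : γ < 1) (hcap : 0 < cap) (hn : 1 ≤ (k * s : ℕ) * cap) (H : Set (X → Bool))
    (h' : X → Bool) (β : ℝ) (Q : Fin k × Fin s → ℝ) (hQ0 : ∀ a, 0 ≤ Q a) (hQ : ∀ a, Q a ≤ cap)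
    (hQs : ∑ a, Q a = 1) (ρ : List (Round X k s)) :
    ∀ v : Fin k → Fin s → ℝ, (∀ i x, 0 < v i x) →
      (∀ i x, v i x ≤ cap * ∑ a : Fin k × Fin s, v a.1 a.2) → IsRun S d m γ cap H v ρ →
      ∑ a, Q a * Real.log (v a.1 a.2) - Real.log (∑ a : Fin k × Fin s, v a.1 a.2) +
        Real.log (1 - γ) * (∑ a : Fin k × Fin s, Q a *
          ((ρ.map Round.hyp).countP fun h => decide (h (S a.1 a.2).1 = (S a.1 a.2).2) : ℕ)) +
        γ * (ρ.length * (1 - cap * errCount S h' - β) - excessSum S h' β v ρ) ≤ Real.log cap := by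
  induction ρ with
  | nil =>
    intro v hv hvcap _
    have hVpos : 0 < ∑ a : Fin k × Fin s, v a.1 a.2 :=
      Finset.sum_pos (fun a _ => hv _ _) ⟨(0, 0), Finset.mem_univ _⟩
    have h1 : ∑ a, Q a * Real.log (v a.1 a.2) ≤
        ∑ a, Q a * Real.log (cap * ∑ a : Fin k × Fin s, v a.1 a.2) :=
      Finset.sum_le_sum fun a _ => mul_le_mul_of_nonneg_left
        (Real.log_le_log (hv _ _) (hvcap _ _)) (hQ0 a)
    rw [← Finset.sum_mul, hQs, one_mul, Real.log_mul hcap.ne' hVpos.ne'] at h1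
    simp [excessSum]
    linarith
  | cons r ρ ih =>
    intro v hv hvcap hrun
    obtain ⟨⟨h, _, rfl⟩, hrun⟩ := hrun
    obtain ⟨p1, p2, p3, p4⟩ := roundOf_spec S d m hγ1 hcap hn hv h
    have h1 := ih _ p1 (fun i x => by rw [p2, mul_one]; exact p3 i x) hrun
    have h2 := p4 Q hQ hQs
    rw [p2, Real.log_one, sub_zero] at h1
    -- The excess absorbs whatever the learner loses against `h'`; no assumption on the quality of
    -- `h` is made here.
    have h3 : wErr S v h - cap * errCount S h' - β ≤ excess S h' β v h := by
      have := le_max_right 0 (wErr S v h - wErr S v h' - β)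
      have := wErr_le S hv hvcap h'
      simp only [excess]
      linarith
    have h4 : ∑ a : Fin k × Fin s, Q a *
        ((((roundOf S d m γ cap v h) :: ρ).map Round.hyp).countP
          fun h => decide (h (S a.1 a.2).1 = (S a.1 a.2).2) : ℕ) =
        (∑ a : Fin k × Fin s, Q a *
          ((ρ.map Round.hyp).countP fun h => decide (h (S a.1 a.2).1 = (S a.1 a.2).2) : ℕ)) +
        ∑ a, if h (S a.1 a.2).1 = (S a.1 a.2).2 then Q a else 0 := by
      rw [← Finset.sum_add_distrib]
      refine Finset.sum_congr rfl fun a _ => ?_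
      rw [List.map_cons, List.countP_cons]
      have : (roundOf S d m γ cap v h).hyp = h := rfl
      rw [this]
      by_cases hc : h (S a.1 a.2).1 = (S a.1 a.2).2
      · simp [hc]; ring
      · simp [hc]
    rw [h4, List.length_cons, excessSum]
    have h5 := mul_le_mul_of_nonneg_left h3 hγ0.le
    have h6 : (roundOf S d m γ cap v h).hyp = h := rfl
    rw [h6]
    push_cast
    linarith

/-- If the excesses are small, the output is right on most examples. -/
theorem errCount_output_lt [NeZero s] (S : Fin k → Fin s → X × Bool) (d m : ℕ) {γ κ β : ℝ}
    (hγ0 : 0 < γ) (hγ1 : γ ≤ 1 / 4) (hβ : β = 1 / 2 - 2 * γ) (hκ0 : 0 < κ) (hκ1 : κ ≤ 1)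
    (H : Set (X → Bool)) (h' : X → Bool) (hh' : (errCount S h' : ℝ) ≤ κ * (k * s : ℕ) * γ)
    {ρ : List (Round X k s)}
    (hrun : IsRun S d m γ (1 / (κ * (k * s : ℕ))) H (fun _ _ => 1 / (s : ℝ)) ρ)
    (hex : excessSum S h' β (fun _ _ => 1 / (s : ℝ)) ρ ≤ ρ.length * γ / 12)
    (hT : Real.log (1 / κ) < ρ.length * γ ^ 2 / 4) :
    (errCount S (output ρ) : ℝ) < κ * (k * s : ℕ) := by
  classical
  by_contra! hcon
  have hk : (0 : ℝ) < k := by exact_mod_cast Nat.pos_of_ne_zero (NeZero.ne k)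
  have hs : (0 : ℝ) < s := by exact_mod_cast Nat.pos_of_ne_zero (NeZero.ne s)
  have hnpos : (0 : ℝ) < (k * s : ℕ) := by push_cast; positivity
  set n : ℝ := ((k * s : ℕ) : ℝ) with hn
  have hns : n = k * s := by rw [hn]; push_cast; rfl
  set B := Finset.univ.filter fun a : Fin k × Fin s =>
    output ρ (S a.1 a.2).1 ≠ (S a.1 a.2).2 with hB
  have hBcard : κ * n ≤ (B.card : ℝ) := hcon
  have hκn : 0 < κ * n := by positivity
  have hBpos : (0 : ℝ) < B.card := hκn.trans_le hBcard
  set cap : ℝ := 1 / (κ * n) with hcapdef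
  have hcap : 0 < cap := by positivity
  have hcapn : n * cap = 1 / κ := by rw [hcapdef]; field_simp
  have hone : 1 ≤ 1 / κ := by rw [le_div_iff₀ hκ0]; linarith
  -- The comparison distribution is uniform on the misclassified examples; it respects the cap
  -- precisely because there are at least `κ n` of them.
  set Q : Fin k × Fin s → ℝ := fun a => if a ∈ B then 1 / (B.card : ℝ) else 0 with hQdef
  have hV : ∑ _a : Fin k × Fin s, 1 / (s : ℝ) = k := by
    simp; field_simp
  have hQs : ∑ a, Q a = 1 := by
    simp only [hQdef]
    rw [← Finset.sum_filter, Finset.filter_mem_eq_inter, Finset.univ_inter, Finset.sum_const,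
      nsmul_eq_mul]
    field_simp
  have hreg := regret_le S d m hγ0 (by linarith) hcap (by rw [hcapn]; exact hone) H h' β Q
    (fun a => by simp only [hQdef]; split_ifs <;> positivity)
    (fun a => by
      simp only [hQdef]; split_ifs
      · rw [hcapdef]; gcongr
      · exact hcap.le) hQs ρ (fun _ _ => 1 / (s : ℝ)) (fun _ _ => by positivity)
    (fun _ _ => by
      rw [hV]
      have : (1 : ℝ) / s = k * (1 / n) := by rw [hns]; field_simp
      rw [this, mul_comm cap]
      gcongr
      rw [hcapdef]
      gcongr
      nlinarith) hrun
  rw [hV, ← Finset.sum_mul, hQs, one_mul] at hreg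
  have hcorrect : ∑ a : Fin k × Fin s, Q a *
      ((ρ.map Round.hyp).countP fun h => decide (h (S a.1 a.2).1 = (S a.1 a.2).2) : ℕ) ≤
      ρ.length / 2 := by
    calc _ ≤ ∑ a : Fin k × Fin s, Q a * ((ρ.length : ℝ) / 2) := by
          refine Finset.sum_le_sum fun a _ => ?_
          simp only [hQdef]
          split_ifs with ha
          · gcongr
            have := two_mul_countP_le_of_majority_ne (ρ.map Round.hyp)
              (Finset.mem_filter.1 ha).2
            rw [List.length_map] at this
            rw [le_div_iff₀ (by norm_num), mul_comm]
            exact_mod_cast this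
          · simp
      _ = ρ.length / 2 := by rw [← Finset.sum_mul, hQs, one_mul]
  have h1γ : 0 < 1 - γ := by linarith
  -- The coefficient `4/3` is valid for `γ ≤ 1/4`.
  have hlogγ : -γ - 4 / 3 * γ ^ 2 ≤ Real.log (1 - γ) := by
    refine le_trans ?_ (Real.one_sub_inv_le_log_of_pos h1γ)
    have : (1 - γ)⁻¹ ≤ 1 + γ + 4 / 3 * γ ^ 2 := by
      rw [inv_le_iff_one_le_mul₀ h1γ]
      nlinarith [sq_nonneg γ, mul_nonneg (sq_nonneg γ) (by linarith : 0 ≤ 1 / 4 - γ)]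
    linarith
  have hlogneg : Real.log (1 - γ) ≤ 0 := Real.log_nonpos h1γ.le (by linarith)
  set T : ℝ := (ρ.length : ℝ) with hTdef
  have hT0 : 0 ≤ T := by positivity
  have h1 : (-γ - 4 / 3 * γ ^ 2) * (T / 2) ≤ Real.log (1 - γ) *
      ∑ a : Fin k × Fin s, Q a *
      ((ρ.map Round.hyp).countP fun h => decide (h (S a.1 a.2).1 = (S a.1 a.2).2) : ℕ) :=
    (mul_le_mul_of_nonneg_right hlogγ (by positivity)).trans
      (mul_le_mul_of_nonpos_left hcorrect hlogneg)
  have hE : cap * errCount S h' ≤ γ := by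
    rw [hcapdef, one_div, inv_mul_le_iff₀ hκn]; exact hh'
  have h2 : γ * (T * (1 / 2 + γ) - T * γ / 12) ≤
      γ * (T * (1 - cap * errCount S h' - β) - excessSum S h' β (fun _ _ => 1 / (s : ℝ)) ρ) := by
    have : T * (1 / 2 + γ) ≤ T * (1 - cap * errCount S h' - β) := by
      gcongr; linarith
    gcongr
  have hlogs : Real.log (1 / (s : ℝ)) - Real.log k = -Real.log n := by
    rw [hns, Real.log_mul hk.ne' hs.ne', one_div, Real.log_inv]; ring
  have hlogcap : Real.log cap = Real.log (1 / κ) - Real.log n := by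
    rw [hcapdef, one_div, one_div, Real.log_inv, Real.log_inv, Real.log_mul hκ0.ne' hnpos.ne']
    ring
  -- After `log n` cancels, the gain is `T γ² (1 - 1/12 - 2/3) = T γ² / 4`, which exceeds `log
  -- (1/κ)` by `hT`.
  rw [hlogcap] at hreg
  linarith

end Regret

/-! ### Errors as averages of losses -/

section UniformDeviation

universe u
variable {X : Type u}

/-- The indicator of the error of `h` on a labelled example. -/
def lossAt (h : X → Bool) (q : X × Bool) : ℝ := if h q.1 ≠ q.2 then 1 else 0

theorem lossAt_nonneg (h : X → Bool) (q : X × Bool) : 0 ≤ lossAt h q := by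
  unfold lossAt; split_ifs <;> norm_num

theorem lossAt_le_one (h : X → Bool) (q : X × Bool) : lossAt h q ≤ 1 := by
  unfold lossAt; split_ifs <;> norm_num

/-- A class with at most `G` patterns on any points has at most `G` patterns of differences of
errors. -/
theorem exists_diff_patterns {ι Z : Type*} {K : Set (X → Bool)} {G : ℝ}
    (hG : ∀ p : ι ⊕ ι → X, ∃ V : Finset (ι ⊕ ι → Bool),
      (∀ h ∈ K, (fun i => h (p i)) ∈ V) ∧ (V.card : ℝ) ≤ G)
    (z : Z → X × Bool) (y : ι → Z × Z) :
    ∃ V : Finset (ι → ℝ), (∀ h ∈ K, (fun j => lossAt h (z (y j).2) - lossAt h (z (y j).1)) ∈ V) ∧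
      (V.card : ℝ) ≤ G := by
  classical
  obtain ⟨V, hV, hVG⟩ := hG (Sum.elim (fun j => (z (y j).1).1) fun j => (z (y j).2).1)
  refine ⟨V.image fun p j => (if p (Sum.inr j) ≠ (z (y j).2).2 then (1 : ℝ) else 0) -
    (if p (Sum.inl j) ≠ (z (y j).1).2 then (1 : ℝ) else 0), fun h hh => ?_, ?_⟩
  · exact Finset.mem_image.2 ⟨_, hV h hh, rfl⟩
  · exact le_trans (by exact_mod_cast Finset.card_image_le) hVG

theorem measurable_lossAt [MeasurableSpace X] {h : X → Bool} (hh : Measurable h) :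
    Measurable (lossAt h) := by
  refine Measurable.ite ?_ measurable_const measurable_const
  exact (measurableSet_eq_fun (hh.comp measurable_fst) measurable_snd).compl

theorem measurableSet_err [MeasurableSpace X] {h : X → Bool} (hh : Measurable h) :
    MeasurableSet {z : X × Bool | h z.1 ≠ z.2} :=
  (measurableSet_eq_fun (hh.comp measurable_fst) measurable_snd).compl

theorem integral_lossAt [MeasurableSpace X] {h : X → Bool} (hh : Measurable h)
    (D : Measure (X × Bool)) : ∫ q, lossAt h q ∂D = err D h := by
  have : lossAt h = Set.indicator {z : X × Bool | h z.1 ≠ z.2} 1 := by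
    funext q; simp [lossAt, Set.indicator]
  rw [this, integral_indicator_one (measurableSet_err hh)]
  rfl

theorem err_empirical [MeasurableSpace X] {h : X → Bool} (hh : Measurable h) {m : ℕ}
    (z : Fin m → X × Bool) : err (empirical z) h = (∑ l, lossAt h (z l)) / m := by
  classical
  rw [err, empirical, Measure.real, Measure.smul_apply, Measure.finsetSum_apply]
  simp only [Measure.dirac_apply' _ (measurableSet_err hh), smul_eq_mul]
  rw [ENNReal.toReal_mul, ENNReal.toReal_sum]
  · rw [ENNReal.toReal_inv, ENNReal.toReal_natCast, div_eq_inv_mul]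
    congr 1
    refine Finset.sum_congr rfl fun l _ => ?_
    simp only [lossAt, Set.indicator]
    by_cases hc : h (z l).1 = (z l).2 <;> simp [hc]
  · intro l _
    simp only [Set.indicator]
    split_ifs <;> simp

theorem isProbabilityMeasure_empirical [MeasurableSpace X] {m : ℕ} (hm : 0 < m)
    (z : Fin m → X × Bool) : IsProbabilityMeasure (empirical z) := by
  constructor
  rw [empirical, Measure.smul_apply, Measure.finsetSum_apply]
  simp only [measure_univ, Finset.sum_const, Finset.card_univ, Fintype.card_fin, nsmul_eq_mul,
    mul_one, smul_eq_mul]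
  exact ENNReal.inv_mul_cancel (by exact_mod_cast hm.ne') (ENNReal.natCast_ne_top m)

theorem optErr_le [MeasurableSpace X] (D : Measure (X × Bool)) {H : Set (X → Bool)} {h : X → Bool}
    (hh : h ∈ H) : optErr D H ≤ err D h :=
  ciInf_le (f := fun h : H => err D h) ⟨0, by rintro _ ⟨h, rfl⟩; exact measureReal_nonneg⟩ ⟨h, hh⟩

end UniformDeviation

/-! ### Expectations over discrete random choices -/

section Expectation

/-- The expectation of a nonnegative function of a random choice. -/
noncomputable def expect {α : Type*} (p : PMF α) (F : α → ℝ≥0∞) : ℝ≥0∞ := ∑' a, p a * F a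

variable {α β : Type*}

theorem expect_bind (p : PMF α) (f : α → PMF β) (F : β → ℝ≥0∞) :
    expect (p.bind f) F = expect p fun a => expect (f a) F := by
  simp only [expect, PMF.bind_apply, ← ENNReal.tsum_mul_right, ← ENNReal.tsum_mul_left]
  rw [ENNReal.tsum_comm]
  simp only [mul_assoc]

theorem expect_pure (a : α) (F : α → ℝ≥0∞) : expect (PMF.pure a) F = F a := by
  classical
  rw [expect, tsum_eq_single a]
  · simp
  · intro b hb; simp [hb]

theorem expect_map (p : PMF α) (f : α → β) (F : β → ℝ≥0∞) :
    expect (p.map f) F = expect p (F ∘ f) := by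
  rw [PMF.map, expect_bind]
  simp only [Function.comp_apply, expect_pure]
  rfl

theorem expect_mono (p : PMF α) {F G : α → ℝ≥0∞} (h : ∀ a ∈ p.support, F a ≤ G a) :
    expect p F ≤ expect p G := by
  refine ENNReal.tsum_le_tsum fun a => ?_
  by_cases ha : a ∈ p.support
  · exact mul_le_mul_right (h a ha) _
  · rw [PMF.mem_support_iff, not_not] at ha
    simp [ha]

theorem expect_add (p : PMF α) (F G : α → ℝ≥0∞) :
    expect p (fun a => F a + G a) = expect p F + expect p G := by
  simp only [expect, mul_add, ENNReal.tsum_add]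

theorem expect_const (p : PMF α) (c : ℝ≥0∞) : expect p (fun _ => c) = c := by
  rw [expect, ENNReal.tsum_mul_right, PMF.tsum_coe, one_mul]

/-- Markov's inequality. -/
theorem ofReal_one_sub_le_of_expect_le (p : PMF α) {F : α → ℝ} {c δ : ℝ} (hc : 0 < c)
    (hδ : 0 ≤ δ) (h : expect p (fun a => ENNReal.ofReal (F a)) ≤ ENNReal.ofReal (δ * c))
    (s : Set α) (hs : ∀ a ∈ p.support, F a ≤ c → a ∈ s) :
    ENNReal.ofReal (1 - δ) ≤ p.toOuterMeasure s := by
  have h1 : (1 : ℝ≥0∞) ≤ p.toOuterMeasure s + ENNReal.ofReal δ := by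
    have h2 : (∑' a, p a) * ENNReal.ofReal c ≤
        p.toOuterMeasure s * ENNReal.ofReal c + ENNReal.ofReal δ * ENNReal.ofReal c := by
      rw [← ENNReal.ofReal_mul hδ]
      refine le_trans ?_ (add_le_add_right h _)
      rw [PMF.toOuterMeasure_apply, ← ENNReal.tsum_mul_right, ← ENNReal.tsum_mul_right, expect,
        ← ENNReal.tsum_add]
      refine ENNReal.tsum_le_tsum fun a => ?_
      -- Termwise: a point of the support lies in `s` or has `F a > c`, and one of the two summands
      -- pays for it.
      by_cases ha : a ∈ p.support
      · by_cases hF : F a ≤ c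
        · rw [Set.indicator_of_mem (hs a ha hF)]
          exact le_self_add
        · refine le_trans ?_ le_add_self
          exact mul_le_mul_right (ENNReal.ofReal_le_ofReal (not_le.1 hF).le) _
      · rw [PMF.mem_support_iff, not_not] at ha
        simp [ha]
    rw [PMF.tsum_coe, ← add_mul] at h2
    have hc0 : ENNReal.ofReal c ≠ 0 := (ENNReal.ofReal_pos.2 hc).ne'
    exact (ENNReal.mul_le_mul_iff_left hc0 ENNReal.ofReal_ne_top).1 h2
  rw [ENNReal.ofReal_sub _ hδ, ENNReal.ofReal_one]
  exact tsub_le_iff_right.2 h1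

theorem weightedPMF_apply {α : Type} [Fintype α] [Nonempty α] {w : α → ℝ} (hw : ∀ a, 0 < w a)
    (a : α) : weightedPMF w a = ENNReal.ofReal (w a / ∑ b, w b) := by
  have hpos : 0 < ∑ b, w b := Finset.sum_pos (fun b _ => hw b) Finset.univ_nonempty
  have hsum : ∑ b, ENNReal.ofReal (w b) = ENNReal.ofReal (∑ b, w b) :=
    (ENNReal.ofReal_sum_of_nonneg fun b _ => (hw b).le).symm
  have hne : ∑ b, ENNReal.ofReal (w b) ≠ 0 := by
    rw [hsum]; exact (ENNReal.ofReal_pos.2 hpos).ne'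
  rw [weightedPMF, dif_pos hne, PMF.normalize_apply, tsum_fintype, hsum,
    ENNReal.ofReal_div_of_pos hpos, div_eq_mul_inv]

theorem piPMF_apply {m : ℕ} {α : Type} [Fintype α] (p : Fin m → PMF α) (a : Fin m → α) :
    piPMF p a = ∏ l, p l (a l) := rfl

end Expectation

/-! ### The excess of the sampled weak learner -/

section Expectation

universe u
variable {X : Type u} [MeasurableSpace X] {k s : ℕ} [NeZero k] [NeZero s]

/-- The law of one example drawn proportionally to the weights `v`. -/
noncomputable def drawLaw (v : Fin k → Fin s → ℝ) : Measure (Fin k × Fin s) :=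
  ∑ a, ENNReal.ofReal (v a.1 a.2 / ∑ b : Fin k × Fin s, v b.1 b.2) • Measure.dirac a

omit [NeZero k] [NeZero s] in
theorem drawLaw_singleton (v : Fin k → Fin s → ℝ) (a : Fin k × Fin s) :
    drawLaw v {a} = ENNReal.ofReal (v a.1 a.2 / ∑ b : Fin k × Fin s, v b.1 b.2) := by
  classical
  rw [drawLaw, Measure.finsetSum_apply, Finset.sum_eq_single a]
  · simp
  · intro b _ hb; simp [hb]
  · simp

theorem isProbabilityMeasure_drawLaw {v : Fin k → Fin s → ℝ} (hv : ∀ i x, 0 < v i x) :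
    IsProbabilityMeasure (drawLaw v) := by
  have hV : 0 < ∑ b : Fin k × Fin s, v b.1 b.2 :=
    Finset.sum_pos (fun a _ => hv _ _) ⟨(0, 0), Finset.mem_univ _⟩
  constructor
  rw [drawLaw, Measure.finsetSum_apply]
  simp only [Measure.smul_apply, measure_univ, smul_eq_mul, mul_one]
  rw [← ENNReal.ofReal_sum_of_nonneg fun a _ => (div_pos (hv _ _) hV).le, ← Finset.sum_div,
    div_self hV.ne', ENNReal.ofReal_one]

omit [MeasurableSpace X] in
theorem integral_drawLaw {v : Fin k → Fin s → ℝ} (hv : ∀ i x, 0 < v i x)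
    (S : Fin k → Fin s → X × Bool) (h : X → Bool) :
    ∫ a, lossAt h (S a.1 a.2) ∂drawLaw v = wErr S v h := by
  have := isProbabilityMeasure_drawLaw hv
  have hV : 0 < ∑ b : Fin k × Fin s, v b.1 b.2 :=
    Finset.sum_pos (fun a _ => hv _ _) ⟨(0, 0), Finset.mem_univ _⟩
  rw [integral_fintype Integrable.of_finite, wErr, Finset.sum_div]
  refine Finset.sum_congr rfl fun a _ => ?_
  rw [Measure.real, drawLaw_singleton, ENNReal.toReal_ofReal (div_pos (hv _ _) hV).le, lossAt]
  split_ifs <;> simp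

/-- A request falls on example `(i, x)` with probability `(Vᵢ / V) * (vᵢₓ / Vᵢ) = vᵢₓ / V`, where
`Vᵢ` and `V` are the local and total sums. So the two-stage draw is a product law, to which
symmetrization applies. -/
theorem expect_draws {m : ℕ} {v : Fin k → Fin s → ℝ} (hv : ∀ i x, 0 < v i x)
    (F : (Fin m → Fin k × Fin s) → ℝ≥0∞) :
    expect (piPMF fun _ : Fin m => weightedPMF fun i => ∑ x, v i x) (fun I =>
      expect (piPMF fun l => weightedPMF (v (I l))) fun J => F fun l => (I l, J l)) =
    ∫⁻ z, F z ∂Measure.pi fun _ : Fin m => drawLaw v := by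
  have := isProbabilityMeasure_drawLaw hv
  rw [lintegral_fintype, ← (Equiv.arrowProdEquivProdArrow (Fin m) (fun _ => Fin k)
    (fun _ => Fin s)).symm.sum_comp, Fintype.sum_prod_type, expect, tsum_fintype]
  refine Finset.sum_congr rfl fun I _ => ?_
  rw [expect, tsum_fintype, Finset.mul_sum]
  refine Finset.sum_congr rfl fun J _ => ?_
  rw [Measure.pi_singleton, piPMF_apply, piPMF_apply, ← mul_assoc, ← Finset.prod_mul_distrib,
    mul_comm]
  congr 1
  refine Finset.prod_congr rfl fun l _ => ?_
  have hpos : ∀ i, 0 < ∑ x, v i x := fun i => Finset.sum_pos (fun x _ => hv i x)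
    Finset.univ_nonempty
  rw [drawLaw_singleton, weightedPMF_apply hpos, weightedPMF_apply (hv _), Fintype.sum_prod_type]
  have hV : 0 < ∑ i, ∑ x, v i x := Finset.sum_pos (fun i _ => hpos i) Finset.univ_nonempty
  rw [← ENNReal.ofReal_mul (div_pos (hpos _) hV).le]
  congr 1
  have := (hpos (I l)).ne'
  simp only [Equiv.arrowProdEquivProdArrow, Equiv.coe_fn_symm_mk]
  field_simp

/-- The expected excess of the hypothesis of a round. -/
theorem expect_excess_le (S : Fin k → Fin s → X × Bool) {H : Set (X → Bool)}
    {A : Measure (X × Bool) → X → Bool} {β : ℝ} (hA : IsWeakAgnosticLearner H β A)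
    {d m : ℕ} (hd : vcDim H ≤ d) (hmeas : ∀ h ∈ H, Measurable h) (hm : 0 < m) {h' : X → Bool}
    (hh' : h' ∈ H) {η x : ℝ} (hη : 0 < η) (hx0 : 0 < x) (hx1 : x ≤ 1)
    (hlog : Real.log (2 * ((x⁻¹) ^ d * Real.exp (x * (m + m : ℕ)))) ≤ m * η ^ 2 / 2)
    (d' : ℕ) (γ cap : ℝ) {v : Fin k → Fin s → ℝ} (hv : ∀ i x, 0 < v i x) :
    expect (boostRound S A d' m γ cap v) (fun r => ENNReal.ofReal (excess S h' β v r.hyp)) ≤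
      ENNReal.ofReal (2 * η) := by
  classical
  have := isProbabilityMeasure_drawLaw hv
  have hm' : (0 : ℝ) < m := by exact_mod_cast hm
  -- Only losses on the stored examples matter, so the class may be replaced by its finite set of
  -- loss vectors and measurability is automatic.
  let Θ := {p : Fin k × Fin s → ℝ // ∃ h ∈ H, p = fun a => lossAt h (S a.1 a.2)}
  have hfin : Finite Θ := by
    have hsub : {p : Fin k × Fin s → ℝ | ∃ h ∈ H, p = fun a => lossAt h (S a.1 a.2)} ⊆
        Set.range fun (b : Fin k × Fin s → Bool) a => if b a then (1 : ℝ) else 0 := by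
      rintro p ⟨h, _, rfl⟩
      refine ⟨fun a => decide (h (S a.1 a.2).1 ≠ (S a.1 a.2).2), funext fun a => ?_⟩
      simp [lossAt]
    exact ((Set.finite_range _).subset hsub).to_subtype
  have hne : Nonempty Θ := ⟨⟨_, h', hh', rfl⟩⟩
  set f : Θ → Fin k × Fin s → ℝ := fun θ => θ.1 with hf
  have hf0 : ∀ θ a, 0 ≤ f θ a := by
    rintro ⟨_, h, hh, rfl⟩ a; exact lossAt_nonneg _ _
  have hf1 : ∀ θ a, f θ a ≤ 1 := by
    rintro ⟨_, h, hh, rfl⟩ a; exact lossAt_le_one _ _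
  set π := Measure.pi fun _ : Fin m => drawLaw v with hπ
  set mean : Θ → Fin m → ℝ := fun θ _ => ∫ a, f θ a ∂drawLaw v with hmean
  have hdev : ∫ z, maxDev f mean z ∂π ≤ m * η := by
    have := integral_maxDev_le (ι := Fin m) (f := f) (fun θ => measurable_of_finite _) hf0 hf1
      (fun _ => drawLaw v) (G := (x⁻¹) ^ d * Real.exp (x * (m + m : ℕ))) hη ?_
      (by rw [Fintype.card_fin]; exact hlog)
    · rwa [Fintype.card_fin] at this
    intro y
    obtain ⟨V, hV, hVG⟩ := exists_diff_patterns (ι := Fin m) (K := H)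
      (G := (x⁻¹) ^ d * Real.exp (x * (m + m : ℕ)))
      (fun p => by
        obtain ⟨V, h1, h2⟩ := exists_patterns hd p hx0 hx1
        refine ⟨V, h1, h2.trans (le_of_eq ?_)⟩
        simp) (fun a : Fin k × Fin s => S a.1 a.2) y
    refine ⟨V, ?_, hVG⟩
    rintro ⟨_, h, hh, rfl⟩
    exact hV h hh
  have hm0 : ∀ θ j, 0 ≤ mean θ j := fun θ _ => integral_nonneg fun a => hf0 θ a
  have hm1 : ∀ θ j, mean θ j ≤ 1 := fun θ _ =>
    (integral_mono Integrable.of_finite (integrable_const 1) fun a => hf1 θ a).trans (by simp)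
  -- the excess is at most twice the deviation
  have hdevle : ∀ z : Fin m → Fin k × Fin s, ∀ h ∈ H,
      |wErr S v h - (∑ l, lossAt h (S (z l).1 (z l).2)) / m| ≤ maxDev f mean z / m := by
    intro z h hh
    have h1 := le_ciSup (bddAbove_maxDev hf0 hf1 hm0 hm1 z) (⟨_, h, hh, rfl⟩ : Θ)
    simp only [hmean, hf, integral_drawLaw hv S h] at h1
    rw [Finset.sum_sub_distrib, Finset.sum_const, Finset.card_univ, Fintype.card_fin,
      nsmul_eq_mul] at h1
    rw [le_div_iff₀ hm', ← abs_of_pos hm', ← abs_mul, abs_of_pos hm']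
    refine le_trans (le_of_eq ?_) h1
    congr 1
    field_simp
  have hpt : ∀ z : Fin m → Fin k × Fin s,
      excess S h' β v (A (empirical fun l => S (z l).1 (z l).2)) ≤ 2 * (maxDev f mean z / m) := by
    intro z
    obtain ⟨hmem, hle⟩ := hA _ (isProbabilityMeasure_empirical hm fun l => S (z l).1 (z l).2)
    set h := A (empirical fun l => S (z l).1 (z l).2)
    have h1 := hle.trans (add_le_add_left (optErr_le _ hh') _)
    rw [err_empirical (hmeas _ hmem), err_empirical (hmeas _ hh')] at h1
    have h2 := abs_le.1 (hdevle z h hmem)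
    have h3 := abs_le.1 (hdevle z h' hh')
    refine max_le ?_ (by linarith [h2.2, h3.1])
    have := abs_nonneg (wErr S v h - (∑ l, lossAt h (S (z l).1 (z l).2)) / m)
    linarith [hdevle z h hmem]
  have hrun : expect (boostRound S A d' m γ cap v)
      (fun r => ENNReal.ofReal (excess S h' β v r.hyp)) =
      ∫⁻ z, ENNReal.ofReal (excess S h' β v (A (empirical fun l => S (z l).1 (z l).2))) ∂π := by
    rw [boostRound_eq, hπ, ← expect_draws hv, expect_bind]
    congr 1
    funext I
    rw [expect_bind]
    congr 1
    funext J
    rw [expect_pure]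
    rfl
  rw [hrun]
  calc _ ≤ ∫⁻ z, ENNReal.ofReal (2 * (maxDev f mean z / m)) ∂π :=
        lintegral_mono fun z => ENNReal.ofReal_le_ofReal (hpt z)
    _ = ENNReal.ofReal (∫ z, 2 * (maxDev f mean z / m) ∂π) := by
        rw [ofReal_integral_eq_lintegral_ofReal Integrable.of_finite]
        refine Eventually.of_forall fun z => ?_
        have : 0 ≤ maxDev f mean z := Real.iSup_nonneg fun _ => abs_nonneg _
        simp only [Pi.zero_apply]
        positivity
    _ ≤ ENNReal.ofReal (2 * η) := by
        refine ENNReal.ofReal_le_ofReal ?_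
        rw [integral_const_mul, integral_div]
        gcongr
        rw [div_le_iff₀ hm']
        linarith

theorem boostRound_support (S : Fin k → Fin s → X × Bool) {A : Measure (X × Bool) → X → Bool}
    {H : Set (X → Bool)} {m : ℕ} (hA : ∀ z : Fin m → X × Bool, A (empirical z) ∈ H) (d : ℕ)
    (γ cap : ℝ) (v : Fin k → Fin s → ℝ) :
    ∀ r ∈ (boostRound S A d m γ cap v).support, ∃ h ∈ H, r = roundOf S d m γ cap v h := by
  intro r hr
  rw [boostRound_eq, PMF.mem_support_bind_iff] at hr
  obtain ⟨I, _, hr⟩ := hr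
  rw [PMF.mem_support_bind_iff] at hr
  obtain ⟨J, _, hr⟩ := hr
  rw [PMF.mem_support_pure_iff] at hr
  exact ⟨_, hA _, hr⟩

theorem boostFrom_support (S : Fin k → Fin s → X × Bool) {A : Measure (X × Bool) → X → Bool}
    {H : Set (X → Bool)} {m : ℕ} (hA : ∀ z : Fin m → X × Bool, A (empirical z) ∈ H) (d : ℕ)
    (γ cap : ℝ) (T : ℕ) : ∀ (v : Fin k → Fin s → ℝ),
    ∀ ρ ∈ (boostFrom S A d m γ cap T v).support, ρ.length = T ∧ IsRun S d m γ cap H v ρ := by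
  induction T with
  | zero =>
    intro v ρ hρ
    rw [boostFrom, PMF.mem_support_pure_iff] at hρ
    subst hρ
    exact ⟨rfl, trivial⟩
  | succ T ih =>
    intro v ρ hρ
    rw [boostFrom, PMF.mem_support_bind_iff] at hρ
    obtain ⟨r, hr, hρ⟩ := hρ
    rw [PMF.mem_support_map_iff] at hρ
    obtain ⟨ρ', hρ', rfl⟩ := hρ
    obtain ⟨h1, h2⟩ := ih _ _ hρ'
    exact ⟨by rw [List.length_cons, h1], boostRound_support S hA d γ cap v r hr, h2⟩

/-- The bound for a round holds for all positive weights, hence conditionally on the past. Linearity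
of expectation then suffices: neither independence of the rounds nor a union bound is used. -/
theorem expect_excessSum_le (S : Fin k → Fin s → X × Bool) {A : Measure (X × Bool) → X → Bool}
    {m : ℕ} (d : ℕ) {γ cap : ℝ} (hγ1 : γ < 1) (hcap : 0 < cap) (hn : 1 ≤ (k * s : ℕ) * cap)
    (h' : X → Bool) (β : ℝ) {c : ℝ} (hc : 0 ≤ c)
    (hround : ∀ v : Fin k → Fin s → ℝ, (∀ i x, 0 < v i x) →
      expect (boostRound S A d m γ cap v) (fun r => ENNReal.ofReal (excess S h' β v r.hyp)) ≤
        ENNReal.ofReal c) (T : ℕ) :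
    ∀ v : Fin k → Fin s → ℝ, (∀ i x, 0 < v i x) →
      expect (boostFrom S A d m γ cap T v) (fun ρ => ENNReal.ofReal (excessSum S h' β v ρ)) ≤
        ENNReal.ofReal (T * c) := by
  induction T with
  | zero =>
    intro v _
    rw [boostFrom, expect_pure]
    simp [excessSum]
  | succ T ih =>
    intro v hv
    rw [boostFrom, expect_bind]
    have h1 : ∀ r ∈ (boostRound S A d m γ cap v).support,
        expect ((boostFrom S A d m γ cap T r.weight).map fun ρ => r :: ρ)
          (fun ρ => ENNReal.ofReal (excessSum S h' β v ρ)) ≤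
        ENNReal.ofReal (excess S h' β v r.hyp) + ENNReal.ofReal (T * c) := by
      intro r hr
      obtain ⟨h, _, rfl⟩ := boostRound_support S (H := Set.univ) (fun _ => Set.mem_univ _)
        d γ cap v r hr
      rw [expect_map]
      have h2 : ∀ ρ : List (Round X k s), ((fun ρ => ENNReal.ofReal (excessSum S h' β v ρ)) ∘
          fun ρ => roundOf S d m γ cap v h :: ρ) ρ =
          ENNReal.ofReal (excess S h' β v (roundOf S d m γ cap v h).hyp) +
          ENNReal.ofReal (excessSum S h' β (roundOf S d m γ cap v h).weight ρ) := by
        intro ρ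
        rw [← ENNReal.ofReal_add (excess_nonneg _ _ _ _ _) (excessSum_nonneg _ _ _ _ _)]
        rfl
      rw [funext h2, expect_add, expect_const]
      gcongr
      exact ih _ (roundOf_spec S d m hγ1 hcap hn hv h).1
    refine (expect_mono _ h1).trans ?_
    rw [expect_add, expect_const]
    refine (add_le_add_left (hround v hv) _).trans ?_
    rw [← ENNReal.ofReal_add hc (by positivity)]
    refine ENNReal.ofReal_le_ofReal ?_
    push_cast
    linarith

end Expectation

/-! ### Generalization of majority votes -/

section Samples

universe u
variable {X : Type u}

/-- The majorities of `T` hypotheses of the class `H`. -/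
def majorities (H : Set (X → Bool)) (T : ℕ) : Set (X → Bool) :=
  Set.range fun τ : Fin T → H => majority (List.ofFn fun i => (τ i).1)

theorem majority_mem_majorities {H : Set (X → Bool)} (hs : List (X → Bool))
    (h : ∀ f ∈ hs, f ∈ H) : majority hs ∈ majorities H hs.length := by
  refine ⟨fun i => ⟨hs.get i, h _ (List.get_mem _ _)⟩, ?_⟩
  exact congrArg majority (List.ofFn_get hs)

theorem majority_congr {T : ℕ} {τ τ' : Fin T → X → Bool} {x : X} (h : ∀ i, τ i x = τ' i x) :
    majority (List.ofFn τ) x = majority (List.ofFn τ') x := by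
  have e : (fun h : X → Bool => if h x then (1 : ℤ) else -1) ∘ τ =
      (fun h : X → Bool => if h x then (1 : ℤ) else -1) ∘ τ' := funext fun i => by simp [h i]
  rw [majority, majority, List.map_ofFn, List.map_ofFn, e]

theorem exists_patterns_majorities {H : Set (X → Bool)} {T : ℕ} {ι : Type*} [Fintype ι]
    (p : ι → X) (V : Finset (ι → Bool)) (hV : ∀ h ∈ H, (fun i => h (p i)) ∈ V) :
    ∃ V' : Finset (ι → Bool), (∀ h ∈ majorities H T, (fun i => h (p i)) ∈ V') ∧
      V'.card ≤ V.card ^ T := by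
  classical
  -- The vote at a point depends only on `T` bits, so it is evaluated on constant functions of a
  -- `Unit` argument; a choice of `T` patterns determines the pattern of the majority.
  refine ⟨(Finset.univ : Finset (Fin T → V)).image fun c i =>
    majority (List.ofFn fun t (_ : Unit) => (c t).1 i) (), ?_, ?_⟩
  · rintro _ ⟨τ, rfl⟩
    refine Finset.mem_image.2 ⟨fun t => ⟨_, hV (τ t).1 (τ t).2⟩, Finset.mem_univ _, ?_⟩
    funext i
    simp only [majority, List.map_ofFn]
    rfl
  · refine Finset.card_image_le.trans ?_
    simp

variable [MeasurableSpace X]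

theorem measurable_majority (hs : List (X → Bool)) (h : ∀ f ∈ hs, Measurable f) :
    Measurable (majority hs) := by
  have hsum : Measurable fun x => (hs.map fun h => if h x then (1 : ℤ) else -1).sum := by
    induction hs with
    | nil => simp
    | cons f t ih =>
      simp only [List.map_cons, List.sum_cons]
      refine Measurable.add ?_ (ih fun g hg => h g (List.mem_cons_of_mem _ hg))
      exact (measurable_from_top (f := fun b : Bool => if b then (1 : ℤ) else -1)).comp
        (h f List.mem_cons_self)
  exact (measurable_from_top (f := fun z : ℤ => decide (0 ≤ z))).comp hsum

/-- At each point the finitely many approximating sequences are eventually all correct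
simultaneously, and then so is their majority. -/
theorem UniversallySeparable.majorities {H : Set (X → Bool)} (hH : UniversallySeparable H)
    (T : ℕ) : UniversallySeparable (majorities H T) := by
  obtain ⟨hmeas, H₀, hsub, hcount, happrox⟩ := hH
  refine ⟨?_, DistBoost.majorities H₀ T, ?_, ?_, ?_⟩
  · rintro _ ⟨τ, rfl⟩
    refine measurable_majority _ fun f hf => ?_
    obtain ⟨i, rfl⟩ := (List.mem_ofFn' _ _).1 hf
    exact hmeas _ (τ i).2
  · rintro _ ⟨τ, rfl⟩
    exact ⟨fun i => ⟨τ i, hsub (τ i).2⟩, rfl⟩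
  · have := hcount.to_subtype
    exact Set.countable_range _
  · rintro _ ⟨τ, rfl⟩
    choose g hg hlim using fun i => happrox (τ i).1 (τ i).2
    refine ⟨fun n => majority (List.ofFn fun i => g i n), fun n => ⟨fun i => ⟨_, hg i n⟩, rfl⟩,
      fun x => ?_⟩
    filter_upwards [eventually_all.2 fun i => hlim i x] with n hn
    exact majority_congr hn

variable {k s : ℕ} [NeZero k]

theorem isProbabilityMeasure_mixture (D : Fin k → Measure (X × Bool))
    [∀ i, IsProbabilityMeasure (D i)] : IsProbabilityMeasure (mixture D) := by
  constructor
  rw [mixture, Measure.smul_apply, Measure.finsetSum_apply]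
  simp only [measure_univ, Finset.sum_const, Finset.card_univ, Fintype.card_fin, nsmul_eq_mul,
    mul_one, smul_eq_mul]
  exact ENNReal.inv_mul_cancel (by exact_mod_cast NeZero.ne k) (ENNReal.natCast_ne_top k)

omit [NeZero k] in
theorem err_mixture (D : Fin k → Measure (X × Bool)) [∀ i, IsProbabilityMeasure (D i)]
    (h : X → Bool) : err (mixture D) h = (∑ i, err (D i) h) / k := by
  rw [err, mixture, Measure.real, Measure.smul_apply, Measure.finsetSum_apply, smul_eq_mul,
    ENNReal.toReal_mul, ENNReal.toReal_sum fun i _ => measure_ne_top _ _, ENNReal.toReal_inv,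
    ENNReal.toReal_natCast, div_eq_inv_mul]
  rfl

omit [NeZero k] in
-- Flattens the nested product into one product over pairs, the form that symmetrization requires.
theorem sampleLaw_eq_map (D : Fin k → Measure (X × Bool)) [∀ i, IsProbabilityMeasure (D i)]
    (s : ℕ) : sampleLaw D s =
      (Measure.pi fun a : Fin k × Fin s => D a.1).map
        (MeasurableEquiv.curry (Fin k) (Fin s) (X × Bool)) := by
  have := Measure.infinitePi_map_curry fun (i : Fin k) (_ : Fin s) => D i
  simp only [Measure.infinitePi_eq_pi] at this
  exact this.symm

theorem tendsto_err {D : Measure (X × Bool)} [IsProbabilityMeasure D] {g : ℕ → X → Bool}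
    {h : X → Bool} (hg : ∀ n, Measurable (g n)) (hh : Measurable h)
    (hlim : ∀ x, ∀ᶠ n in atTop, g n x = h x) :
    Tendsto (fun n => err D (g n)) atTop (nhds (err D h)) := by
  simp_rw [← fun n => integral_lossAt (hg n) D, ← integral_lossAt hh D]
  refine tendsto_integral_of_dominated_convergence (fun _ => (1 : ℝ))
    (fun n => (measurable_lossAt (hg n)).aestronglyMeasurable) (integrable_const _)
    (fun n => Eventually.of_forall fun q => ?_) (Eventually.of_forall fun q => ?_)
  · rw [Real.norm_eq_abs, abs_of_nonneg (lossAt_nonneg _ _)]; exact lossAt_le_one _ _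
  · refine tendsto_const_nhds.congr' ?_
    filter_upwards [hlim q.1] with n hn
    simp [lossAt, hn]

/-- Uniform convergence of the error rates on the local samples, for a separable class with few
patterns. -/
theorem sampleLaw_deviation_le [NeZero s] (D : Fin k → Measure (X × Bool))
    [∀ i, IsProbabilityMeasure (D i)] {K : Set (X → Bool)} (hK : UniversallySeparable K) {G : ℝ}
    (hG : ∀ p : (Fin k × Fin s) ⊕ (Fin k × Fin s) → X,
      ∃ V : Finset ((Fin k × Fin s) ⊕ (Fin k × Fin s) → Bool),
        (∀ h ∈ K, (fun i => h (p i)) ∈ V) ∧ (V.card : ℝ) ≤ G)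
    {η δ ε : ℝ} (hη : 0 < η) (hε : 0 < ε) (hηδ : η ≤ δ * ε)
    (hlog : Real.log (2 * G) ≤ (k * s : ℕ) * η ^ 2 / 2) :
    sampleLaw D s {S | ∃ h ∈ K, ε < |err (mixture D) h - errCount S h / (k * s : ℕ)|} ≤
      ENNReal.ofReal δ := by
  obtain ⟨hmeas, K₀, hsub, hcount, happrox⟩ := hK
  have hkp : (0 : ℝ) < k := by exact_mod_cast Nat.pos_of_ne_zero (NeZero.ne k)
  have hsp : (0 : ℝ) < s := by exact_mod_cast Nat.pos_of_ne_zero (NeZero.ne s)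
  set n : ℝ := ((k * s : ℕ) : ℝ) with hn
  have hns : n = k * s := by rw [hn]; push_cast; rfl
  have hnpos : 0 < n := by rw [hns]; positivity
  have hmix := isProbabilityMeasure_mixture D
  rcases isEmpty_or_nonempty K₀ with hemp | hne
  · have : {S : Fin k → Fin s → X × Bool | ∃ h ∈ K,
        ε < |err (mixture D) h - errCount S h / n|} = ∅ := by
      refine Set.eq_empty_of_forall_notMem fun S hS => ?_
      obtain ⟨h, hh, _⟩ := hS
      obtain ⟨g, hg, _⟩ := happrox h hh
      exact hemp.elim ⟨g 0, hg 0⟩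
    rw [this]; simp
  have := hcount.to_subtype
  set f : K₀ → X × Bool → ℝ := fun θ => lossAt θ.1 with hf
  have hfm : ∀ θ, Measurable (f θ) := fun θ => measurable_lossAt (hmeas _ (hsub θ.2))
  have hf0 : ∀ θ q, 0 ≤ f θ q := fun θ q => lossAt_nonneg _ _
  have hf1 : ∀ θ q, f θ q ≤ 1 := fun θ q => lossAt_le_one _ _
  set π := Measure.pi fun a : Fin k × Fin s => D a.1 with hπ
  set mean : K₀ → Fin k × Fin s → ℝ := fun θ a => ∫ q, f θ q ∂D a.1 with hmean
  have hm0 : ∀ θ j, 0 ≤ mean θ j := fun θ j => integral_nonneg fun a => hf0 θ a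
  have hint : ∀ θ i, Integrable (f θ) (D i) := fun θ i =>
    integrable_of_abs_le (hfm θ) (c := 1) fun z => by
      rw [abs_of_nonneg (hf0 θ z)]; exact hf1 θ z
  have hm1 : ∀ θ j, mean θ j ≤ 1 := fun θ j =>
    (integral_mono (hint θ j.1) (integrable_const 1) fun a => hf1 θ a).trans (by simp)
  have hcard : ((Fintype.card (Fin k × Fin s) : ℕ) : ℝ) = n := by simp [hn]
  have hdev : ∫ z, maxDev f mean z ∂π ≤ n * η := by
    rw [← hcard]
    refine integral_maxDev_le hfm hf0 hf1 (fun a : Fin k × Fin s => D a.1) hη (fun y => ?_)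
      (by rw [hcard]; exact hlog)
    obtain ⟨V, hV, hVG⟩ := exists_diff_patterns hG (fun q : X × Bool => q) y
    exact ⟨V, fun θ => hV _ (hsub θ.2), hVG⟩
  have hdm : Measurable (maxDev f mean) := measurable_maxDev hfm mean
  have hdint : Integrable (maxDev f mean) π :=
    integrable_of_abs_le hdm fun z => abs_maxDev_le hf0 hf1 hm0 hm1 z
  have hterm : ∀ (h : X → Bool), Measurable h → ∀ S : Fin k → Fin s → X × Bool,
      ∑ a : Fin k × Fin s, (∫ q, lossAt h q ∂D a.1 - lossAt h (S a.1 a.2)) =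
        n * (err (mixture D) h - errCount S h / n) := by
    intro h hh S
    rw [Finset.sum_sub_distrib, mul_sub, mul_div_cancel₀ _ hnpos.ne', err_mixture]
    congr 1
    · simp_rw [integral_lossAt hh, Fintype.sum_prod_type]
      simp only [Finset.sum_const, Finset.card_univ, Fintype.card_fin, nsmul_eq_mul]
      rw [← Finset.mul_sum, hns]
      field_simp
    · simp only [lossAt]
      rw [← Finset.sum_filter, errCount]
      simp
  -- A violation by a member of `K` passes to the countable subclass: true errors converge, sample
  -- errors are eventually equal, and the inequality is strict. So an event that need not be
  -- measurable lies inside a measurable one.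
  have hincl : (MeasurableEquiv.curry (Fin k) (Fin s) (X × Bool)) ⁻¹'
      {S : Fin k → Fin s → X × Bool | ∃ h ∈ K, ε < |err (mixture D) h - errCount S h / n|} ⊆
      {z | n * ε ≤ maxDev f mean z} := by
    rintro z ⟨h, hh, hlt⟩
    set S : Fin k → Fin s → X × Bool := MeasurableEquiv.curry (Fin k) (Fin s) (X × Bool) z with hS
    obtain ⟨g, hg, hlim⟩ := happrox h hh
    have hconv := tendsto_err (D := mixture D) (fun n => hmeas _ (hsub (hg n))) (hmeas h hh) hlim
    have hcnt : ∀ᶠ j in atTop, errCount S (g j) = errCount S h := by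
      have : ∀ᶠ j in atTop, ∀ a : Fin k × Fin s, g j (S a.1 a.2).1 = h (S a.1 a.2).1 :=
        eventually_all.2 fun a => hlim _
      filter_upwards [this] with j hj
      rw [errCount, errCount]
      congr 1
      exact Finset.filter_congr fun a _ => by rw [hj a]
    have hconv' : Tendsto (fun j => |err (mixture D) (g j) - errCount S h / n|) atTop
        (nhds |err (mixture D) h - errCount S h / n|) := (hconv.sub_const _).abs
    obtain ⟨j, hj1, hj2⟩ := ((hconv'.eventually_const_lt hlt).and hcnt).exists
    rw [← hj2] at hj1
    have h1 := le_ciSup (bddAbove_maxDev hf0 hf1 hm0 hm1 z) (⟨g j, hg j⟩ : K₀)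
    have h2 := hterm (g j) (hmeas _ (hsub (hg j))) S
    have h3 : |∑ a : Fin k × Fin s, (mean ⟨g j, hg j⟩ a - f ⟨g j, hg j⟩ (z a))| =
        n * |err (mixture D) (g j) - errCount S (g j) / n| := by
      rw [← abs_of_pos hnpos, ← abs_mul, abs_of_pos hnpos, ← h2]
      rfl
    refine le_trans ?_ (h3.symm.le.trans h1)
    gcongr
  rw [sampleLaw_eq_map, MeasurableEquiv.map_apply]
  refine (measure_mono hincl).trans ?_
  have hnε : 0 < n * ε := by positivity
  have hmarkov := mul_meas_ge_le_integral_of_nonneg (μ := π)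
    (Eventually.of_forall fun z => Real.iSup_nonneg fun _ => abs_nonneg _) hdint (n * ε)
  rw [← ofReal_measureReal]
  refine ENNReal.ofReal_le_ofReal ?_
  have h4 : n * ε * π.real {z | n * ε ≤ maxDev f mean z} ≤ n * ε * δ := by
    refine hmarkov.trans (hdev.trans ?_)
    have : n * η ≤ n * (δ * ε) := by gcongr
    linarith
  exact le_of_mul_le_mul_left h4 hnε

end Samples

/-! ### Numerical constants -/

section Constants

/-- The factor in the sample size. -/
noncomputable def sampleConst (δ : ℝ) : ℝ := 11264 * (Real.log (33792 / δ ^ 2) + 1) / δ ^ 2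

theorem le_sampleConst {δ : ℝ} (hδ : 0 < δ) (hδ1 : δ ≤ 1) : 11264 / δ ^ 2 ≤ sampleConst δ := by
  have : 0 ≤ Real.log (33792 / δ ^ 2) := by
    apply Real.log_nonneg
    rw [le_div_iff₀ (by positivity)]
    nlinarith
  rw [sampleConst]
  gcongr
  linarith

theorem sampleConst_ge_one {δ : ℝ} (hδ : 0 < δ) (hδ1 : δ ≤ 1) : 1 ≤ sampleConst δ := by
  refine le_trans ?_ (le_sampleConst hδ hδ1)
  rw [le_div_iff₀ (by positivity)]
  nlinarith

/-- With `x * T = ε² δ² / 1024` the exponential costs `n ε² δ² / 512` of the available `n ε² δ² /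
128`. The rest is at most `66 Λ ε² a log Λ`, and `66 * 512 / 3 = 11264`. The number `33792 = 33 *
1024` comes from `x⁻¹ ≤ 1024 * 33 * Λ / δ²`. -/
theorem log_growth_majorities_le {δ ε Λ n : ℝ} {T d : ℕ} (hδ : 0 < δ) (hδ1 : δ ≤ 1)
    (hε : 0 < ε) (hε1 : ε ≤ 1) (hT : 1 ≤ T) (hd : 1 ≤ d) (hΛ0 : 0 < Λ) (hΛ : 1 ≤ Real.log Λ)
    (hTd : (T * d : ℝ) ≤ 33 * Λ * ε ^ 2)
    (hn : sampleConst δ * (Λ * Real.log Λ) ≤ n) :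
    Real.log (2 * (((ε ^ 2 * δ ^ 2 / (1024 * T))⁻¹) ^ d *
      Real.exp (ε ^ 2 * δ ^ 2 / (1024 * T) * (n + n))) ^ T) ≤ n * (δ / 2 * (ε / 4)) ^ 2 / 2 := by
  have hT' : (1 : ℝ) ≤ T := by exact_mod_cast hT
  have hd' : (1 : ℝ) ≤ d := by exact_mod_cast hd
  set x := ε ^ 2 * δ ^ 2 / (1024 * T) with hx
  have hx0 : 0 < x := by positivity
  have hε2 : ε ^ 2 ≤ 1 := by nlinarith
  have hδ2 : δ ^ 2 ≤ 1 := by nlinarith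
  have hxT : x * T = ε ^ 2 * δ ^ 2 / 1024 := by rw [hx]; field_simp
  have hlog : Real.log (2 * ((x⁻¹) ^ d * Real.exp (x * (n + n))) ^ T) =
      Real.log 2 + T * d * Real.log x⁻¹ + 2 * n * (x * T) := by
    rw [Real.log_mul (by norm_num) (by positivity), Real.log_pow,
      Real.log_mul (by positivity) (by positivity), Real.log_pow, Real.log_exp]
    ring
  have hxinv : x⁻¹ = 1024 * T / (ε ^ 2 * δ ^ 2) := by rw [hx, inv_div]
  have hlb : Real.log 2 ≤ Real.log x⁻¹ := by
    refine Real.log_le_log (by norm_num) ?_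
    rw [hxinv, le_div_iff₀ (by positivity)]
    nlinarith [mul_le_one₀ hε2 (by positivity) hδ2]
  have hub : Real.log x⁻¹ ≤ (Real.log (33792 / δ ^ 2) + 1) * Real.log Λ := by
    have h1 : x⁻¹ ≤ 33792 / δ ^ 2 * Λ := by
      rw [hxinv, div_mul_eq_mul_div, div_le_div_iff₀ (by positivity) (by positivity)]
      have : (T : ℝ) ≤ 33 * Λ * ε ^ 2 := by nlinarith
      nlinarith [mul_le_mul_of_nonneg_right this (by positivity : 0 ≤ δ ^ 2)]
    have h2 := Real.log_le_log (by positivity) h1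
    rw [Real.log_mul (by positivity) hΛ0.ne'] at h2
    have h3 : 0 ≤ Real.log (33792 / δ ^ 2) := by
      apply Real.log_nonneg
      rw [le_div_iff₀ (by positivity)]
      nlinarith
    nlinarith
  have hTd1 : (1 : ℝ) ≤ T * d := by nlinarith
  have hlogx : 0 ≤ Real.log x⁻¹ := (Real.log_pos (by norm_num)).le.trans hlb
  set a := Real.log (33792 / δ ^ 2) + 1 with ha
  have h4 : Real.log 2 + T * d * Real.log x⁻¹ ≤ 66 * Λ * ε ^ 2 * (a * Real.log Λ) := by
    have : Real.log 2 ≤ T * d * Real.log x⁻¹ := by nlinarith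
    calc Real.log 2 + T * d * Real.log x⁻¹ ≤ 2 * (T * d) * Real.log x⁻¹ := by linarith
      _ ≤ 2 * (33 * Λ * ε ^ 2) * (a * Real.log Λ) := by gcongr
      _ = _ := by ring
  have h5 : 11264 * a * (Λ * Real.log Λ) ≤ n * δ ^ 2 := by
    have := mul_le_mul_of_nonneg_right hn (by positivity : 0 ≤ δ ^ 2)
    rw [sampleConst, ← ha] at this
    refine le_trans (le_of_eq ?_) this
    field_simp
  have h6 := mul_le_mul_of_nonneg_right h5 (by positivity : 0 ≤ ε ^ 2)
  rw [hlog, hxT]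
  nlinarith

theorem log_two_le_of_sampleConst {δ ε Λ n u : ℝ} (hδ : 0 < δ) (hδ1 : δ ≤ 1)
    (hΛ0 : 0 < Λ) (hΛ : 1 ≤ Real.log Λ) (hu : Real.log 2 ≤ Λ * (u ^ 2 * ε ^ 2))
    (hn : sampleConst δ * (Λ * Real.log Λ) ≤ n) :
    Real.log (2 * 1) ≤ n * (δ / 2 * (u * ε / 16)) ^ 2 / 2 := by
  have h1 : 11264 / δ ^ 2 * Λ ≤ n := by
    refine le_trans ?_ hn
    have := le_sampleConst hδ hδ1
    have h0 : 0 ≤ sampleConst δ := by linarith [sampleConst_ge_one hδ hδ1]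
    have : Λ ≤ Λ * Real.log Λ := le_mul_of_one_le_right hΛ0.le hΛ
    gcongr
  have h2 : 11264 * Λ ≤ n * δ ^ 2 := by
    have := mul_le_mul_of_nonneg_right h1 (by positivity : 0 ≤ δ ^ 2)
    refine le_trans (le_of_eq ?_) this
    field_simp
  have h3 := mul_le_mul_of_nonneg_right h2 (by positivity : 0 ≤ u ^ 2 * ε ^ 2)
  rw [mul_one]
  have : 0 < Real.log 2 := Real.log_pos (by norm_num)
  nlinarith

/-- The factor in the number of examples per round. -/
noncomputable def roundConst (η : ℝ) : ℝ := 8 * Real.log (8 / η ^ 2) / η ^ 2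

theorem roundConst_ge_one {η : ℝ} (hη : 0 < η) (hη1 : η ≤ 1) : 1 ≤ roundConst η := by
  have h2 : η ^ 2 ≤ 1 := by nlinarith
  have : 1 - (8 / η ^ 2)⁻¹ ≤ Real.log (8 / η ^ 2) :=
    Real.one_sub_inv_le_log_of_pos (by positivity)
  rw [inv_div] at this
  rw [roundConst, le_div_iff₀ (by positivity)]
  linarith

/-- The choice `x = η² / 8` spends half of the budget `m η² / 2` on the exponential; the size of `m`
makes the other half cover `2 d log (8 / η²)`. -/
theorem log_growth_round_le {η : ℝ} {d m : ℕ} (hη : 0 < η) (hη1 : η ≤ 1) (hd : 1 ≤ d)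
    (hm : roundConst η * d ≤ m) :
    Real.log (2 * (((η ^ 2 / 8)⁻¹) ^ d * Real.exp (η ^ 2 / 8 * (m + m : ℕ)))) ≤ m * η ^ 2 / 2 := by
  have h2 : η ^ 2 ≤ 1 := by nlinarith
  have hd' : (1 : ℝ) ≤ d := by exact_mod_cast hd
  rw [Real.log_mul (by norm_num) (by positivity), Real.log_mul (by positivity) (by positivity),
    Real.log_pow, Real.log_exp, inv_div]
  have hlb : Real.log 2 ≤ Real.log (8 / η ^ 2) := by
    refine Real.log_le_log (by norm_num) ?_
    rw [le_div_iff₀ (by positivity)]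
    nlinarith
  have hl2 : 0 < Real.log 2 := Real.log_pos (by norm_num)
  have h3 := mul_le_mul_of_nonneg_right hm (by positivity : 0 ≤ η ^ 2)
  have h4 : roundConst η * d * η ^ 2 = 8 * d * Real.log (8 / η ^ 2) := by
    rw [roundConst]; field_simp
  rw [h4] at h3
  push_cast
  nlinarith

/-- The factor in the number of words per round. -/
noncomputable def wordConst (C : ℝ) : ℝ :=
  7 + (17 + 28 * (Real.log (2 * C) + 6)) * (2 * (Real.log (2 * C) + 6) + 1)

theorem natSize_le {n : ℕ} (hn : 0 < n) : (Nat.size n : ℝ) ≤ 2 * Real.log n + 1 := by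
  have h1 : 2 ^ (Nat.size n - 1) ≤ n := by
    have : Nat.size n - 1 < Nat.size n := by
      have := Nat.size_pos.2 hn; omega
    exact Nat.lt_size.1 this
  have h2 : ((2 : ℝ) ^ (Nat.size n - 1)) ≤ n := by exact_mod_cast h1
  have h3 := Real.log_le_log (by positivity) h2
  rw [Real.log_pow] at h3
  have h4 : (Nat.size n : ℝ) = (Nat.size n - 1 : ℕ) + 1 := by
    have := Nat.size_pos.2 hn
    exact_mod_cast (by omega : Nat.size n = Nat.size n - 1 + 1)
  have h5 : (1 : ℝ) / 2 ≤ Real.log 2 := by linarith [Real.log_two_gt_d9]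
  have h6 : (0 : ℝ) ≤ (Nat.size n - 1 : ℕ) := by positivity
  nlinarith

/-- From `log (4/3) ≥ 1/4` an iteration costs at most `k (17 + 28 P) L` words, and there are at most
`(2 P + 1) L` of them. -/
theorem words_le_of_log_le {k s d : ℕ} (hks : 0 < k * s) (hd : 1 ≤ d) {P L : ℝ} (hP : 0 ≤ P)
    (hL : 1 ≤ L) (hn : Real.log (k * s : ℕ) ≤ P * L) :
    (k * d + 6 * k + iterationWords k s * Nat.size (k * s) : ℝ) ≤
      (7 + (17 + 28 * P) * (2 * P + 1)) * (k * d * L ^ 2) := by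
  have hd' : (1 : ℝ) ≤ d := by exact_mod_cast hd
  have hk : (0 : ℝ) ≤ k := by positivity
  have hlog : 0 ≤ Real.log (k * s : ℕ) := Real.log_natCast_nonneg _
  have h43 : 1 / 4 ≤ Real.log (4 / 3) := by
    have := Real.one_sub_inv_le_log_of_pos (by norm_num : (0 : ℝ) < 4 / 3)
    norm_num at this ⊢
    linarith
  have h1 : Real.log (k * s : ℕ) / Real.log (4 / 3) ≤ 4 * (P * L) := by
    rw [div_le_iff₀ (by linarith)]
    nlinarith
  have h2 : iterationWords k s ≤ k * ((17 + 28 * P) * L) := by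
    have : iterationWords k s = k * (17 + 7 * (Real.log (k * s : ℕ) / Real.log (4 / 3))) := by
      rw [iterationWords]; ring
    rw [this]
    gcongr
    nlinarith
  have h3 : (Nat.size (k * s) : ℝ) ≤ (2 * P + 1) * L := by
    have := natSize_le hks
    nlinarith
  have h4 : iterationWords k s * Nat.size (k * s) ≤
      k * ((17 + 28 * P) * L) * ((2 * P + 1) * L) := by
    gcongr
  have hL2 : 1 ≤ L ^ 2 := by nlinarith
  have hkd : (k : ℝ) ≤ k * d := le_mul_of_one_le_right hk hd'
  have hkdL : (k * d : ℝ) ≤ k * d * L ^ 2 := le_mul_of_one_le_right (by positivity) hL2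
  have h5 : k * ((17 + 28 * P) * L) * ((2 * P + 1) * L) ≤
      (17 + 28 * P) * (2 * P + 1) * (k * d * L ^ 2) := by
    calc k * ((17 + 28 * P) * L) * ((2 * P + 1) * L)
        = (17 + 28 * P) * (2 * P + 1) * (k * L ^ 2) := by ring
      _ ≤ _ := by gcongr
  linarith

theorem log_two_le_log_inv {ε : ℝ} (hε : 0 < ε) (hε2 : ε ≤ 1 / 2) :
    Real.log 2 ≤ Real.log (1 / ε) := by
  refine Real.log_le_log (by norm_num) ?_
  rw [le_div_iff₀ hε]; linarith

theorem log_sampleOrder_bounds {d : ℕ} {β ε : ℝ} (hd : 1 ≤ d) (hβ : 0 < β) (hβ2 : β < 1 / 2)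
    (hε : 0 < ε) (hε2 : ε ≤ 1 / 2) :
    1 ≤ Real.log (d * Real.log (1 / ε) / ((1 / 2 - β) * ε)) ∧
    0 < sampleOrder d β ε ∧ 1 ≤ Real.log (sampleOrder d β ε) ∧
    Real.log (sampleOrder d β ε) ≤
      3 * Real.log (d * Real.log (1 / ε) / ((1 / 2 - β) * ε)) := by
  have hd' : (1 : ℝ) ≤ d := by exact_mod_cast hd
  have hlog := log_two_le_log_inv hε hε2
  have hl2 := Real.log_two_gt_d9
  have hu : 0 < 1 / 2 - β := by linarith
  set l := Real.log (1 / ε) with hl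
  set u := 1 / 2 - β with hudef
  have hu2 : u ≤ 1 / 2 := by linarith
  have hdl : Real.log 2 ≤ d * l := by nlinarith
  have huε : u * ε ≤ 1 / 4 := by nlinarith
  have huε0 : 0 < u * ε := by positivity
  set Y := d * l / (u * ε) with hY
  -- A narrow margin: `d l ≥ log 2` and `u ε ≤ 1/4` give `Y ≥ 4 log 2 > e`.
  have hYe : Real.exp 1 ≤ Y := by
    rw [hY, le_div_iff₀ huε0]
    have := Real.exp_one_lt_d9
    nlinarith [Real.exp_pos 1]
  have hY2 : 2 ≤ Y := by
    have := Real.exp_one_gt_d9; linarith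
  have hYpos : 0 < Y := by linarith
  have hΛ : sampleOrder d β ε = Y / (u * ε) := by
    rw [sampleOrder, ← hl, ← hudef, hY]; field_simp
  have hYΛ : Y ≤ sampleOrder d β ε := by
    rw [hΛ, le_div_iff₀ huε0]; nlinarith
  have hΛY : sampleOrder d β ε ≤ Y ^ 3 := by
    have h1 : 1 / (u * ε) ≤ 2 * Y := by
      rw [hY, ← mul_div_assoc, div_le_div_iff_of_pos_right huε0]; linarith
    have : sampleOrder d β ε = Y * (1 / (u * ε)) := by rw [hΛ]; ring
    rw [this]
    calc Y * (1 / (u * ε)) ≤ Y * (2 * Y) := by gcongr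
      _ ≤ Y * (Y * Y) := by gcongr
      _ = Y ^ 3 := by ring
  have hL : 1 ≤ Real.log Y := by rw [Real.le_log_iff_exp_le hYpos]; exact hYe
  have hΛpos : 0 < sampleOrder d β ε := hYpos.trans_le hYΛ
  refine ⟨hL, hΛpos, hL.trans (Real.log_le_log hYpos hYΛ), ?_⟩
  have := Real.log_le_log hΛpos hΛY
  rw [Real.log_pow] at this
  exact_mod_cast this

theorem log_card_le {k N : ℕ} {C Λ L : ℝ} (hk : 0 < k) (hkN : k ≤ N) (hC : 1 ≤ C) (hΛ0 : 0 < Λ)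
    (hΛ : 1 ≤ Real.log Λ) (hL : 1 ≤ L) (hΛL : Real.log Λ ≤ 3 * L)
    (hN : (N : ℝ) ≤ C * (Λ * Real.log Λ)) :
    Real.log (k * (N / k + 1) : ℕ) ≤ (Real.log (2 * C) + 6) * L := by
  -- Here `k ≤ N` is needed: rounding up adds at most `k` examples.
  have h1 : k * (N / k + 1) ≤ 2 * N := by
    have := Nat.mul_div_le N k
    rw [Nat.mul_add]; omega
  have h2 : ((k * (N / k + 1) : ℕ) : ℝ) ≤ 2 * C * (Λ * Real.log Λ) := by
    have : ((k * (N / k + 1) : ℕ) : ℝ) ≤ 2 * N := by exact_mod_cast h1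
    linarith
  have h3 : (0 : ℝ) < (k * (N / k + 1) : ℕ) := by
    exact_mod_cast Nat.mul_pos hk (Nat.succ_pos _)
  have h4 := Real.log_le_log h3 h2
  have hlogpos : 0 < Real.log Λ := by linarith
  rw [Real.log_mul (by positivity) (by positivity), Real.log_mul hΛ0.ne' hlogpos.ne'] at h4
  have h5 : Real.log (Real.log Λ) ≤ Real.log Λ - 1 := Real.log_le_sub_one_of_pos hlogpos
  have h6 : 0 ≤ Real.log (2 * C) := Real.log_nonneg (by linarith)
  nlinarith

end Constants

/-! ### Assembling the guarantees -/

section Main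

universe u
variable {X : Type u} [MeasurableSpace X] {k s : ℕ} [NeZero k] [NeZero s]

/-- If the errors on the local samples are close to the true ones, then the algorithm succeeds with
high probability over its random choices. -/
theorem ofReal_le_distBoost (D : Fin k → Measure (X × Bool)) [∀ i, IsProbabilityMeasure (D i)]
    {H : Set (X → Bool)} {A : Measure (X × Bool) → X → Bool} {β : ℝ}
    (hA : IsWeakAgnosticLearner H β A) {d m T : ℕ} (hd1 : 1 ≤ d) (hd : vcDim H ≤ d)
    (hmeas : ∀ h ∈ H, Measurable h) {δ ε κ η : ℝ} (hβ0 : 0 < β) (hβ2 : β < 1 / 2) (hδ : 0 < δ)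
    (hε : 0 < ε) (hε2 : ε ≤ 1 / 2) (hη : 0 < η) (hη1 : η ≤ 1) (hηδ : 48 * η ≤ δ * (1 / 2 - β))
    (hm : roundConst η * d ≤ m) (hm0 : 0 < m)
    (hT : 32 * (Real.log (1 / ε) / (1 / 2 - β) ^ 2) < T)
    (hκ : 2 * optErr (mixture D) H / (1 / 2 - β) + ε / 2 ≤ κ)
    (hκ' : κ ≤ 2 * optErr (mixture D) H / (1 / 2 - β) + 3 * ε / 4)
    {h' : X → Bool} (hh' : h' ∈ H)
    (hopt : err (mixture D) h' ≤ optErr (mixture D) H + (1 / 2 - β) * ε / 16)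
    (S : Fin k → Fin s → X × Bool)
    (hS' : |err (mixture D) h' - errCount S h' / (k * s : ℕ)| ≤ (1 / 2 - β) * ε / 16)
    (hS : ∀ f ∈ majorities H T, |err (mixture D) f - errCount S f / (k * s : ℕ)| ≤ ε / 4) :
    ENNReal.ofReal (1 - δ) ≤ (distBoost S A d m β (min 1 κ) T).toOuterMeasure
      {ρ | err (mixture D) (output ρ) ≤ 2 * optErr (mixture D) H / (1 / 2 - β) + ε} := by
  have hmix := isProbabilityMeasure_mixture D
  -- For `κ ≥ 1` the claimed error bound is at least `1` and there is nothing to prove.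
  rcases le_or_gt 1 κ with h1κ | hκ1
  · refine ofReal_one_sub_le_of_expect_le _ (F := fun _ => 0) one_pos hδ.le ?_ _ fun ρ _ _ => ?_
    · simp [expect]
    · have : err (mixture D) (output ρ) ≤ 1 := measureReal_le_one
      simp only [Set.mem_ofPred_eq]
      linarith
  set γ : ℝ := (1 / 2 - β) / 2 with hγ
  have hu : 0 < 1 / 2 - β := by linarith
  have hγ0 : 0 < γ := by positivity
  have hopt0 : 0 ≤ optErr (mixture D) H := Real.iInf_nonneg fun _ => measureReal_nonneg
  have hκε : ε / 2 ≤ κ := by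
    have : 0 ≤ 2 * optErr (mixture D) H / (1 / 2 - β) := by positivity
    linarith
  have hκ0 : 0 < κ := by linarith
  have hk : (0 : ℝ) < k := by exact_mod_cast Nat.pos_of_ne_zero (NeZero.ne k)
  have hs : (0 : ℝ) < s := by exact_mod_cast Nat.pos_of_ne_zero (NeZero.ne s)
  have hnpos : (0 : ℝ) < (k * s : ℕ) := by push_cast; positivity
  rw [min_eq_right hκ1.le]
  set n : ℝ := ((k * s : ℕ) : ℝ) with hn
  have hcap : 0 < 1 / (κ * n) := by positivity
  have hncap : 1 ≤ n * (1 / (κ * n)) := by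
    have : n * (1 / (κ * n)) = 1 / κ := by field_simp
    rw [this, le_div_iff₀ hκ0]; linarith
  have hTpos : (0 : ℝ) < T := by
    have : 0 < Real.log (1 / ε) :=
      (Real.log_pos (by norm_num)).trans_le (log_two_le_log_inv hε hε2)
    have : 0 < 32 * (Real.log (1 / ε) / (1 / 2 - β) ^ 2) := by positivity
    linarith
  have hexp : expect (distBoost S A d m β κ T)
      (fun ρ => ENNReal.ofReal (excessSum S h' β (fun _ _ => 1 / (s : ℝ)) ρ)) ≤
      ENNReal.ofReal (δ * (T * γ / 12)) := by
    have h1 := expect_excessSum_le S (A := A) (m := m) d (γ := γ) (by linarith) hcap hncap h' β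
      (c := 2 * η) (by positivity) (fun v hv =>
        expect_excess_le S hA hd hmeas hm0 hh' hη (x := η ^ 2 / 8) (by positivity) (by nlinarith)
          (log_growth_round_le hη hη1 hd1 hm) d γ _ hv) T (fun _ _ => 1 / (s : ℝ))
      (fun _ _ => by positivity)
    refine h1.trans (ENNReal.ofReal_le_ofReal ?_)
    -- The factor `48`: the mean total excess `2 η T` must be at most `δ` times the tolerated `T γ /
    -- 12`, and `γ = u / 2`.
    have : T * (2 * η) ≤ T * (δ * γ / 12) := by
      gcongr
      rw [hγ]; linarith
    linarith
  refine ofReal_one_sub_le_of_expect_le _ (by positivity) hδ.le hexp _ fun ρ hρ hex => ?_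
  obtain ⟨hlen, hrun⟩ := boostFrom_support S (fun z =>
    (hA _ (isProbabilityMeasure_empirical hm0 z)).1) d γ (1 / (κ * n)) T _ ρ hρ
  have hcount : (errCount S h' : ℝ) ≤ κ * n * γ := by
    have h2 := (abs_le.1 hS').1
    have h3 : errCount S h' / n ≤ κ * γ := by
      -- The lower bound on `κ` is designed for this: `κ γ` exceeds the optimum by at least `u ε /
      -- 4`, which leaves room for the two errors `u ε / 16`.
      have h4 : optErr (mixture D) H + (1 / 2 - β) * ε / 4 ≤ κ * γ := by
        have := mul_le_mul_of_nonneg_right hκ hγ0.le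
        refine le_trans (le_of_eq ?_) this
        have key : ∀ u : ℝ, u ≠ 0 → optErr (mixture D) H + u * ε / 4 =
            (2 * optErr (mixture D) H / u + ε / 2) * (u / 2) := fun u hu => by
          field_simp; ring
        exact key _ hu.ne'
      have : 0 ≤ (1 / 2 - β) * ε := by positivity
      linarith
    rw [div_le_iff₀ hnpos] at h3
    linarith
  have hlt := errCount_output_lt (β := β) S d m hγ0 (by linarith) (by rw [hγ]; ring) hκ0 hκ1.le H h' hcount
    hrun (by rw [hlen]; exact hex) (by
      rw [hlen]
      -- From `κ ≥ ε / 2 ≥ ε²`.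
      have h5 : Real.log (1 / κ) ≤ 2 * Real.log (1 / ε) := by
        have h6 : 1 / κ ≤ (1 / ε) ^ 2 := by
          rw [one_div_pow]
          apply one_div_le_one_div_of_le (by positivity)
          nlinarith
        have := Real.log_le_log (by positivity) h6
        rwa [Real.log_pow] at this
      refine h5.trans_lt ?_
      have h7 := mul_lt_mul_of_pos_right hT (by positivity : 0 < γ ^ 2 / 4)
      have h8 : 32 * (Real.log (1 / ε) / (1 / 2 - β) ^ 2) * (γ ^ 2 / 4) =
          2 * Real.log (1 / ε) := by
        have key : ∀ l u : ℝ, u ≠ 0 → 32 * (l / u ^ 2) * ((u / 2) ^ 2 / 4) = 2 * l :=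
          fun l u hu => by field_simp; ring
        exact key _ _ hu.ne'
      linarith)
  have hmaj : output ρ ∈ majorities H T := by
    have hmem : ∀ (ρ : List (Round X k s)) (v : Fin k → Fin s → ℝ),
        IsRun S d m γ (1 / (κ * n)) H v ρ → ∀ f ∈ ρ.map Round.hyp, f ∈ H := by
      intro ρ
      induction ρ with
      | nil => intro v _ f hf; simp at hf
      | cons r ρ ih =>
        rintro v ⟨⟨h, hh, rfl⟩, hrun⟩ f hf
        rw [List.map_cons, List.mem_cons] at hf
        rcases hf with rfl | hf
        · exact hh
        · exact ih _ hrun f hf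
    have := majority_mem_majorities (ρ.map Round.hyp) (hmem ρ _ hrun)
    rwa [List.length_map, hlen] at this
  have h9 := (abs_le.1 (hS _ hmaj)).2
  have h10 : errCount S (output ρ) / n < κ := by
    rw [div_lt_iff₀ hnpos]; exact hlt
  simp only [Set.mem_ofPred_eq]
  linarith

theorem run_costs {A : Measure (X × Bool) → X → Bool} {d m T : ℕ} {β κ : ℝ}
    (S : Fin k → Fin s → X × Bool) :
    ∀ ρ ∈ (distBoost S A d m β κ T).support, ρ.length = T ∧ ∀ r ∈ ρ, r.examples = m ∧
      (r.words : ℝ) ≤ k * d + 6 * k + iterationWords k s * Nat.size (k * s) := by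
  intro ρ hρ
  obtain ⟨hlen, hrun⟩ := boostFrom_support S (H := Set.univ) (fun _ => Set.mem_univ _) d
    ((1 / 2 - β) / 2) (1 / (κ * ((k * s : ℕ) : ℝ))) T _ ρ hρ
  refine ⟨hlen, ?_⟩
  have key : ∀ (ρ : List (Round X k s)) (v : Fin k → Fin s → ℝ),
      IsRun S d m ((1 / 2 - β) / 2) (1 / (κ * ((k * s : ℕ) : ℝ))) Set.univ v ρ → ∀ r ∈ ρ,
      r.examples = m ∧
        (r.words : ℝ) ≤ k * d + 6 * k + iterationWords k s * Nat.size (k * s) := by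
    intro ρ
    induction ρ with
    | nil => intro v _ r hr; simp at hr
    | cons r ρ ih =>
      rintro v ⟨⟨h, hh, rfl⟩, hrun⟩ r' hr'
      rw [List.mem_cons] at hr'
      rcases hr' with rfl | hr'
      · exact ⟨rfl, roundOf_words_le S d m _ _ v h⟩
      · exact ih _ hrun r' hr'
  exact key ρ _ hrun

/-- With high probability the errors on the local samples are close to the true ones. -/
theorem sampleLaw_not_close_le (D : Fin k → Measure (X × Bool)) [∀ i, IsProbabilityMeasure (D i)]
    {H : Set (X → Bool)} {d T : ℕ} (hd1 : 1 ≤ d) (hd : vcDim H ≤ d) (hH : UniversallySeparable H)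
    {δ ε β : ℝ} (hδ : 0 < δ) (hδ1 : δ ≤ 1) (hβ0 : 0 < β) (hβ2 : β < 1 / 2) (hε : 0 < ε)
    (hε2 : ε ≤ 1 / 2) (hT1 : 1 ≤ T) (hT : T ≤ 33 * (Real.log (1 / ε) / (1 / 2 - β) ^ 2))
    (hn : sampleConst δ * (sampleOrder d β ε * Real.log (sampleOrder d β ε)) ≤ (k * s : ℕ))
    {h' : X → Bool} (hh' : h' ∈ H) :
    sampleLaw D s {S | ¬ (|err (mixture D) h' - errCount S h' / (k * s : ℕ)| ≤
        (1 / 2 - β) * ε / 16 ∧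
      ∀ f ∈ majorities H T, |err (mixture D) f - errCount S f / (k * s : ℕ)| ≤ ε / 4)} ≤
      ENNReal.ofReal δ := by
  have hu : 0 < 1 / 2 - β := by linarith
  obtain ⟨_, hΛ0, hΛ, _⟩ := log_sampleOrder_bounds hd1 hβ0 hβ2 hε hε2
  have hd' : (1 : ℝ) ≤ d := by exact_mod_cast hd1
  have hlog2 := log_two_le_log_inv hε hε2
  have hl2 : 0 < Real.log 2 := Real.log_pos (by norm_num)
  have hT' : (1 : ℝ) ≤ T := by exact_mod_cast hT1
  have hΛeq : sampleOrder d β ε * ((1 / 2 - β) ^ 2 * ε ^ 2) = d * Real.log (1 / ε) := by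
    rw [sampleOrder]
    exact div_mul_cancel₀ _ (by positivity)
  -- The finer precision `u ε / 16` is needed for the reference hypothesis only, where one pattern
  -- makes it cheap; the majorities need just `ε / 4`.
  have hsingle : sampleLaw D s {S | ∃ h ∈ ({h'} : Set (X → Bool)),
      (1 / 2 - β) * ε / 16 < |err (mixture D) h - errCount S h / (k * s : ℕ)|} ≤
      ENNReal.ofReal (δ / 2) := by
    refine sampleLaw_deviation_le D ⟨?_, {h'}, subset_rfl, Set.countable_singleton _, ?_⟩ (G := 1)
      (fun p => ⟨{fun i => h' (p i)}, ?_, by simp⟩) (η := δ / 2 * ((1 / 2 - β) * ε / 16))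
      (by positivity) (by positivity) le_rfl ?_
    · rintro h rfl; exact hH.1 _ hh'
    · rintro h rfl; exact ⟨fun _ => h, fun _ => rfl, fun _ => Eventually.of_forall fun _ => rfl⟩
    · rintro h rfl; exact Finset.mem_singleton_self _
    · refine log_two_le_of_sampleConst hδ hδ1 hΛ0 hΛ ?_ hn
      rw [hΛeq]; nlinarith
  have hclass : sampleLaw D s {S | ∃ f ∈ majorities H T,
      ε / 4 < |err (mixture D) f - errCount S f / (k * s : ℕ)|} ≤ ENNReal.ofReal (δ / 2) := by
    set x := ε ^ 2 * δ ^ 2 / (1024 * T) with hx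
    have hx0 : 0 < x := by positivity
    have hx1 : x ≤ 1 := by
      rw [hx, div_le_one (by positivity)]
      have h1 : ε ^ 2 ≤ 1 := by nlinarith
      have h2 : δ ^ 2 ≤ 1 := by nlinarith
      have := mul_le_one₀ h1 (by positivity) h2
      linarith
    refine sampleLaw_deviation_le D (hH.majorities T)
      (G := ((x⁻¹) ^ d * Real.exp (x * (((k * s : ℕ) : ℝ) + (k * s : ℕ)))) ^ T) (fun p => ?_)
      (η := δ / 2 * (ε / 4)) (by positivity) (by positivity) le_rfl ?_
    · obtain ⟨V, hV, hVc⟩ := exists_patterns hd p hx0 hx1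
      obtain ⟨V', hV', hVc'⟩ := exists_patterns_majorities (T := T) p V hV
      refine ⟨V', hV', le_trans (by exact_mod_cast hVc') (?_ : ((V.card : ℝ)) ^ T ≤ _)⟩
      refine pow_le_pow_left₀ (by positivity) (hVc.trans (le_of_eq ?_)) _
      simp
    · refine log_growth_majorities_le hδ hδ1 hε (by linarith) hT1 hd1 hΛ0 hΛ ?_ hn
      have h3 : 33 * sampleOrder d β ε * ε ^ 2 =
          33 * (Real.log (1 / ε) / (1 / 2 - β) ^ 2) * d := by
        have key : ∀ u : ℝ, u ≠ 0 → 33 * (d * Real.log (1 / ε) / (u ^ 2 * ε ^ 2)) * ε ^ 2 =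
            33 * (Real.log (1 / ε) / u ^ 2) * d := fun u hu => by field_simp
        exact key _ hu.ne'
      rw [h3]
      gcongr
  calc _ ≤ sampleLaw D s ({S | ∃ h ∈ ({h'} : Set (X → Bool)),
        (1 / 2 - β) * ε / 16 < |err (mixture D) h - errCount S h / (k * s : ℕ)|} ∪
        {S | ∃ f ∈ majorities H T,
          ε / 4 < |err (mixture D) f - errCount S f / (k * s : ℕ)|}) := by
        refine measure_mono fun S hS => ?_
        rw [Set.mem_union]
        by_contra hcon
        rw [not_or] at hcon
        refine hS ⟨?_, fun f hf => ?_⟩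
        · by_contra! h
          exact hcon.1 ⟨h', rfl, h⟩
        · by_contra! h
          exact hcon.2 ⟨f, hf, h⟩
    _ ≤ ENNReal.ofReal (δ / 2) + ENNReal.ofReal (δ / 2) :=
        (measure_union_le _ _).trans (add_le_add hsingle hclass)
    _ = ENNReal.ofReal δ := by
        rw [← ENNReal.ofReal_add (by positivity) (by positivity)]
        congr 1; ring

end Main

/-! ### Choice of the parameters -/

theorem log_two_div_sq_le {β ε : ℝ} (hβ : 0 < β) (hβ2 : β < 1 / 2) (hε : 0 < ε)
    (hε2 : ε ≤ 1 / 2) : 2 ≤ Real.log (1 / ε) / (1 / 2 - β) ^ 2 := by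
  have := log_two_le_log_inv hε hε2
  have := Real.log_two_gt_d9
  have : (1 / 2 - β) ^ 2 ≤ 1 / 4 := by nlinarith
  rw [le_div_iff₀ (pow_pos (by linarith) 2)]
  linarith

theorem two_mul_le_div_sq_mul_log {β d : ℝ} (hd : 0 ≤ d) (hβ : 0 < β) (hβ2 : β < 1 / 2) :
    2 * d ≤ d / β ^ 2 * Real.log (1 / β) := by
  have := log_two_le_log_inv hβ hβ2.le
  have := Real.log_two_gt_d9
  have h : 4 * d ≤ d / β ^ 2 := by
    have : β ^ 2 ≤ 1 / 4 := by nlinarith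
    rw [le_div_iff₀ (by positivity)]
    nlinarith
  have := mul_le_mul h (by linarith : 1 / 2 ≤ Real.log (1 / β)) (by norm_num) (by positivity)
  linarith

theorem wordConst_pos {C : ℝ} (hC : 1 ≤ C) : 0 < wordConst C := by
  have : 0 ≤ Real.log (2 * C) := Real.log_nonneg (by linarith)
  rw [wordConst]
  positivity

end DistBoost

theorem theorem4 (δ : ℝ) (hδ : 0 < δ) :
    ∃ C₁ C₂ C₃ : ℝ, 0 < C₁ ∧ 0 < C₂ ∧ 0 < C₃ ∧ ∀ b : ℝ, b < 1 / 2 → ∃ C₄ : ℝ, 0 < C₄ ∧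
    ∀ (d k : ℕ) [NeZero k] (β ε : ℝ), 1 ≤ d → 0 < β → β ≤ b → 0 < ε → ε ≤ 1 / 2 →
    ∃ T m N : ℕ,
      T = ⌊C₁ * (Real.log (1 / ε) / (1 / 2 - β) ^ 2)⌋₊ ∧
      m = ⌊C₄ * (d / β ^ 2 * Real.log (1 / β))⌋₊ ∧
      N = ⌊C₂ * (sampleOrder d β ε * Real.log (sampleOrder d β ε))⌋₊ ∧
    ∀ (X : Type*) [MeasurableSpace X] (H : Set (X → Bool)) (A : Measure (X × Bool) → X → Bool)
      (D : Fin k → Measure (X × Bool)) [∀ i, IsProbabilityMeasure (D i)] (κ : ℝ),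
      vcDim H ≤ d → UniversallySeparable H → IsWeakAgnosticLearner H β A →
      2 * optErr (mixture D) H / (1 / 2 - β) + ε / 2 ≤ κ →
      κ ≤ 2 * optErr (mixture D) H / (1 / 2 - β) + 3 * ε / 4 →
      -- with high probability over the samples and the random choices of the algorithm
      sampleLaw D (N / k + 1)
          {S | ¬ ENNReal.ofReal (1 - δ) ≤
            (distBoost S A d m β (min 1 κ) T).toOuterMeasure
              {ρ | err (mixture D) (output ρ) ≤
                2 * optErr (mixture D) H / (1 / 2 - β) + ε}} ≤ ENNReal.ofReal δ ∧
      -- the costs of every possible run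
      ∀ (S : Fin k → Fin (N / k + 1) → X × Bool),
        ∀ ρ ∈ (distBoost S A d m β (min 1 κ) T).support,
          (ρ.length : ℝ) ≤ C₁ * (Real.log (1 / ε) / (1 / 2 - β) ^ 2) ∧
          ∀ r ∈ ρ,
            (r.examples : ℝ) ≤ C₄ * (d / β ^ 2 * Real.log (1 / β)) ∧
            (k ≤ N → (r.words : ℝ) ≤
              C₃ * (k * d * Real.log (d * Real.log (1 / ε) / ((1 / 2 - β) * ε)) ^ 2)) := by
  -- The estimates of the constants assume `δ ≤ 1`; a smaller `δ` only strengthens the claim.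
  set δ₁ := min δ 1 with hδ₁
  have hδ0 : 0 < δ₁ := lt_min hδ one_pos
  have hδ1 : δ₁ ≤ 1 := min_le_right _ _
  have hδδ : δ₁ ≤ δ := min_le_left _ _
  have hC₂ := sampleConst_ge_one hδ0 hδ1
  refine ⟨33, sampleConst δ₁, wordConst (sampleConst δ₁), by norm_num, by linarith,
    wordConst_pos hC₂, fun b hb => ?_⟩
  -- Taken from `b`, not from `β`, so that `C₄` serves all `β ≤ b`.
  set η := δ₁ * min 1 (1 / 2 - b) / 48 with hη
  have hb0 : 0 < min 1 (1 / 2 - b) := lt_min one_pos (by linarith)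
  have hη0 : 0 < η := by positivity
  have hη1 : η ≤ 1 := by
    have := mul_le_one₀ hδ1 hb0.le (min_le_left 1 (1 / 2 - b))
    rw [hη]; linarith
  have hC₄ := roundConst_ge_one hη0 hη1
  refine ⟨roundConst η, by linarith, fun d k _ β ε hd hβ hβb hε hε2 => ?_⟩
  have hβ2 : β < 1 / 2 := by linarith
  have hu : 0 < 1 / 2 - β := by linarith
  have hd' : (1 : ℝ) ≤ d := by exact_mod_cast hd
  have hηδ : 48 * η ≤ δ₁ * (1 / 2 - β) := by
    have : δ₁ * min 1 (1 / 2 - b) ≤ δ₁ * (1 / 2 - β) := by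
      have := min_le_right 1 (1 / 2 - b)
      gcongr
      linarith
    rw [hη]; linarith
  refine ⟨_, _, _, rfl, rfl, rfl, ?_⟩
  intro X _ H A D _ κ hvc hH hA hκ hκ'
  have hq := log_two_div_sq_le hβ hβ2 hε hε2
  set T := ⌊33 * (Real.log (1 / ε) / (1 / 2 - β) ^ 2)⌋₊ with hT
  have hTle : (T : ℝ) ≤ 33 * (Real.log (1 / ε) / (1 / 2 - β) ^ 2) :=
    Nat.floor_le (by linarith)
  have hTlt := Nat.lt_floor_add_one (33 * (Real.log (1 / ε) / (1 / 2 - β) ^ 2))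
  rw [← hT] at hTlt
  -- The regret bound needs more than `32` times the ratio; the ratio is at least `2`, so the
  -- constant `33` survives the floor.
  have hT32 : 32 * (Real.log (1 / ε) / (1 / 2 - β) ^ 2) < T := by linarith
  have hT1 : 1 ≤ T := by
    have : (0 : ℝ) < T := by linarith
    exact_mod_cast this
  have hr := two_mul_le_div_sq_mul_log (d := d) (by linarith) hβ hβ2
  have hr' := mul_le_mul_of_nonneg_left hr (by linarith : 0 ≤ roundConst η)
  have hCd : 1 ≤ roundConst η * d := one_le_mul_of_one_le_of_one_le hC₄ hd'
  set m := ⌊roundConst η * (d / β ^ 2 * Real.log (1 / β))⌋₊ with hm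
  have hmle : (m : ℝ) ≤ roundConst η * (d / β ^ 2 * Real.log (1 / β)) :=
    Nat.floor_le (by linarith)
  have hmlt := Nat.lt_floor_add_one (roundConst η * (d / β ^ 2 * Real.log (1 / β)))
  rw [← hm] at hmlt
  -- The number under the floor is at least `2 * roundConst η * d`, and `roundConst η * d ≥ 1` makes
  -- up for rounding.
  have hmd : roundConst η * d ≤ m := by linarith
  have hm0 : 0 < m := by
    have : (0 : ℝ) < m := by linarith
    exact_mod_cast this
  obtain ⟨hL, hΛ0, hΛ, hΛL⟩ := log_sampleOrder_bounds hd hβ hβ2 hε hε2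
  set N := ⌊sampleConst δ₁ * (sampleOrder d β ε * Real.log (sampleOrder d β ε))⌋₊ with hN
  have hNle : (N : ℝ) ≤ sampleConst δ₁ * (sampleOrder d β ε * Real.log (sampleOrder d β ε)) :=
    Nat.floor_le (mul_nonneg (by linarith) (mul_nonneg hΛ0.le (by linarith)))
  have hk : 0 < k := Nat.pos_of_ne_zero (NeZero.ne k)
  have hn : sampleConst δ₁ * (sampleOrder d β ε * Real.log (sampleOrder d β ε)) ≤
      (k * (N / k + 1) : ℕ) := by
    -- The sample size `k (N / k + 1)` is at least `N + 1`, hence above the real number whose floor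
    -- is `N`.
    refine (Nat.lt_floor_add_one _).le.trans ?_
    rw [← hN]
    exact_mod_cast Nat.lt_mul_div_succ N hk
  constructor
  · have hne : Nonempty H := ⟨⟨A (D 0), (hA _ inferInstance).1⟩⟩
    obtain ⟨⟨h', hh'⟩, hopt⟩ := exists_lt_of_ciInf_lt
      (lt_add_of_pos_right (optErr (mixture D) H) (by positivity : 0 < (1 / 2 - β) * ε / 16))
    refine (measure_mono ?_).trans
      ((sampleLaw_not_close_le D hd hvc hH hδ0 hδ1 hβ hβ2 hε hε2 hT1 hTle hn hh').trans
        (ENNReal.ofReal_le_ofReal hδδ))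
    refine fun S hS hclose => hS ?_
    exact (ENNReal.ofReal_le_ofReal (by linarith)).trans
      (ofReal_le_distBoost D hA hd hvc hH.1 hβ hβ2 hδ0 hε hε2 hη0 hη1 hηδ hmd hm0 hT32 hκ hκ'
        hh' hopt.le S hclose.1 hclose.2)
  · intro S ρ hρ
    obtain ⟨hlen, hcost⟩ := run_costs S ρ hρ
    refine ⟨by rw [hlen]; exact hTle, fun r hr => ?_⟩
    obtain ⟨hex, hw⟩ := hcost r hr
    refine ⟨by rw [hex]; exact hmle, fun hkN => hw.trans ?_⟩
    have hP : 0 ≤ Real.log (2 * sampleConst δ₁) + 6 := by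
      have : 0 ≤ Real.log (2 * sampleConst δ₁) := Real.log_nonneg (by linarith)
      linarith
    exact words_le_of_log_le (Nat.mul_pos hk (Nat.succ_pos _)) hd hP hL
      (log_card_le hk hkN hC₂ hΛ0 hΛ hL hΛL hNle)
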